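/- **Setting.** Consider a sequence of experiments $k=0,1,2,\dots$ with $n$ bins and data sizes (exposures) $m=m_k>0$, $m_k\to\infty$. There are two hypotheses. Under $H_0$ the mean bin counts are $\mu(\eta)=m\,\pi(\eta)$, with a nuisance parameter $\eta$ in a set of parameters in $\mathbb R^{q}$; under $H_1$ they are $\nu(\zeta)=m\,\tau(\zeta)$, with a nuisance parameter $\zeta$ in a set of parameters in $\mathbb R^{q^*}$. The per-unit means $\pi,\tau$ are positive and three times continuously differentiable in the parameters, and may depend on $k$. For data $x=(N_1,\dots,N_n)$ and predicted means $\lambda(\theta)$ let $T(\theta;x)$ be one of $$\sum_i 2\Big(\lambda_i-N_i+N_i\log\tfrac{N_i}{\lambda_i}\Big),\quad \sum_i\Big(\log\tfrac{\lambda_i}{N_i}+\tfrac{(N_i-\lambda_i)^2}{\lambda_i}\Big),\quad \sum_i\tfrac{(N_i-\lambda_i)^2}{\lambda_i},\quad \sum_i\tfrac{(N_i-\lambda_i)^2}{N_i}$$ (the Poisson, Gaussian, Pearson and Neyman forms), plus a smooth penalty $\chi^2_{\rm penalty}(\theta)\ge 0$ (possibly $0$, and possibly depending on $k$). Let $T^{\min}_{H}(x)=\inf_\theta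 T_H(\theta;x)$ and $\Delta T(x)=T^{\min}_{H_1}(x)-T^{\min}_{H_0}(x)$. Let $\chi^2_H(\theta;x)$ be the Pearson form without penalty and $D(x)=\min_\zeta\chi^2_{H_1}(\zeta;x)-\min_\eta\chi^2_{H_0}(\eta;x)$ (each minimum being read as an infimum if it is not attained), so that $D=\chi^2_{H_1}(\hat\zeta)-\chi^2_{H_0}(\hat\eta)$ for minimizers $\hat\zeta,\hat\eta$. **Assumptions ($H_0$ true).** The counts $N_i$ are independent, either all Poisson with mean $\mu^0_i$ or all $N(\mu^0_i,\mu^0_i)$, where $\mu^0=\mu(\eta^0)=m\pi^0$ and $\eta^0=\eta^0_k$ is the true parameter; $\pi^0$ is bounded and bounded away from $0$, and the penalty at $\eta^0$ is bounded. Further, $\zeta^0=\zeta^0_k$ minimizes $t(\zeta)=\sum_i(\pi^0_i-\tau_i(\zeta))^2/\tau_i(\zeta)$ regularly, uniformly in $k$: some ball of fixed radius about $\zeta^0$ lies in the parameter set, and on it the derivatives of $\tau$ of orders $1$ to $3$ and the penalty are bounded; $\tau^0=\tau(\zeta^0)$ is bounded away from $0$; for every $\varepsilon>0$, $\inf_{|\zeta-\zeta^0|\ge\varepsilon}t(\zeta)-t(\zeta^0)$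 is bounded below by a positive constant; the Hessian of $t$ at $\zeta^0$ is bounded below by a positive multiple of the identity. Finally [A0]: $\delta=\pi^0-\tau^0=O(1)$. Put $\nu^0=m\tau^0$, $\bar D=\min_\zeta\sum_i(\mu^0_i-\nu_i(\zeta))^2/\nu_i(\zeta)$, $D_1=m\sum_i\delta_i^2/\tau^0_i$, $D_2=2\sqrt m\sum_i(\delta_i/\tau^0_i)\sqrt m\,(N_i/m-\pi^0_i)$ and $s=\sum_i\delta_i^3/(\tau^0_i)^2$. Write $Y\approx N(a,v)$ if the Kolmogorov distance between the law of $Y=Y_k$ and $N(a_k,v_k)$ tends to $0$ as $k\to\infty$. **Conclusions ($H_0$ true).** 1. The minimum $\bar D$ is attained at $\zeta^0$, $D_1=\bar D=D(\mu^0)$, $\bar D=O(m)$, $D_2=O_p(\sqrt m)$, and any minimizers $\hat\zeta$ of $\chi^2_{H_1}(\cdot;X)$ satisfy $\hat\zeta-\zeta^0=O_p(m^{-1/2})$. 2. $D(X)=D_1+D_2+O_p(1)$. 3. $D_2/(2\sqrt m)\approx N(0,\bar D/m+s)$ and $D_1+D_2\approx N(\bar D,4\bar D+4ms)$. If $\bar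 D\to\infty$, then also $D(X)\approx N(\bar D,4\bar D+4ms)$. 4. For each of the four forms, $T^{\min}_{H_0}(X)$ differs from its Pearson form by $O_p(m^{-1/2})$. 5. Assume in addition CD3: $\mu^0_i-\nu^0_i=o(\mu^0_i)$ for every $i$. Then $ms=o(\bar D)$ and $D_1+D_2\approx N(\bar D,4\bar D)$. If moreover $\bar D\to\infty$, then $D(X)\approx N(\bar D,4\bar D)$, and for each of the four forms: $T^{\min}_{H_1}(X)$ differs from its Pearson form by $o_p$ of the latter, $\Delta T(X)-D(X)=o_p(D(X))$, and, with $\overline{\Delta T}_{H_0}=\Delta T(\mu^0)$, one has $\overline{\Delta T}_{H_0}\sim\bar D$ and $\Delta T(X)\approx N\big(\overline{\Delta T}_{H_0},\,4|\overline{\Delta T}_{H_0}|\big)$. **Conclusion ($H_1$ true).** If instead the data come from $H_1$ with true means $\nu(\zeta^0)$, and the assumptions above (CD3 and the divergence of the minimal deviation included) hold with the roles of $H_0$ and $H_1$ exchanged, then for each of the four forms $\Delta T(X)\approx N\big(\overline{\Delta T}_{H_1},\,4|\overline{\Delta T}_{H_1}|\big)$ with $\overline{\Delta T}_{H_1}=\Delta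 T(\nu(\zeta^0))$. -/

import Mathlib

open MeasureTheory ProbabilityTheory Filter Topology Asymptotics

/-- A hypothesis (a framework of models) for `n` bins, in a sequence of experiments `k = 0, 1, 2, …`.
It has a `q`-dimensional nuisance parameter `θ` ranging over `params`, the per-unit-of-exposure mean
count `rate k θ i` of bin `i` (positive and three times continuously differentiable in `θ`), and a
nonnegative smooth penalty term `pen k θ` (zero when no prior knowledge on `θ` is used). The
dependence on `k` allows the per-unit means to vary with the data size. -/
structure BinModel (n : ℕ) where
  q : ℕ
  params : Set (EuclideanSpace ℝ (Fin q))
  rate : ℕ → EuclideanSpace ℝ (Fin q) → Fin n → ℝ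
  pen : ℕ → EuclideanSpace ℝ (Fin q) → ℝ
  rate_pos : ∀ k, ∀ θ ∈ params, ∀ i, 0 < rate k θ i
  rate_smooth : ∀ k i, ContDiffOn ℝ 3 (fun θ => rate k θ i) params
  pen_nonneg : ∀ k, ∀ θ ∈ params, 0 ≤ pen k θ
  pen_smooth : ∀ k, ContDiffOn ℝ 3 (pen k) params

/-- The four forms of the deviation statistic. -/
inductive Form where
  | poisson
  | gaussian
  | pearson
  | neyman

/-- Contribution of a bin with observed count `N` and predicted mean `l`. -/
noncomputable def Form.term : Form → ℝ → ℝ → ℝ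
  | .poisson, N, l => 2 * (l - N + N * Real.log (N / l))
  | .gaussian, N, l => Real.log (l / N) + (N - l) ^ 2 / l
  | .pearson, N, l => (N - l) ^ 2 / l
  | .neyman, N, l => (N - l) ^ 2 / N

namespace BinModel

variable {n : ℕ}

/-- The nuisance parameter vectors of a model. -/
abbrev Param (M : BinModel n) : Type := EuclideanSpace ℝ (Fin M.q)

/-- Mean bin counts: exposure times per-unit mean counts. -/
noncomputable def mean (M : BinModel n) (m : ℕ → ℝ) (k : ℕ) (θ : M.Param) : Fin n → ℝ :=
  fun i => m k * M.rate k θ i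

/-- The Pearson chi-square of the data `x` (without penalty). -/
noncomputable def chiSq (M : BinModel n) (m : ℕ → ℝ) (k : ℕ) (θ : M.Param) (x : Fin n → ℝ) : ℝ :=
  ∑ i, (x i - M.mean m k θ i) ^ 2 / M.mean m k θ i

/-- The Pearson chi-square minimized over the nuisance parameter. -/
noncomputable def chiSqMin (M : BinModel n) (m : ℕ → ℝ) (k : ℕ) (x : Fin n → ℝ) : ℝ :=
  ⨅ θ : M.params, M.chiSq m k θ x

/-- The deviation statistic `T(θ; x)` of the given form, penalty included. -/
noncomputable def T (M : BinModel n) (m : ℕ → ℝ) (v : Form) (k : ℕ) (θ : M.Param)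
    (x : Fin n → ℝ) : ℝ :=
  (∑ i, v.term (x i) (M.mean m k θ i)) + M.pen k θ

/-- `T(θ; x)` minimized over the nuisance parameter. -/
noncomputable def Tmin (M : BinModel n) (m : ℕ → ℝ) (v : Form) (k : ℕ) (x : Fin n → ℝ) : ℝ :=
  ⨅ θ : M.params, M.T m v k θ x

/-- The per-unit Pearson deviation between the per-unit means `p` and the model at `θ`. -/
noncomputable def deviation (M : BinModel n) (k : ℕ) (p : Fin n → ℝ) (θ : M.Param) : ℝ :=
  ∑ i, (p i - M.rate k θ i) ^ 2 / M.rate k θ i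

/-- `a k` is the true nuisance parameter; the true per-unit means are stable as the data size grows
(neither tending to zero nor to infinity), and the penalty at the truth stays bounded. -/
structure IsTruth (M : BinModel n) (a : ℕ → M.Param) : Prop where
  mem : ∀ k, a k ∈ M.params
  rate_bounds : ∃ c C : ℝ, 0 < c ∧ ∀ k i, c ≤ M.rate k (a k) i ∧ M.rate k (a k) i ≤ C
  pen_bound : ∃ C : ℝ, ∀ k, M.pen k (a k) ≤ C

/-- `b k` is the nuisance parameter for which the model is the closest to the per-unit means `p k`
in Pearson deviation. It is a regular minimizer, uniformly in `k`: interior, with bounded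
derivatives near it, unique in the sense of being well separated, and with nonsingular Hessian. -/
structure IsBestFit (M : BinModel n) (p : ℕ → Fin n → ℝ) (b : ℕ → M.Param) : Prop where
  smooth_near : ∃ r C : ℝ, 0 < r ∧ ∀ k, Metric.ball (b k) r ⊆ M.params ∧
    ∀ θ ∈ Metric.ball (b k) r, M.pen k θ ≤ C ∧
      ∀ i, ∀ j ∈ Finset.Icc 1 3, ‖iteratedFDeriv ℝ j (fun θ => M.rate k θ i) θ‖ ≤ C
  rate_lower : ∃ c : ℝ, 0 < c ∧ ∀ k i, c ≤ M.rate k (b k) i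
  separated : ∀ ε : ℝ, 0 < ε → ∃ κ : ℝ, 0 < κ ∧ ∀ k, ∀ θ ∈ M.params, ε ≤ ‖θ - b k‖ →
    M.deviation k (p k) (b k) + κ ≤ M.deviation k (p k) θ
  hessian : ∃ c : ℝ, 0 < c ∧ ∀ k, ∀ v : M.Param,
    c * ‖v‖ ^ 2 ≤ iteratedFDeriv ℝ 2 (M.deviation k (p k)) (b k) ![v, v]

end BinModel

/-- `ΔT(x) = T_{H₁}^min(x) - T_{H₀}^min(x)`. -/
noncomputable def DeltaT {n : ℕ} (H₀ H₁ : BinModel n) (m : ℕ → ℝ) (v : Form) (k : ℕ)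
    (x : Fin n → ℝ) : ℝ :=
  H₁.Tmin m v k x - H₀.Tmin m v k x

/-- `D(x) = χ²_{H₁}(ζ̂) - χ²_{H₀}(η̂)`, the difference of the minimized Pearson chi-squares. -/
noncomputable def pearsonD {n : ℕ} (H₀ H₁ : BinModel n) (m : ℕ → ℝ) (k : ℕ)
    (x : Fin n → ℝ) : ℝ :=
  H₁.chiSqMin m k x - H₀.chiSqMin m k x

section Leading

variable {n : ℕ} (H₀ H₁ : BinModel n) (m : ℕ → ℝ) (η₀ : ℕ → H₀.Param) (ζ₀ : ℕ → H₁.Param)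

/-- `δ = π⁰ - τ⁰`. -/
noncomputable def rateDiff (k : ℕ) (i : Fin n) : ℝ :=
  H₀.rate k (η₀ k) i - H₁.rate k (ζ₀ k) i

/-- `D̄ = min_ν ∑ (μ⁰ᵢ - νᵢ)² / νᵢ`. -/
noncomputable def Dbar (k : ℕ) : ℝ := H₁.chiSqMin m k (H₀.mean m k (η₀ k))

/-- `D₁ = m δᵀ diag(τ⁰)⁻¹ δ`. -/
noncomputable def D₁ (k : ℕ) : ℝ :=
  m k * ∑ i, rateDiff H₀ H₁ η₀ ζ₀ k i ^ 2 / H₁.rate k (ζ₀ k) i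

/-- `D₂ = 2 √m δᵀ diag(τ⁰)⁻¹ √m (x / m - π⁰)`. -/
noncomputable def D₂ (k : ℕ) (x : Fin n → ℝ) : ℝ :=
  2 * √(m k) * ∑ i, rateDiff H₀ H₁ η₀ ζ₀ k i / H₁.rate k (ζ₀ k) i *
    (√(m k) * (x i / m k - H₀.rate k (η₀ k) i))

/-- `s = ∑ (π⁰ᵢ - τ⁰ᵢ)³ / (τ⁰ᵢ)²`. -/
noncomputable def sTerm (k : ℕ) : ℝ :=
  ∑ i, rateDiff H₀ H₁ η₀ ζ₀ k i ^ 3 / H₁.rate k (ζ₀ k) i ^ 2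

end Leading

section Stochastic

variable {Ω : ℕ → Type*} [∀ k, MeasurableSpace (Ω k)] (P : ∀ k, Measure (Ω k))

/-- The bin counts of experiment `k` are independent, with Poisson laws of means `l k i` (for all
bins and experiments) or with normal laws of means and variances `l k i`. -/
structure IsCountData {n : ℕ} (X : ∀ k, Ω k → Fin n → ℝ) (l : ℕ → Fin n → ℝ) : Prop where
  indep : ∀ k, iIndepFun (fun i ω => X k ω i) (P k)
  law : (∀ k i, HasLaw (fun ω => X k ω i)
      ((poissonMeasure (l k i).toNNReal).map (fun N : ℕ => (N : ℝ))) (P k)) ∨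
    (∀ k i, HasLaw (fun ω => X k ω i) (gaussianReal (l k i) (l k i).toNNReal) (P k))

/-- `Y = O_p(r)`. -/
def IsBigOInProb (Y : ∀ k, Ω k → ℝ) (r : ℕ → ℝ) : Prop :=
  ∀ ε : ℝ, 0 < ε → ∃ C : ℝ, ∀ᶠ k in atTop, (P k).real {ω | C * r k < |Y k ω|} ≤ ε

/-- `Y = o_p(R)`. -/
def IsLittleOInProb (Y R : ∀ k, Ω k → ℝ) : Prop :=
  ∀ ε : ℝ, 0 < ε → Tendsto (fun k => (P k).real {ω | ε * |R k ω| < |Y k ω|}) atTop (𝓝 0)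

/-- `Y` is asymptotically distributed as `N(a, v)`: the Kolmogorov distance (the supremum distance
of the distribution functions) between the law of `Y k` and `N(a k, v k)` tends to zero. -/
def ApproxNormal (Y : ∀ k, Ω k → ℝ) (a v : ℕ → ℝ) : Prop :=
  ∀ ε : ℝ, 0 < ε → ∀ᶠ k in atTop, ∀ t : ℝ,
    |(P k).real {ω | Y k ω ≤ t} - (gaussianReal (a k) (v k).toNNReal).real (Set.Iic t)| ≤ ε

end Stochastic

/-!
The counts stay within `O(√m)` of their means, except on events of small probability, and an
estimate holds in probability as soon as it holds along every sequence of outcomes for which this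
is the case. So it suffices to compare the minima for deterministic data `x` with `x - m p = O(√m)`.

Under the correct hypothesis the minima are `O(1)`, and near them the forms differ by `O(m⁻¹ᐟ²)`.
Under the other one, the minimum of `t` at `ζ⁰` and the quadratic growth around it keep every
near-minimizer within `O(m⁻¹ᐟ²)` of `ζ⁰`, up to the size of the perturbation. The data enter the
chi-square at `ζ` and at `ζ⁰` through increments that differ by `O(√m ‖ζ - ζ⁰‖)`, so the minimum
equals `D₁ + D₂` up to `O(1)`. With [CD3] the predictions at near-minimizers have relative errors
`O(ρ)`, where `ρ → 0` and `m ρ²` has the order of the minimum; there the forms differ from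
Pearson's by `O(m ρ³)`, and their derivatives in the data by `O(ρ²)`, which is negligible next to
the fluctuations of order `√m ρ`.
-/

/-! ### Normal approximation in the Kolmogorov distance -/

section Distribution

theorem gaussianReal_real_Iic_add_le (a : ℝ) (v : NNReal) (t : ℝ) {ε : ℝ} (hε : 0 ≤ ε) :
    (gaussianReal a v).real (Set.Iic (t + ε * √v)) ≤ (gaussianReal a v).real (Set.Iic t) + ε := by
  rcases eq_or_ne v 0 with rfl | hv
  · simpa using hε
  have hpdf : ∀ x, gaussianPDF a v x ≤ ENNReal.ofReal (√v)⁻¹ := fun x => by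
    refine ENNReal.ofReal_le_ofReal ((mul_le_of_le_one_right (by positivity) ?_).trans ?_)
    · exact Real.exp_le_one_iff.2 (div_nonpos_of_nonpos_of_nonneg (neg_nonpos.2 (sq_nonneg _))
        (by positivity))
    · have : (v : ℝ) ≤ 2 * Real.pi * v := le_mul_of_one_le_left v.2 (by linarith [Real.pi_gt_three])
      have : 0 < (v : ℝ) := NNReal.coe_pos.2 (pos_iff_ne_zero.2 hv)
      gcongr
  have hIoc : (gaussianReal a v).real (Set.Ioc t (t + ε * √v)) ≤ ε := by
    refine ENNReal.toReal_le_of_le_ofReal hε ?_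
    calc gaussianReal a v (Set.Ioc t (t + ε * √v))
        = ∫⁻ x in Set.Ioc t (t + ε * √v), gaussianPDF a v x := gaussianReal_apply a hv _
      _ ≤ ∫⁻ _ in Set.Ioc t (t + ε * √v), ENNReal.ofReal (√v)⁻¹ := lintegral_mono fun x => hpdf x
      _ = ENNReal.ofReal ε := by
        have : √(v : ℝ) ≠ 0 := Real.sqrt_ne_zero'.2 (NNReal.coe_pos.2 (pos_iff_ne_zero.2 hv))
        rw [lintegral_const, Measure.restrict_apply_univ, Real.volume_Ioc, add_sub_cancel_left,
          ← ENNReal.ofReal_mul (by positivity)]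
        congr 1
        field_simp
  calc (gaussianReal a v).real (Set.Iic (t + ε * √v))
      ≤ (gaussianReal a v).real (Set.Iic t ∪ Set.Ioc t (t + ε * √v)) :=
        measureReal_mono (Set.Iic_union_Ioc_eq_Iic (le_add_of_nonneg_right (by positivity))).ge
    _ ≤ _ := (measureReal_union_le _ _).trans (by gcongr)

theorem continuous_cdf (μ : Measure ℝ) [IsProbabilityMeasure μ] [NullSingletonClass μ] :
    Continuous (cdf μ) := by
  refine continuous_iff_continuousAt.2 fun t => ?_
  have hjump : cdf μ t - Function.leftLim (cdf μ) t ≤ 0 := by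
    rw [← ENNReal.ofReal_eq_zero, ← StieltjesFunction.measure_singleton, measure_cdf,
      measure_singleton]
  have hmono := (monotone_cdf μ).leftLim_le (le_refl t)
  rw [(monotone_cdf μ).continuousAt_iff_leftLim_eq_rightLim, StieltjesFunction.rightLim_eq]
  linarith

theorem tendstoLocallyUniformly_of_monotone {ι : Type*} {p : Filter ι} {F : ι → ℝ → ℝ}
    {G : ℝ → ℝ} (hF : ∀ k, Monotone (F k)) (hG : Continuous G)
    (hlim : ∀ t, Tendsto (fun k => F k t) p (𝓝 (G t))) : TendstoLocallyUniformly F G p := by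
  refine Metric.tendstoLocallyUniformly_iff.2 fun ε hε x => ?_
  have hosc : ∀ᶠ y in 𝓝 x, |G y - G x| < ε / 3 :=
    hG.continuousAt.eventually (Metric.ball_mem_nhds _ (by positivity))
  obtain ⟨δ, hδ, hball⟩ := Metric.nhds_basis_closedBall.eventually_iff.1 hosc
  rw [Real.closedBall_eq_Icc] at hball
  have hleft := abs_lt.1 (hball (Set.left_mem_Icc.2 (by linarith : x - δ ≤ x + δ)))
  have hright := abs_lt.1 (hball (Set.right_mem_Icc.2 (by linarith : x - δ ≤ x + δ)))
  refine ⟨_, Icc_mem_nhds (by linarith : x - δ < x) (by linarith : x < x + δ), ?_⟩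
  filter_upwards [Metric.tendsto_nhds.1 (hlim (x - δ)) (ε / 3) (by positivity),
    Metric.tendsto_nhds.1 (hlim (x + δ)) (ε / 3) (by positivity)] with k hl hr y hy
  have := hF k hy.1
  have := hF k hy.2
  have := abs_lt.1 (hball hy)
  rw [Real.dist_eq, abs_lt] at *
  constructor <;> linarith

theorem tendstoUniformly_of_monotone {ι : Type*} {p : Filter ι} {F : ι → ℝ → ℝ}
    {G : ℝ → ℝ} (hF : ∀ k, Monotone (F k)) (hF0 : ∀ k t, 0 ≤ F k t) (hF1 : ∀ k t, F k t ≤ 1)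
    (hG : Continuous G) (hbot : Tendsto G atBot (𝓝 0)) (htop : Tendsto G atTop (𝓝 1))
    (hlim : ∀ t, Tendsto (fun k => F k t) p (𝓝 (G t))) : TendstoUniformly F G p := by
  refine Metric.tendstoUniformly_iff.2 fun ε hε => ?_
  obtain ⟨A, hA⟩ := eventually_atBot.1 (Metric.tendsto_nhds.1 hbot (ε / 3) (by positivity))
  obtain ⟨B, hB⟩ := eventually_atTop.1 (Metric.tendsto_nhds.1 htop (ε / 3) (by positivity))
  have hmid := tendstoLocallyUniformly_iff_forall_isCompact.1
    (tendstoLocallyUniformly_of_monotone hF hG hlim) (Set.Icc A B) isCompact_Icc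
  filter_upwards [Metric.tendstoUniformlyOn_iff.1 hmid ε hε,
    Metric.tendsto_nhds.1 (hlim A) (ε / 3) (by positivity),
    Metric.tendsto_nhds.1 (hlim B) (ε / 3) (by positivity)] with k hk hkA hkB t
  simp only [Real.dist_eq, abs_lt] at *
  rcases le_total t A with htA | hAt
  · have := hF k htA
    have := hF0 k t
    have := hA t htA
    have := hA A le_rfl
    constructor <;> linarith
  rcases le_total t B with htB | hBt
  · exact hk t ⟨hAt, htB⟩
  · have := hF k hBt
    have := hF1 k t
    have := hB t hBt
    have := hB B le_rfl
    constructor <;> linarith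

variable {Ω : ℕ → Type*} [∀ k, MeasurableSpace (Ω k)] {P : ∀ k, Measure (Ω k)}

theorem ApproxNormal.const_add {Y : ∀ k, Ω k → ℝ} {a v : ℕ → ℝ} (h : ApproxNormal P Y a v)
    (b : ℕ → ℝ) :
    ApproxNormal P (fun k ω => b k + Y k ω) (fun k => b k + a k) v := by
  intro ε hε
  filter_upwards [h ε hε] with k hk t
  have hset : {ω | b k + Y k ω ≤ t} = {ω | Y k ω ≤ t - b k} := by
    ext ω
    simp only [Set.mem_ofPred_eq, le_sub_iff_add_le']
  rw [hset, add_comm (b k), ← gaussianReal_map_add_const,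
    map_measureReal_apply (by fun_prop) measurableSet_Iic, Set.preimage_add_const_Iic]
  exact hk (t - b k)

variable [∀ k, IsProbabilityMeasure (P k)]

theorem ApproxNormal.isBigOInProb_one {Z : ∀ k, Ω k → ℝ} {a v : ℝ}
    (hZ : ApproxNormal P Z (fun _ => a) fun _ => v) (hm : ∀ k, AEMeasurable (Z k) (P k)) :
    IsBigOInProb P Z fun _ => 1 := by
  intro ε hε
  have hbot := ((tendsto_cdf_atBot (gaussianReal a v.toNNReal)).comp
    tendsto_neg_atTop_atBot).eventually_lt_const (show 0 < ε / 4 by linarith)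
  have htop := (tendsto_cdf_atTop (gaussianReal a v.toNNReal)).eventually_const_lt
    (show 1 - ε / 4 < 1 by linarith)
  obtain ⟨K, hK1, hK2⟩ := (hbot.and htop).exists
  simp only [Function.comp_apply, cdf_eq_real] at hK1 hK2
  refine ⟨K, ?_⟩
  filter_upwards [hZ (ε / 4) (by linarith)] with k hk
  have hupper : (P k).real {ω | K < Z k ω} = 1 - (P k).real {ω | Z k ω ≤ K} := by
    have hmeas : NullMeasurableSet {ω | Z k ω ≤ K} (P k) :=
      (hm k).nullMeasurable measurableSet_Iic
    rw [← probReal_compl_eq_one_sub₀ hmeas]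
    congr 1
    ext ω
    simp
  calc (P k).real {ω | K * 1 < |Z k ω|}
      ≤ (P k).real ({ω | Z k ω ≤ -K} ∪ {ω | K < Z k ω}) := by
        refine measureReal_mono fun ω (hω : K * 1 < |Z k ω|) => ?_
        rcases lt_abs.1 hω with h | h
        · exact Or.inr (show K < Z k ω by linarith)
        · exact Or.inl (show Z k ω ≤ -K by linarith)
    _ ≤ (P k).real {ω | Z k ω ≤ -K} + (P k).real {ω | K < Z k ω} := measureReal_union_le _ _
    _ ≤ ε := by linarith [(abs_le.1 (hk (-K))).2, (abs_le.1 (hk K)).1]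

theorem ApproxNormal.of_sub_isLittleOInProb {Y Y' : ∀ k, Ω k → ℝ} {a v : ℕ → ℝ}
    (h : ApproxNormal P Y a v) (hv : ∀ k, 0 ≤ v k)
    (hsub : IsLittleOInProb P (fun k ω => Y' k ω - Y k ω) fun k _ => √(v k)) :
    ApproxNormal P Y' a v := by
  intro ε hε
  filter_upwards [h (ε / 3) (by positivity), (hsub (ε / 3) (by positivity)).eventually_le_const
    (show 0 < ε / 3 by positivity)] with k hk hbad t
  set s := ε / 3 * √(v k) with hs
  set B := {ω | ε / 3 * |√(v k)| < |Y' k ω - Y k ω|}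
  have hclose : ∀ ω, ω ∉ B → |Y' k ω - Y k ω| ≤ s := fun ω hω => by
    rw [hs, ← abs_of_nonneg (Real.sqrt_nonneg (v k))]
    exact not_lt.1 hω
  have hle : (P k).real {ω | Y' k ω ≤ t} ≤ (P k).real {ω | Y k ω ≤ t + s} + (P k).real B := by
    refine (measureReal_mono fun ω (hω : Y' k ω ≤ t) => ?_).trans (measureReal_union_le _ _)
    refine or_iff_not_imp_right.2 fun hB => show Y k ω ≤ t + s from ?_
    linarith [(abs_le.1 (hclose ω hB)).1]
  have hge : (P k).real {ω | Y k ω ≤ t - s} ≤ (P k).real {ω | Y' k ω ≤ t} + (P k).real B := by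
    refine (measureReal_mono fun ω (hω : Y k ω ≤ t - s) => ?_).trans (measureReal_union_le _ _)
    refine or_iff_not_imp_right.2 fun hB => show Y' k ω ≤ t from ?_
    linarith [(abs_le.1 (hclose ω hB)).2]
  have hε3 : 0 ≤ ε / 3 := by positivity
  have hup := gaussianReal_real_Iic_add_le (a k) (v k).toNNReal t hε3
  have hlow := gaussianReal_real_Iic_add_le (a k) (v k).toNNReal (t - s) hε3
  rw [Real.coe_toNNReal _ (hv k), ← hs] at hup hlow
  rw [sub_add_cancel] at hlow
  have := abs_le.1 (hk (t + s))
  have := abs_le.1 (hk (t - s))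
  rw [abs_le]
  constructor <;> linarith

end Distribution

/-! ### Stochastic orders along sequences of outcomes -/

section Transfer

variable {α : ℕ → Type*} [∀ k, Nonempty (α k)] {S : ∀ k, Set (α k)}

theorem eventually_forall_mem_of_forall_seq {p : ∀ k, α k → Prop}
    (hS : ∀ᶠ k in atTop, (S k).Nonempty)
    (h : ∀ a : ∀ k, α k, (∀ᶠ k in atTop, a k ∈ S k) → ∀ᶠ k in atTop, p k (a k)) :
    ∀ᶠ k in atTop, ∀ a ∈ S k, p k a := by
  have hbad : ∀ k, ∃ a, (S k).Nonempty → a ∈ S k ∧ (p k a → ∀ b ∈ S k, p k b) := fun k => by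
    by_cases hall : ∃ b ∈ S k, ¬ p k b
    · obtain ⟨b, hbS, hb⟩ := hall
      exact ⟨b, fun _ => ⟨hbS, fun hp => absurd hp hb⟩⟩
    · push Not at hall
      by_cases hne : (S k).Nonempty
      · exact ⟨hne.some, fun _ => ⟨hne.some_mem, fun _ => hall⟩⟩
      · exact ⟨Classical.arbitrary _, fun h => absurd h hne⟩
  choose a ha using hbad
  filter_upwards [hS, h a (hS.mono fun k hk => (ha k hk).1)] with k hk hp
  exact (ha k hk).2 hp

theorem exists_eventually_forall_mem_le_of_forall_seq {f : ∀ k, α k → ℝ} {r : ℕ → ℝ}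
    (hS : ∀ᶠ k in atTop, (S k).Nonempty)
    (h : ∀ a : ∀ k, α k, (∀ᶠ k in atTop, a k ∈ S k) → (fun k => f k (a k)) =O[atTop] r) :
    ∃ C, ∀ᶠ k in atTop, ∀ a ∈ S k, |f k a| ≤ C * |r k| := by
  classical
  let exceeds (k N : ℕ) (a : α k) : Prop := N * |r k| < |f k a|
  have hworst : ∀ k, ∃ a, (S k).Nonempty → a ∈ S k ∧
      ∀ N ≤ k, (∃ b ∈ S k, exceeds k N b) → exceeds k N a := fun k => by
    by_cases hex : ∃ N ≤ k, ∃ b ∈ S k, exceeds k N b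
    · obtain ⟨N, hNk, hN⟩ := hex
      obtain ⟨a, haS, ha⟩ :=
        Nat.findGreatest_spec (P := fun N => ∃ b ∈ S k, exceeds k N b) hNk hN
      refine ⟨a, fun _ => ⟨haS, fun N' hN'k hN' => lt_of_le_of_lt ?_ ha⟩⟩
      gcongr
      exact Nat.le_findGreatest hN'k hN'
    · push Not at hex
      by_cases hne : (S k).Nonempty
      · refine ⟨hne.some, fun _ => ⟨hne.some_mem, fun N hN ⟨b, hb, hNb⟩ => ?_⟩⟩
        exact absurd hNb (hex N hN b hb)
      · exact ⟨Classical.arbitrary _, fun h => absurd h hne⟩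
  choose a ha using hworst
  obtain ⟨C, hC⟩ := (h a (hS.mono fun k hk => (ha k hk).1)).bound
  obtain ⟨N, hN⟩ := exists_nat_ge C
  refine ⟨N, ?_⟩
  filter_upwards [hS, hC, eventually_ge_atTop N] with k hk hkC hkN b hb
  by_contra! hcon
  have hlt : N * |r k| < |f k (a k)| := (ha k hk).2 N hkN ⟨b, hb, hcon⟩
  refine absurd (hlt.trans_le hkC) (not_lt.2 ?_)
  simp only [Real.norm_eq_abs]
  gcongr

end Transfer

section InProbability

variable {Ω : ℕ → Type*} [∀ k, MeasurableSpace (Ω k)] {P : ∀ k, Measure (Ω k)}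
  [∀ k, IsProbabilityMeasure (P k)] {A Y R : ∀ k, Ω k → ℝ} {r s : ℕ → ℝ}

theorem IsBigOInProb.exists_eventually_prob_compl_le (hA : IsBigOInProb P A r) {ε : ℝ}
    (hε : 0 < ε) :
    ∃ S : ∀ k, Set (Ω k), (∀ᶠ k in atTop, (P k).real (S k)ᶜ ≤ ε) ∧
      (∀ᶠ k in atTop, (S k).Nonempty) ∧
      ∀ ω : ∀ k, Ω k, (∀ᶠ k in atTop, ω k ∈ S k) → (fun k => A k (ω k)) =O[atTop] r := by
  obtain ⟨C, hC⟩ := hA (min ε (1 / 2)) (by positivity)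
  refine ⟨fun k => {ω | |A k ω| ≤ C * r k}, ?_, ?_, fun ω hω => ?_⟩
  · filter_upwards [hC] with k hk
    simpa only [Set.compl_ofPred, not_le] using hk.trans (min_le_left _ _)
  · filter_upwards [hC] with k hk
    by_contra! hempty
    have huniv : {ω | C * r k < |A k ω|} = Set.univ := by
      rw [← Set.compl_empty, ← hempty]
      ext ω
      simp
    rw [huniv, probReal_univ] at hk
    linarith [min_le_right ε (1 / 2)]
  · refine IsBigO.of_bound |C| (hω.mono fun k hk => ?_)
    rw [Real.norm_eq_abs, Real.norm_eq_abs, ← abs_mul]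
    exact le_trans hk (le_abs_self _)

theorem IsBigOInProb.isBigOInProb_of_forall_seq (hA : IsBigOInProb P A r) (hs : ∀ k, 0 ≤ s k)
    (h : ∀ ω : ∀ k, Ω k, (fun k => A k (ω k)) =O[atTop] r → (fun k => Y k (ω k)) =O[atTop] s) :
    IsBigOInProb P Y s := by
  intro ε hε
  have := fun k => nonempty_of_isProbabilityMeasure (P k)
  obtain ⟨S, hPS, hS, hSA⟩ := hA.exists_eventually_prob_compl_le hε
  obtain ⟨C, hC⟩ := exists_eventually_forall_mem_le_of_forall_seq hS fun ω hω => h ω (hSA ω hω)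
  refine ⟨C, ?_⟩
  filter_upwards [hPS, hC] with k hPk hk
  refine (measureReal_mono ?_).trans hPk
  intro ω (hω : C * s k < |Y k ω|) hωS
  have := hk ω hωS
  rw [abs_of_nonneg (hs k)] at this
  linarith

theorem IsBigOInProb.isLittleOInProb_of_forall_seq (hA : IsBigOInProb P A r)
    (h : ∀ ω : ∀ k, Ω k, (fun k => A k (ω k)) =O[atTop] r →
      (fun k => Y k (ω k)) =o[atTop] fun k => R k (ω k)) :
    IsLittleOInProb P Y R := by
  intro δ hδ
  refine tendsto_order.2 ⟨fun a ha => .of_forall fun k => ha.trans_le measureReal_nonneg,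
    fun ε hε => ?_⟩
  have := fun k => nonempty_of_isProbabilityMeasure (P k)
  obtain ⟨S, hPS, hS, hSA⟩ := hA.exists_eventually_prob_compl_le (half_pos hε)
  have hle := eventually_forall_mem_of_forall_seq (p := fun k ω => |Y k ω| ≤ δ * |R k ω|) hS
    fun ω hω => (h ω (hSA ω hω)).bound hδ
  filter_upwards [hPS, hle] with k hPk hk
  refine lt_of_le_of_lt ((measureReal_mono ?_).trans hPk) (half_lt_self hε)
  intro ω (hω : δ * |R k ω| < |Y k ω|) hωS
  exact absurd hω (not_lt.2 (hk ω hωS))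

end InProbability

section Variance

theorem approxNormal_gaussianReal (a : ℕ → ℝ) {v : ℕ → ℝ} (hv : ∀ k, 0 ≤ v k) :
    ApproxNormal (fun _ => gaussianReal 0 1) (fun k z => a k + √(v k) * z) a v := by
  intro ε hε
  refine .of_forall fun k t => ?_
  have hmap : gaussianReal (a k) (v k).toNNReal =
      (gaussianReal 0 1).map fun z => a k + √(v k) * z := by
    have hcomp : (fun z => a k + √(v k) * z) = (a k + ·) ∘ (√(v k) * ·) := rfl
    rw [hcomp, ← Measure.map_map (by fun_prop) (by fun_prop), gaussianReal_map_const_mul,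
      gaussianReal_map_const_add, mul_zero, zero_add, mul_one]
    congr 1
    ext
    simp [Real.sq_sqrt, hv k]
  rw [hmap, map_measureReal_apply (by fun_prop) measurableSet_Iic]
  simpa [Set.preimage] using hε.le

theorem isLittleO_sqrt_sub_sqrt {v w : ℕ → ℝ} (hv : ∀ k, 0 ≤ v k) (hw : ∀ k, 0 ≤ w k)
    (h : v ~[atTop] w) : (fun k => √(v k) - √(w k)) =o[atTop] fun k => √(w k) := by
  have habs : (fun k => √|v k - w k|) =o[atTop] fun k => √(w k) :=
    (isLittleO_abs_left.2 h.isLittleO).sqrt (.of_forall hw)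
  refine IsBigO.trans_isLittleO (IsBigO.of_bound' (.of_forall fun k => ?_)) habs
  rw [Real.norm_eq_abs, Real.norm_of_nonneg (Real.sqrt_nonneg _)]
  refine Real.le_sqrt_of_sq_le ?_
  have hv' := Real.sqrt_nonneg (v k)
  have hw' := Real.sqrt_nonneg (w k)
  have hfactor : (√(v k) - √(w k)) * (√(v k) + √(w k)) = v k - w k := by
    linear_combination Real.sq_sqrt (hv k) - Real.sq_sqrt (hw k)
  rw [← hfactor, abs_mul, sq]
  refine mul_le_mul_of_nonneg_left ?_ (abs_nonneg _)
  rw [abs_of_nonneg (add_nonneg hv' hw'), abs_le]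
  constructor <;> linarith

theorem ApproxNormal.congr_variance {Ω : ℕ → Type*} [∀ k, MeasurableSpace (Ω k)]
    {P : ∀ k, Measure (Ω k)} {Y : ∀ k, Ω k → ℝ} {a v w : ℕ → ℝ} (h : ApproxNormal P Y a v)
    (hv : ∀ k, 0 ≤ v k) (hw : ∀ k, 0 ≤ w k) (hvw : v ~[atTop] w) : ApproxNormal P Y a w := by
  have hbounded : IsBigOInProb (fun _ => gaussianReal 0 1) (fun _ z => z) fun _ => 1 := by
    refine ApproxNormal.isBigOInProb_one (a := 0) (v := 1) ?_ fun _ => aemeasurable_id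
    simpa using approxNormal_gaussianReal (fun _ => 0) (v := fun _ => 1) fun _ => zero_le_one
  have hlaws : ApproxNormal (fun _ => gaussianReal 0 1) (fun k z => a k + √(w k) * z) a v := by
    refine (approxNormal_gaussianReal a hv).of_sub_isLittleOInProb hv
      (hbounded.isLittleOInProb_of_forall_seq fun z hz => ?_)
    simpa [sub_mul] using (isLittleO_sqrt_sub_sqrt hw hv hvw.symm).mul_isBigO hz
  intro ε hε
  filter_upwards [h (ε / 3) (by positivity), hlaws (ε / 3) (by positivity),
    approxNormal_gaussianReal a hw (ε / 3) (by positivity)] with k hY hlaw hgauss t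
  have := abs_le.1 (hY t)
  have := abs_le.1 (hlaw t)
  have := abs_le.1 (hgauss t)
  rw [abs_le]
  constructor <;> linarith

end Variance

/-! ### The central limit theorem for the counts -/

section CentralLimit

open Complex

theorem charFun_map_sub_div (μ : Measure ℝ) (b s t : ℝ) :
    charFun (μ.map fun x => (x - b) / s) t = charFun μ (t / s) * cexp (-(b * (t / s)) * I) := by
  have hcomp : (fun x => (x - b) / s) = (· + -(b / s)) ∘ (s⁻¹ * ·) := by
    ext x
    simp only [Function.comp_apply]
    ring
  rw [hcomp, ← Measure.map_map (by fun_prop) (by fun_prop), charFun_map_add_const,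
    charFun_map_mul, ← div_eq_inv_mul, Real.inner_apply]
  push_cast
  ring_nf

theorem isBigO_cexp_mul_I_sub_taylor :
    (fun y : ℝ => cexp (y * I) - (1 + y * I - y ^ 2 / 2)) =O[𝓝 0] fun y => y ^ 3 := by
  have hlim : Tendsto (fun y : ℝ => (y : ℂ) * I) (𝓝 0) (𝓝 0) := by
    simpa using (continuous_ofReal.mul_const I).tendsto (0 : ℝ)
  have h := ((Complex.exp_sub_sum_range_isBigO_pow 3).comp_tendsto hlim).norm_right
  simp only [Function.comp_def, Finset.sum_range_succ, norm_pow, norm_mul, norm_I, norm_real] at h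
  refine (h.congr (fun y => ?_) fun y => ?_).trans (isBigO_refl _ _).norm_left
  · simp [Nat.factorial, mul_pow]
    ring
  · rw [mul_one, norm_pow]

theorem tendsto_mul_cexp_sub_taylor {l u : ℕ → ℝ} (hl : Tendsto l atTop atTop)
    (hu : u =O[atTop] fun _ => (1 : ℝ)) :
    Tendsto (fun k => (l k : ℂ) * (cexp ((u k / √(l k) : ℝ) * I) -
      (1 + (u k / √(l k) : ℝ) * I - ((u k / √(l k) : ℝ) : ℂ) ^ 2 / 2))) atTop (𝓝 0) := by
  have hinv : (fun k => (√(l k))⁻¹) =o[atTop] fun _ => (1 : ℝ) :=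
    (isLittleO_one_iff ℝ).2 (Real.tendsto_sqrt_atTop.comp hl).inv_tendsto_atTop
  have hlim : Tendsto (fun k => u k / √(l k)) atTop (𝓝 0) := by
    rw [← isLittleO_one_iff ℝ]
    simpa [div_eq_mul_inv] using hu.mul_isLittleO hinv
  have htaylor := (isBigO_ofReal_left.2 (isBigO_refl l atTop)).mul
    (isBigO_cexp_mul_I_sub_taylor.comp_tendsto hlim)
  have hrate : (fun k => l k * (u k / √(l k)) ^ 3) =o[atTop] fun _ => (1 : ℝ) := by
    refine ((hu.pow 3).mul_isLittleO hinv).congr' ?_ (.of_forall fun k => by simp)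
    filter_upwards [hl.eventually_gt_atTop 0] with k hk
    have := Real.sqrt_pos.2 hk
    nth_rewrite 2 [← Real.mul_self_sqrt hk.le]
    field_simp
  exact (isLittleO_one_iff ℝ).1 (htaylor.trans_isLittleO hrate)

theorem charFun_poisson_standardized {l : ℝ} (hl : 0 < l) (t : ℝ) :
    charFun (((poissonMeasure l.toNNReal).map fun N : ℕ => (N : ℝ)).map fun x => (x - l) / √l) t *
      cexp (t ^ 2 / 2) =
    cexp (l * (cexp ((t / √l : ℝ) * I) - (1 + (t / √l : ℝ) * I - ((t / √l : ℝ) : ℂ) ^ 2 / 2))) := by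
  have hsq : (l : ℂ) * ((t / √l : ℝ) : ℂ) ^ 2 = (t : ℂ) ^ 2 := by
    have hreal : l * (t / √l) ^ 2 = t ^ 2 := by
      rw [div_pow, Real.sq_sqrt hl.le, mul_div_cancel₀ _ hl.ne']
    exact_mod_cast congrArg ofReal hreal
  have hcoe : ((l.toNNReal : NNReal) : ℂ) = (l : ℂ) := by
    exact_mod_cast congrArg ofReal (Real.coe_toNNReal _ hl.le)
  rw [charFun_map_sub_div, charFun_map_cast_poissonMeasure, ← Complex.exp_add, ← Complex.exp_add,
    hcoe, ← hsq]
  congr 1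
  push_cast
  ring

theorem charFun_gaussian_standardized {l : ℝ} (hl : 0 < l) (t : ℝ) :
    charFun ((gaussianReal l l.toNNReal).map fun x => (x - l) / √l) t * cexp (t ^ 2 / 2) = 1 := by
  have hsq : (√l : ℂ) ^ 2 = l := by exact_mod_cast congrArg ofReal (Real.sq_sqrt hl.le)
  have hs : (√l : ℂ) ≠ 0 := ofReal_ne_zero.2 (Real.sqrt_ne_zero'.2 hl)
  have hcoe : ((l.toNNReal : NNReal) : ℂ) = (l : ℂ) := by
    exact_mod_cast congrArg ofReal (Real.coe_toNNReal _ hl.le)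
  rw [charFun_map_sub_div, charFun_gaussianReal, ← Complex.exp_add, ← Complex.exp_add,
    ← Complex.exp_zero, hcoe, ← hsq]
  congr 1
  push_cast
  field_simp
  ring

variable {n : ℕ} {Ω : ℕ → Type*} [∀ k, MeasurableSpace (Ω k)] {P : ∀ k, Measure (Ω k)}
  {X : ∀ k, Ω k → Fin n → ℝ} {l : ℕ → Fin n → ℝ}

theorem gaussianReal_zero_var_real_Iic {Ω : Type*} [MeasurableSpace Ω] (P : Measure Ω)
    [IsProbabilityMeasure P] (a t : ℝ) :
    (gaussianReal a 0).real (Set.Iic t) = P.real {_ω | a ≤ t} := by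
  rw [gaussianReal_zero_var]
  by_cases hat : a ≤ t <;> simp [hat, Measure.real]

theorem approxNormal_zero [∀ k, IsProbabilityMeasure (P k)] :
    ApproxNormal P (fun _ _ => 0) (fun _ => 0) fun _ => 0 := fun ε hε => .of_forall fun k t => by
  rw [Real.toNNReal_zero, gaussianReal_zero_var_real_Iic (P k), sub_self, abs_zero]
  exact hε.le

theorem ApproxNormal.const_mul [∀ k, IsProbabilityMeasure (P k)] {Z : ∀ k, Ω k → ℝ}
    (h : ApproxNormal P Z (fun _ => 0) fun _ => 1) {s : ℕ → ℝ} (hs : ∀ k, 0 ≤ s k) :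
    ApproxNormal P (fun k ω => s k * Z k ω) (fun _ => 0) fun k => s k ^ 2 := fun ε hε => by
  filter_upwards [h ε hε] with k hk t
  rcases (hs k).eq_or_lt with hzero | hpos
  · simp only [← hzero, zero_mul]
    rw [zero_pow two_ne_zero, Real.toNNReal_zero, gaussianReal_zero_var_real_Iic (P k), sub_self,
      abs_zero]
    exact hε.le
  · have hset : {ω | s k * Z k ω ≤ t} = {ω | Z k ω ≤ t / s k} :=
      Set.ext fun ω => (le_div_iff₀' hpos).symm
    have hpre : (s k * ·) ⁻¹' Set.Iic t = Set.Iic (t / s k) :=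
      Set.ext fun x => (le_div_iff₀' hpos).symm
    have hmap : (gaussianReal 0 (Real.toNNReal 1)).map (s k * ·) =
        gaussianReal 0 (s k ^ 2).toNNReal := by
      rw [gaussianReal_map_const_mul]
      congr 1
      · simp
      · ext
        simp [sq_nonneg]
    rw [hset, ← hmap, map_measureReal_apply (by fun_prop) measurableSet_Iic, hpre]
    exact hk _

theorem approxNormal_of_tendsto_charFun [∀ k, IsProbabilityMeasure (P k)] {Y : ∀ k, Ω k → ℝ}
    (hY : ∀ k, AEMeasurable (Y k) (P k)) {a v : ℝ} (hv : 0 < v)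
    (h : ∀ t, Tendsto (fun k => charFun ((P k).map (Y k)) t) atTop
      (𝓝 (charFun (gaussianReal a v.toNNReal) t))) :
    ApproxNormal P Y (fun _ => a) fun _ => v := by
  have := nullSingletonClass_gaussianReal (μ := a) (Real.toNNReal_pos.2 hv).ne'
  have hprob := fun k => Measure.isProbabilityMeasure_map (μ := P k) (hY k)
  let laws : ℕ → ProbabilityMeasure ℝ := fun k => ⟨(P k).map (Y k), hprob k⟩
  let limit : ProbabilityMeasure ℝ := ⟨gaussianReal a v.toNNReal, inferInstance⟩
  have hweak : Tendsto laws atTop (𝓝 limit) := ProbabilityMeasure.tendsto_of_tendsto_charFun h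
  have hcdf : ∀ t, Tendsto (fun k => cdf ((P k).map (Y k)) t) atTop
      (𝓝 (cdf (gaussianReal a v.toNNReal) t)) := fun t => by
    have hfrontier : gaussianReal a v.toNNReal (frontier (Set.Iic t)) = 0 := by
      rw [frontier_Iic, measure_singleton]
    have hIic := ProbabilityMeasure.tendsto_measure_of_null_frontier_of_tendsto' hweak hfrontier
    simp only [cdf_eq_real]
    exact (ENNReal.tendsto_toReal (measure_ne_top _ _)).comp hIic
  have hunif := tendstoUniformly_of_monotone (fun k => monotone_cdf ((P k).map (Y k)))
    (fun k t => cdf_nonneg _ t) (fun k t => cdf_le_one _ t) (continuous_cdf _)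
    (tendsto_cdf_atBot _) (tendsto_cdf_atTop _) hcdf
  intro ε hε
  filter_upwards [Metric.tendstoUniformly_iff.1 hunif ε hε] with k hk t
  have := hk t
  rw [dist_comm, Real.dist_eq, cdf_eq_real, cdf_eq_real,
    map_measureReal_apply_of_aemeasurable (hY k) measurableSet_Iic] at this
  exact this.le

theorem isBigOInProb_norm_pi [∀ k, IsProbabilityMeasure (P k)] {Y : ∀ k, Ω k → Fin n → ℝ}
    {r : ℕ → ℝ} (hr : ∀ k, 0 ≤ r k) (hY : ∀ i, IsBigOInProb P (fun k ω => Y k ω i) r) :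
    IsBigOInProb P (fun k ω => ‖Y k ω‖) r := by
  intro ε hε
  have hε' : 0 < ε / (n + 1) := by positivity
  choose C hC using fun i => hY i _ hε'
  have hle : ∀ i, C i ≤ ∑ i, |C i| := fun i => (le_abs_self _).trans
    (Finset.single_le_sum (f := fun i => |C i|) (fun _ _ => abs_nonneg _) (Finset.mem_univ i))
  refine ⟨∑ i, |C i|, ?_⟩
  filter_upwards [eventually_all.2 hC] with k hk
  have hsub : {ω | (∑ i, |C i|) * r k < |‖Y k ω‖|} ⊆ ⋃ i, {ω | C i * r k < |Y k ω i|} := by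
    intro ω hω
    contrapose! hω
    simp only [Set.mem_iUnion, Set.mem_ofPred_eq, not_exists, not_lt, abs_norm] at hω ⊢
    refine (pi_norm_le_iff_of_nonneg (mul_nonneg (by positivity) (hr k))).2 fun i => ?_
    exact (hω i).trans (mul_le_mul_of_nonneg_right (hle i) (hr k))
  calc (P k).real {ω | (∑ i, |C i|) * r k < |‖Y k ω‖|}
      ≤ ∑ i, (P k).real {ω | C i * r k < |Y k ω i|} :=
        (measureReal_mono hsub).trans (measureReal_iUnion_fintype_le _)
    _ ≤ ∑ _i : Fin n, ε / (n + 1) := Finset.sum_le_sum fun i _ => hk i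
    _ ≤ ε := by
        rw [Finset.sum_const, Finset.card_univ, Fintype.card_fin, nsmul_eq_mul, ← mul_div_assoc,
          div_le_iff₀ (by positivity)]
        linarith

namespace IsCountData

theorem aemeasurable (h : IsCountData P X l) (k : ℕ) (i : Fin n) :
    AEMeasurable (fun ω => X k ω i) (P k) :=
  h.law.elim (fun h => (h k i).aemeasurable) fun h => (h k i).aemeasurable

theorem tendsto_charFun_standardized (h : IsCountData P X l) {i : Fin n}
    (hl : Tendsto (fun k => l k i) atTop atTop) {u : ℕ → ℝ} (hu : u =O[atTop] fun _ => (1 : ℝ)) :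
    Tendsto (fun k => charFun ((P k).map fun ω => (X k ω i - l k i) / √(l k i)) (u k) *
      cexp (u k ^ 2 / 2)) atTop (𝓝 1) := by
  have hmap : ∀ k, (P k).map (fun ω => (X k ω i - l k i) / √(l k i)) =
      ((P k).map fun ω => X k ω i).map fun x => (x - l k i) / √(l k i) := fun k => by
    rw [AEMeasurable.map_map_of_aemeasurable (by fun_prop) (h.aemeasurable k i)]
    rfl
  simp only [hmap]
  rcases h.law with hlaw | hlaw
  · have hexp := (continuous_exp.tendsto _).comp (tendsto_mul_cexp_sub_taylor hl hu)
    rw [Complex.exp_zero] at hexp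
    refine hexp.congr' ?_
    filter_upwards [hl.eventually_gt_atTop 0] with k hk
    rw [(hlaw k i).map_eq, charFun_poisson_standardized hk, Function.comp_apply]
  · refine tendsto_const_nhds.congr' ?_
    filter_upwards [hl.eventually_gt_atTop 0] with k hk
    rw [(hlaw k i).map_eq, charFun_gaussian_standardized hk]

variable [∀ k, IsProbabilityMeasure (P k)]

theorem approxNormal_sum_of_sum_sq_eq_one (h : IsCountData P X l)
    (hl : ∀ i, Tendsto (fun k => l k i) atTop atTop) {w : ℕ → Fin n → ℝ}
    (hw : ∀ k, ∑ i, w k i ^ 2 = 1) :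
    ApproxNormal P (fun k ω => ∑ i, w k i * ((X k ω i - l k i) / √(l k i)))
      (fun _ => 0) (fun _ => 1) := by
  let Z : ∀ k, Fin n → Ω k → ℝ := fun k i ω => (X k ω i - l k i) / √(l k i)
  have hZmeas : ∀ k i, AEMeasurable (Z k i) (P k) := fun k i =>
    ((h.aemeasurable k i).sub_const _).div_const _
  have hwZmeas : ∀ k i, AEMeasurable (fun ω => w k i * Z k i ω) (P k) := fun k i =>
    (hZmeas k i).const_mul _
  refine approxNormal_of_tendsto_charFun (fun k => Finset.aemeasurable_fun_sum _ fun i _ =>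
    hwZmeas k i) one_pos fun t => ?_
  have hbounded : ∀ i, (fun k => w k i * t) =O[atTop] fun _ => (1 : ℝ) := fun i => by
    refine IsBigO.of_bound |t| (.of_forall fun k => ?_)
    have : w k i ^ 2 ≤ 1 := (Finset.single_le_sum
      (f := fun i => w k i ^ 2) (fun _ _ => sq_nonneg _) (Finset.mem_univ i)).trans (hw k).le
    rw [norm_mul, norm_one, mul_one]
    exact mul_le_of_le_one_left (norm_nonneg _) (abs_le_one_iff_mul_self_le_one.2 (by linarith))
  have hprod := (tendsto_finsetProd Finset.univ fun i _ =>
    h.tendsto_charFun_standardized (hl i) (hbounded i)).mul_const (cexp (-(t ^ 2 / 2)))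
  have hlimit : charFun (gaussianReal 0 (1 : ℝ).toNNReal) t =
      (∏ _i : Fin n, (1 : ℂ)) * cexp (-(t ^ 2 / 2)) := by
    simp [charFun_gaussianReal]
  rw [hlimit]
  refine hprod.congr fun k => ?_
  have hind : iIndepFun (fun i ω => w k i * Z k i ω) (P k) :=
    (h.indep k).comp (fun i x => w k i * ((x - l k i) / √(l k i))) fun i => by fun_prop
  have hscale : ∀ i, charFun ((P k).map fun ω => w k i * Z k i ω) t =
      charFun ((P k).map (Z k i)) (w k i * t) := fun i => by
    rw [← charFun_map_mul, AEMeasurable.map_map_of_aemeasurable (by fun_prop) (hZmeas k i)]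
    rfl
  have hsum : ∑ i, ((w k i * t : ℝ) : ℂ) ^ 2 / 2 = (t : ℂ) ^ 2 / 2 := by
    have hreal : ∑ i, (w k i * t) ^ 2 / 2 = t ^ 2 / 2 := by
      simp only [mul_pow, ← Finset.sum_div, ← Finset.sum_mul, hw, one_mul]
    exact_mod_cast congrArg ofReal hreal
  rw [hind.charFun_map_fun_sum_eq_prod (hwZmeas k), Finset.prod_apply, Finset.prod_mul_distrib,
    ← Complex.exp_sum, hsum, mul_assoc, ← Complex.exp_add, add_neg_cancel, Complex.exp_zero,
    mul_one]
  exact Finset.prod_congr rfl fun i _ => (hscale i).symm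

theorem approxNormal_sum (h : IsCountData P X l) (hl : ∀ i, Tendsto (fun k => l k i) atTop atTop)
    (w : ℕ → Fin n → ℝ) :
    ApproxNormal P (fun k ω => ∑ i, w k i * ((X k ω i - l k i) / √(l k i)))
      (fun _ => 0) (fun k => ∑ i, w k i ^ 2) := by
  rcases isEmpty_or_nonempty (Fin n) with hn | ⟨⟨j⟩⟩
  · simpa only [Finset.univ_eq_empty, Finset.sum_empty] using approxNormal_zero
  have hnonneg : ∀ k, 0 ≤ ∑ i, w k i ^ 2 := fun k => Finset.sum_nonneg fun i _ => sq_nonneg _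
  let unit : ℕ → Fin n → ℝ := fun k i =>
    if ∑ i, w k i ^ 2 = 0 then Pi.single (M := fun _ => ℝ) j 1 i else w k i / √(∑ i, w k i ^ 2)
  have hunit : ∀ k, ∑ i, unit k i ^ 2 = 1 := fun k => by
    by_cases hk : ∑ i, w k i ^ 2 = 0
    · simp [unit, hk, Pi.single_apply]
    · simp only [unit, hk, if_false, div_pow, Real.sq_sqrt (hnonneg k), ← Finset.sum_div]
      exact div_self hk
  have hw : ∀ k i, √(∑ i, w k i ^ 2) * unit k i = w k i := fun k i => by
    by_cases hk : ∑ i, w k i ^ 2 = 0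
    · have hzero := (Finset.sum_eq_zero_iff_of_nonneg fun i _ => sq_nonneg (w k i)).1 hk i
        (Finset.mem_univ i)
      simp [hk, pow_eq_zero_iff two_ne_zero |>.1 hzero]
    · simp only [unit, hk, if_false]
      exact mul_div_cancel₀ _ (Real.sqrt_ne_zero'.2 ((hnonneg k).lt_of_ne' hk))
  have hscaled := (h.approxNormal_sum_of_sum_sq_eq_one hl hunit).const_mul
    (s := fun k => √(∑ i, w k i ^ 2)) fun k => Real.sqrt_nonneg _
  simpa only [Finset.mul_sum, ← mul_assoc, hw, Real.sq_sqrt, hnonneg] using hscaled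

theorem isBigOInProb_norm_sub (h : IsCountData P X l)
    (hl : ∀ i, Tendsto (fun k => l k i) atTop atTop) {m : ℕ → ℝ}
    (hlm : ∀ i, (fun k => l k i) =O[atTop] m) (hm : ∀ k, 0 ≤ m k) :
    IsBigOInProb P (fun k ω => ‖X k ω - l k‖) fun k => √(m k) := by
  refine isBigOInProb_norm_pi (fun k => Real.sqrt_nonneg _) fun i => ?_
  have hZ : IsBigOInProb P (fun k ω => (X k ω i - l k i) / √(l k i)) fun _ => 1 := by
    refine ApproxNormal.isBigOInProb_one (a := 0) (v := 1) ?_ fun k =>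
      ((h.aemeasurable k i).sub_const _).div_const _
    simpa [ite_pow] using h.approxNormal_sum hl fun _ j => if j = i then 1 else 0
  refine hZ.isBigOInProb_of_forall_seq (fun k => Real.sqrt_nonneg _) fun ω hω => ?_
  refine ((hω.mul ((hlm i).sqrt (.of_forall hm))).congr' ?_ ?_)
  · filter_upwards [(hl i).eventually_gt_atTop 0] with k hk
    exact div_mul_cancel₀ _ (Real.sqrt_ne_zero'.2 hk)
  · exact .of_forall fun k => one_mul _

end IsCountData

end CentralLimit

/-! ### The four forms in a single bin -/

theorem abs_log_one_add_sub_self_le {w : ℝ} (hw : |w| ≤ 1 / 2) :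
    |Real.log (1 + w) - w| ≤ 2 * w ^ 2 := by
  have h := Real.abs_log_sub_add_sum_range_le (x := -w) (by rw [abs_neg]; linarith) 1
  simp only [Finset.sum_range_one, zero_add, pow_one, abs_neg, sub_neg_eq_add, Nat.cast_zero,
    div_one] at h
  rw [neg_add_eq_sub] at h
  refine h.trans ((div_le_iff₀ (by linarith)).2 ?_)
  rw [one_add_one_eq_two, sq_abs]
  nlinarith [sq_nonneg w]

namespace Form

variable {N l : ℝ}

theorem hasDerivAt_term_pearson (N l : ℝ) :
    HasDerivAt (fun N => pearson.term N l) (2 * (N - l) / l) N := by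
  simpa [term] using (((hasDerivAt_id N).sub_const l).pow 2).div_const l

theorem hasDerivAt_term_poisson (hN : 0 < N) (hl : 0 < l) :
    HasDerivAt (fun N => poisson.term N l) (2 * Real.log (N / l)) N := by
  have hlog := ((hasDerivAt_id N).div_const l).log (div_pos hN hl).ne'
  refine ((((hasDerivAt_id N).const_sub l).add
    ((hasDerivAt_id N).mul hlog)).const_mul 2).congr_deriv ?_
  simp only [id]
  field_simp
  ring

theorem hasDerivAt_term_gaussian (hN : 0 < N) (hl : 0 < l) :
    HasDerivAt (fun N => gaussian.term N l) (2 * (N - l) / l - N⁻¹) N := by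
  have hlog := ((hasDerivAt_inv hN.ne').const_mul l).log (div_pos hl hN).ne'
  refine (hlog.add (hasDerivAt_term_pearson N l)).congr_deriv ?_
  field_simp
  ring

theorem hasDerivAt_term_neyman (hN : 0 < N) :
    HasDerivAt (fun N => neyman.term N l) (1 - (l / N) ^ 2) N := by
  refine ((((hasDerivAt_id N).sub_const l).pow 2).div (hasDerivAt_id N) hN.ne').congr_deriv ?_
  simp only [id, Pi.pow_apply]
  field_simp
  ring

theorem exists_hasDerivAt_term (v : Form) (hN : 0 < N) (hl : 0 < l)
    (h : |(N - l) / l| ≤ 1 / 2) :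
    ∃ d, HasDerivAt (fun N => v.term N l) d N ∧
      |d - 2 * (N - l) / l| ≤ 16 * ((N - l) / l) ^ 2 + 2 / l := by
  have hl2 : 0 ≤ 2 / l := by positivity
  have hw : N / l = 1 + (N - l) / l := by field_simp; ring
  have hNl : l / 2 ≤ N := by
    have := (abs_le.1 h).1
    rw [le_div_iff₀ hl] at this
    linarith
  cases v with
  | poisson =>
    refine ⟨_, hasDerivAt_term_poisson hN hl, ?_⟩
    have hlog := abs_log_one_add_sub_self_le h
    rw [← hw] at hlog
    rw [mul_div_assoc, ← mul_sub, abs_mul, abs_two]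
    nlinarith [sq_nonneg ((N - l) / l)]
  | gaussian =>
    refine ⟨_, hasDerivAt_term_gaussian hN hl, ?_⟩
    rw [sub_sub_cancel_left, abs_neg, abs_of_pos (inv_pos.2 hN)]
    have : N⁻¹ ≤ 2 / l := by
      rw [inv_eq_one_div, div_le_div_iff₀ hN hl]
      linarith
    nlinarith [sq_nonneg ((N - l) / l)]
  | pearson =>
    refine ⟨_, hasDerivAt_term_pearson N l, ?_⟩
    rw [sub_self, abs_zero]
    positivity
  | neyman =>
    refine ⟨_, hasDerivAt_term_neyman hN, ?_⟩
    have hident : 1 - (l / N) ^ 2 - 2 * (N - l) / l =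
        -((1 + 2 * (N / l)) * ((N - l) / l) ^ 2 / (N / l) ^ 2) := by
      field_simp
      ring
    have hcoef : 1 + 2 * (N / l) ≤ 16 * (N / l) ^ 2 := by
      have : 1 / 2 ≤ N / l := by rw [le_div_iff₀ hl]; linarith
      nlinarith
    rw [hident, abs_neg, abs_of_nonneg (by positivity), div_le_iff₀ (by positivity)]
    have := mul_le_mul_of_nonneg_right hcoef (sq_nonneg ((N - l) / l))
    nlinarith [mul_nonneg hl2 (sq_nonneg (N / l))]

theorem term_self (v : Form) (l : ℝ) : v.term l l = 0 := by
  cases v <;> simp [term]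

theorem abs_term_sub_pearson_sub_le (v : Form) (hl : 0 < l) {x y ρ : ℝ} (hρ : ρ ≤ 1 / 2)
    (hx : |x - l| ≤ ρ * l) (hy : |y - l| ≤ ρ * l) :
    |(v.term x l - pearson.term x l) - (v.term y l - pearson.term y l)| ≤
      (16 * ρ ^ 2 + 2 / l) * |x - y| := by
  have hderiv : ∀ N ∈ Metric.closedBall l (ρ * l), ∃ d,
      HasDerivAt (fun N => v.term N l - pearson.term N l) d N ∧ |d| ≤ 16 * ρ ^ 2 + 2 / l := by
    intro N hN
    rw [Metric.mem_closedBall, Real.dist_eq] at hN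
    have hw : |(N - l) / l| ≤ ρ := by rwa [abs_div, abs_of_pos hl, div_le_iff₀ hl]
    have hNpos : 0 < N := by nlinarith [abs_le.1 hN]
    obtain ⟨d, hd, hle⟩ := v.exists_hasDerivAt_term hNpos hl (hw.trans hρ)
    refine ⟨_, hd.sub (hasDerivAt_term_pearson N l), hle.trans ?_⟩
    gcongr 16 * ?_ + _
    rw [← sq_abs]
    gcongr
  choose! d hd hle using hderiv
  have := (convex_closedBall l (ρ * l)).norm_image_sub_le_of_norm_hasDerivWithin_le
    (fun N hN => (hd N hN).hasDerivWithinAt) hle (Metric.mem_closedBall.2 hy)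
    (Metric.mem_closedBall.2 hx)
  simpa only [Real.norm_eq_abs] using this

theorem sq_sub_le_sq_sub_sq_div {a b c : ℝ} (hc : 0 < c) (h : c ≤ a + b) :
    (a - b) ^ 2 ≤ (a ^ 2 - b ^ 2) ^ 2 / c ^ 2 := by
  rw [le_div_iff₀ (by positivity), sq_sub_sq, mul_pow, mul_comm]
  gcongr

theorem sq_sub_half_sub_one_le_term_gaussian {a b : ℝ} (ha : 0 < a) (ha2 : 2 ≤ a ^ 2) (hb : 0 < b) :
    (a - b) ^ 2 / 2 - 1 ≤ gaussian.term (a ^ 2) (b ^ 2) := by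
  have hlog : Real.log (b ^ 2 / a ^ 2) = 2 * Real.log (b / a) := by
    rw [← div_pow, Real.log_pow, Nat.cast_two]
  rw [term, hlog]
  rcases le_total a b with hab | hab
  · have hchi := sq_sub_le_sq_sub_sq_div hb (show b ≤ a + b by linarith)
    have := Real.log_nonneg ((one_le_div ha).2 hab)
    linarith [sq_nonneg (a - b)]
  · set g := (a - b) / b with hg
    have hab' : a - b = g * b := by rw [hg, div_mul_cancel₀ _ hb.ne']
    have hlower : -g ≤ Real.log (b / a) := by
      have := Real.one_sub_inv_le_log_of_pos (div_pos hb ha)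
      rwa [inv_div, ← neg_sub, div_sub_one hb.ne', ← hg] at this
    have hchi : (a ^ 2 - b ^ 2) ^ 2 / b ^ 2 = g ^ 2 * (a + b) ^ 2 := by
      rw [sq_sub_sq, mul_pow, hab', mul_pow]
      field_simp
    have hsq : g ^ 2 * a ^ 2 ≤ g ^ 2 * (a + b) ^ 2 := by gcongr; linarith
    have hsq' : g ^ 2 * b ^ 2 ≤ g ^ 2 * a ^ 2 := by gcongr
    rw [hchi, hab', mul_pow]
    nlinarith [sq_nonneg (g - 1), mul_le_mul_of_nonneg_left ha2 (sq_nonneg g)]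

/-- The logarithm of the Gaussian form costs the constant and the restriction to counts at least
two. -/
theorem sqrt_sub_sqrt_sq_le_term (v : Form) (hN : 2 ≤ N) (hl : 0 < l) :
    (√N - √l) ^ 2 / 2 - 1 ≤ v.term N l := by
  have ha : 0 < √N := Real.sqrt_pos.2 (by linarith)
  have hb : 0 < √l := Real.sqrt_pos.2 hl
  obtain ⟨hN2, hl2⟩ : √N ^ 2 = N ∧ √l ^ 2 = l := ⟨Real.sq_sqrt (by linarith), Real.sq_sqrt hl.le⟩
  generalize √N = a, √l = b at *
  subst hN2 hl2
  cases v with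
  | poisson =>
    have hlog : Real.log (a ^ 2 / b ^ 2) = 2 * Real.log (a / b) := by
      rw [← div_pow, Real.log_pow, Nat.cast_two]
    have hlower := Real.one_sub_inv_le_log_of_pos (div_pos ha hb)
    rw [inv_div] at hlower
    have hprod : a ^ 2 * (1 - b / a) = a ^ 2 - a * b := by field_simp
    have := mul_le_mul_of_nonneg_left hlower (sq_nonneg a)
    rw [term, hlog]
    nlinarith [sq_nonneg (a - b)]
  | gaussian => exact sq_sub_half_sub_one_le_term_gaussian ha hN hb
  | pearson =>
    have := sq_sub_le_sq_sub_sq_div hb (show b ≤ a + b by linarith)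
    rw [term]
    linarith [sq_nonneg (a - b)]
  | neyman =>
    have := sq_sub_le_sq_sub_sq_div ha (show a ≤ a + b by linarith)
    rw [term]
    linarith [sq_nonneg (a - b)]

end Form

section Sequences

variable {m ρ x y l : ℕ → ℝ}

theorem isBigO_sum_of_nonneg {ι : Type*} [Fintype ι] {f : ℕ → ι → ℝ} (hf : ∀ k i, 0 ≤ f k i)
    (i : ι) : (fun k => f k i) =O[atTop] fun k => ∑ j, f k j :=
  .of_norm_le fun k => (Real.norm_of_nonneg (hf k i)).trans_le
    (Finset.single_le_sum (fun j _ => hf k j) (Finset.mem_univ i))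

theorem isTheta_and_sub_isBigO_of_sqrt_sub_sqrt (hm0 : ∀ k, 0 < m k) (hx0 : ∀ᶠ k in atTop, 0 ≤ x k)
    (hl0 : ∀ k, 0 < l k) (hx : x =Θ[atTop] m) (hρ : ρ =o[atTop] fun _ => (1 : ℝ))
    (h : (fun k => √(x k) - √(l k)) =O[atTop] fun k => √(m k) * ρ k) :
    l =Θ[atTop] m ∧ (fun k => x k - l k) =O[atTop] fun k => m k * ρ k := by
  have hsqrt : (fun k => √(x k)) =Θ[atTop] fun k => √(m k) :=
    ⟨hx.1.sqrt (.of_forall fun k => (hm0 k).le), hx.2.sqrt hx0⟩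
  have hsmall : (fun k => √(m k) * ρ k) =o[atTop] fun k => √(x k) := by
    have := (isBigO_refl (fun k => √(m k)) atTop).mul_isLittleO hρ
    simp only [mul_one] at this
    exact this.trans_isBigO hsqrt.2
  have hlx : (fun k => √(l k)) ~[atTop] fun k => √(x k) :=
    (h.trans_isLittleO hsmall).neg_left.congr_left fun k => neg_sub _ _
  have hsqrtl : (fun k => √(l k)) =Θ[atTop] fun k => √(m k) := hlx.isTheta.trans hsqrt
  refine ⟨?_, ?_⟩
  · simpa only [Real.sq_sqrt (hl0 _).le, Real.sq_sqrt (hm0 _).le] using hsqrtl.pow 2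
  · refine (h.mul (hsqrt.1.add hsqrtl.1)).congr' ?_ (.of_forall fun k => ?_)
    · filter_upwards [hx0] with k hk
      linear_combination Real.sq_sqrt hk - Real.sq_sqrt (hl0 k).le
    · linear_combination ρ k * Real.sq_sqrt (hm0 k).le

theorem inv_sqrt_isLittleO_one (hm : Tendsto m atTop atTop) :
    (fun k => (√(m k))⁻¹) =o[atTop] fun _ => (1 : ℝ) :=
  (isLittleO_one_iff ℝ).2 (tendsto_inv_atTop_zero.comp (Real.tendsto_sqrt_atTop.comp hm))

theorem mul_inv_sqrt_pow_two (hm0 : ∀ k, 0 < m k) (k : ℕ) : m k * (√(m k))⁻¹ ^ 2 = 1 := by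
  rw [inv_pow, Real.sq_sqrt (hm0 k).le, mul_inv_cancel₀ (hm0 k).ne']

theorem sqrt_isBigO_mul (hmρ : (fun k => (√(m k))⁻¹) =O[atTop] ρ) :
    (fun k => √(m k)) =O[atTop] fun k => m k * ρ k := by
  refine ((isBigO_refl m atTop).mul hmρ).congr_left fun k => ?_
  rw [← div_eq_mul_inv, Real.div_sqrt]

theorem one_isBigO_mul_sq (hm0 : ∀ k, 0 < m k) (hmρ : (fun k => (√(m k))⁻¹) =O[atTop] ρ) :
    (fun _ => (1 : ℝ)) =O[atTop] fun k => m k * ρ k ^ 2 :=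
  ((isBigO_refl m atTop).mul (hmρ.pow 2)).congr_left (mul_inv_sqrt_pow_two hm0)

theorem one_isLittleO_mul_sq (hm0 : ∀ k, 0 < m k) (hmρ : (fun k => (√(m k))⁻¹) =o[atTop] ρ) :
    (fun _ => (1 : ℝ)) =o[atTop] fun k => m k * ρ k ^ 2 :=
  ((isBigO_refl m atTop).mul_isLittleO (hmρ.pow two_pos)).congr_left (mul_inv_sqrt_pow_two hm0)

theorem one_isLittleO_sqrt_mul (hm0 : ∀ k, 0 < m k) (hmρ : (fun k => (√(m k))⁻¹) =o[atTop] ρ) :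
    (fun _ => (1 : ℝ)) =o[atTop] fun k => √(m k) * ρ k :=
  ((isBigO_refl (fun k => √(m k)) atTop).mul_isLittleO hmρ).congr_left fun k =>
    mul_inv_cancel₀ (Real.sqrt_pos.2 (hm0 k)).ne'

theorem mul_cube_isLittleO (hρ : ρ =o[atTop] fun _ => (1 : ℝ)) :
    (fun k => m k * ρ k ^ 3) =o[atTop] fun k => m k * ρ k ^ 2 :=
  ((isBigO_refl (fun k => m k * ρ k ^ 2) atTop).mul_isLittleO hρ).congr
    (fun k => by ring) fun k => mul_one _

theorem Form.term_sub_pearson_sub_isBigO (v : Form) (hm0 : ∀ k, 0 < m k) (hl0 : ∀ k, 0 < l k)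
    (hl : m =O[atTop] l) (hρ : ρ =o[atTop] fun _ => (1 : ℝ))
    (hmρ : (fun k => (√(m k))⁻¹) =O[atTop] ρ)
    (hx : (fun k => x k - l k) =O[atTop] fun k => m k * ρ k)
    (hy : (fun k => y k - l k) =O[atTop] fun k => m k * ρ k) :
    (fun k => (v.term (x k) (l k) - pearson.term (x k) (l k)) -
      (v.term (y k) (l k) - pearson.term (y k) (l k))) =O[atTop]
      fun k => ρ k ^ 2 * (x k - y k) := by
  have hlρ : (fun k => m k * ρ k) =O[atTop] fun k => ρ k * l k := by
    simpa only [mul_comm] using hl.mul (isBigO_refl ρ atTop)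
  obtain ⟨C, hC⟩ := (hx.trans hlρ).isBigOWith
  obtain ⟨C', hC'⟩ := (hy.trans hlρ).isBigOWith
  set σ : ℕ → ℝ := fun k => max C C' * |ρ k|
  have hσ : ∀ᶠ k in atTop, σ k ≤ 1 / 2 := by
    have : Tendsto σ atTop (𝓝 (max C C' * 0)) := by
      simpa only [abs_zero] using ((isLittleO_one_iff ℝ).1 hρ).abs.const_mul (max C C')
    exact this.eventually (ge_mem_nhds (by norm_num))
  have hinv : (fun k => 2 / l k) =O[atTop] fun k => ρ k ^ 2 := by
    have : (fun k => (l k)⁻¹) =O[atTop] fun k => (m k)⁻¹ :=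
      hl.inv_rev (.of_forall fun k hk => absurd hk (hm0 k).ne')
    refine ((this.const_mul_left 2).trans ((hmρ.pow 2).congr_left fun k => ?_)).congr_left
      fun k => (div_eq_mul_inv _ _).symm
    rw [inv_pow, Real.sq_sqrt (hm0 k).le]
  have hbound : (fun k => 16 * σ k ^ 2 + 2 / l k) =O[atTop] fun k => ρ k ^ 2 := by
    refine IsBigO.add (.of_bound (16 * max C C' ^ 2) (.of_forall fun k => ?_)) hinv
    rw [mul_pow, sq_abs, ← mul_assoc, norm_mul, Real.norm_of_nonneg (by positivity)]
  refine IsBigO.trans (.of_norm_eventuallyLE ?_)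
    (hbound.mul (isBigO_refl (fun k => x k - y k) atTop)).norm_left
  filter_upwards [hσ, hC.bound, hC'.bound] with k hk hxk hyk
  simp only [norm_mul, Real.norm_eq_abs, abs_of_pos (hl0 k)] at hxk hyk ⊢
  have h0 : 0 ≤ |ρ k| * l k := mul_nonneg (abs_nonneg _) (hl0 k).le
  have hl2 : 0 ≤ 2 / l k := div_nonneg zero_le_two (hl0 k).le
  rw [abs_of_nonneg (by positivity : 0 ≤ 16 * σ k ^ 2 + 2 / l k)]
  exact v.abs_term_sub_pearson_sub_le (hl0 k) hk
    (by rw [mul_assoc]; exact hxk.trans (by gcongr; exact le_max_left _ _))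
    (by rw [mul_assoc]; exact hyk.trans (by gcongr; exact le_max_right _ _))

end Sequences

/-! ### Fits to data near the means -/

section Counts

variable {n : ℕ} {m : ℕ → ℝ} {p x : ℕ → Fin n → ℝ}

/-- Per-unit means that stay away from zero and from infinity as the data size grows. -/
def IsStableRate (p : ℕ → Fin n → ℝ) : Prop :=
  ∃ c C : ℝ, 0 < c ∧ ∀ k i, c ≤ p k i ∧ p k i ≤ C

/-- Data within `O(√m)` of the mean counts `m p`, the size of their statistical fluctuations. -/
def IsNear (m : ℕ → ℝ) (p x : ℕ → Fin n → ℝ) : Prop :=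
  ∀ i, (fun k => x k i - m k * p k i) =O[atTop] fun k => √(m k)

theorem IsStableRate.pos (hp : IsStableRate p) (k : ℕ) (i : Fin n) : 0 < p k i := by
  obtain ⟨c, C, hc, h⟩ := hp
  exact hc.trans_le (h k i).1

theorem IsStableRate.isTheta_one (hp : IsStableRate p) (i : Fin n) :
    (fun k => p k i) =Θ[atTop] fun _ => (1 : ℝ) := by
  have hpos := hp.pos
  obtain ⟨c, C, hc, h⟩ := hp
  refine ⟨.of_bound C (.of_forall fun k => ?_), .of_bound c⁻¹ (.of_forall fun k => ?_)⟩
  · rw [norm_one, mul_one, Real.norm_of_nonneg (hpos k i).le]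
    exact (h k i).2
  · rw [norm_one, Real.norm_of_nonneg (hpos k i).le, inv_mul_eq_div, one_le_div hc]
    exact (h k i).1

theorem IsStableRate.isTheta_mul (hp : IsStableRate p) (i : Fin n) :
    (fun k => m k * p k i) =Θ[atTop] m := by
  have := (isTheta_refl m atTop).mul (hp.isTheta_one i)
  simpa only [mul_one] using this

theorem isNear_of_norm_isBigO
    (h : (fun k => ‖x k - fun i => m k * p k i‖) =O[atTop] fun k => √(m k)) : IsNear m p x :=
  fun i => isBigO_pi.1 h.of_norm_left i

theorem isNear_mul (m : ℕ → ℝ) (p : ℕ → Fin n → ℝ) : IsNear m p fun k i => m k * p k i :=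
  fun _ => (isBigO_zero _ _).congr_left fun _ => (sub_self _).symm

theorem sqrt_isLittleO (hm : Tendsto m atTop atTop) : (fun k => √(m k)) =o[atTop] m := by
  have h1 : (fun _ => (1 : ℝ)) =o[atTop] fun k => √(m k) :=
    (isLittleO_const_left_of_ne one_ne_zero).2
      (tendsto_norm_atTop_atTop.comp (Real.tendsto_sqrt_atTop.comp hm))
  refine ((isBigO_refl (fun k => √(m k)) atTop).mul_isLittleO h1).congr' (by simp [EventuallyEq]) ?_
  filter_upwards [hm.eventually_ge_atTop 0] with k hk using Real.mul_self_sqrt hk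

theorem IsNear.isEquivalent (hx : IsNear m p x) (hp : IsStableRate p) (hm : Tendsto m atTop atTop)
    (i : Fin n) : (fun k => x k i) ~[atTop] fun k => m k * p k i :=
  ((hx i).trans_isLittleO (sqrt_isLittleO hm)).trans_isBigO (hp.isTheta_mul i).2

theorem IsNear.isTheta (hx : IsNear m p x) (hp : IsStableRate p) (hm : Tendsto m atTop atTop)
    (i : Fin n) : (fun k => x k i) =Θ[atTop] m :=
  (hx.isEquivalent hp hm i).isTheta.trans (hp.isTheta_mul i)

theorem IsStableRate.tendsto_mul (hp : IsStableRate p) (hm0 : ∀ k, 0 < m k)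
    (hm : Tendsto m atTop atTop) (i : Fin n) : Tendsto (fun k => m k * p k i) atTop atTop := by
  obtain ⟨c, C, hc, h⟩ := hp
  exact tendsto_atTop_mono (fun k => mul_le_mul_of_nonneg_left (h k i).1 (hm0 k).le)
    (hm.atTop_mul_const hc)

theorem IsNear.eventually_two_le (hx : IsNear m p x) (hp : IsStableRate p) (hm0 : ∀ k, 0 < m k)
    (hm : Tendsto m atTop atTop) : ∀ᶠ k in atTop, ∀ i, 2 ≤ x k i :=
  eventually_all.2 fun i =>
    ((hx.isEquivalent hp hm i).symm.tendsto_atTop (hp.tendsto_mul hm0 hm i)).eventually_ge_atTop 2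

end Counts

section Infimum

variable {α : Type*} {ε : ℝ}

theorem exists_le_and_le_ciInf_add (f : α → ℝ) (a : α) (hε : 0 < ε) :
    ∃ t, f t ≤ f a ∧ f t ≤ (⨅ z, f z) + ε := by
  have : Nonempty α := ⟨a⟩
  obtain ⟨z, hz⟩ := exists_lt_of_ciInf_lt (lt_add_of_pos_right (⨅ z, f z) hε)
  rcases le_total (f z) (f a) with h | h
  exacts [⟨z, h, hz.le⟩, ⟨a, le_rfl, h.trans hz.le⟩]

theorem exists_abs_ciInf_sub_ciInf_sub_le (f g : α → ℝ) (d : ℝ) (a : α) (hε : 0 < ε) :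
    ∃ t s, f t ≤ f a ∧ g s ≤ g a ∧ (BddBelow (Set.range f) → BddBelow (Set.range g) →
      |(⨅ z, f z) - (⨅ z, g z) - d| ≤ |f t - g t - d| + |f s - g s - d| + ε) := by
  obtain ⟨t, hta, ht⟩ := exists_le_and_le_ciInf_add f a hε
  obtain ⟨s, hsa, hs⟩ := exists_le_and_le_ciInf_add g a hε
  refine ⟨t, s, hta, hsa, fun hf hg => abs_le.2 ⟨?_, ?_⟩⟩
  · linarith [ciInf_le hg t, neg_abs_le (f t - g t - d), abs_nonneg (f s - g s - d)]
  · linarith [ciInf_le hf s, le_abs_self (f s - g s - d), abs_nonneg (f t - g t - d)]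

end Infimum

namespace BinModel

variable {n : ℕ} {M : BinModel n} {m ρ u : ℕ → ℝ} {p x y : ℕ → Fin n → ℝ} {θ : ℕ → M.Param}

/-- The parameters `θ` predict mean counts of the order of `m` that fit the data `x` up to a
relative error `O(ρ)`. -/
structure IsFit (M : BinModel n) (m ρ : ℕ → ℝ) (x : ℕ → Fin n → ℝ) (θ : ℕ → M.Param) : Prop where
  mem : ∀ k, θ k ∈ M.params
  isTheta_mean : ∀ i, (fun k => M.mean m k (θ k) i) =Θ[atTop] m
  sub_isBigO : ∀ i, (fun k => x k i - M.mean m k (θ k) i) =O[atTop] fun k => m k * ρ k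

theorem mean_pos {k : ℕ} (hm0 : 0 < m k) {θ : M.Param} (hθ : θ ∈ M.params) (i : Fin n) :
    0 < M.mean m k θ i :=
  mul_pos hm0 (M.rate_pos k θ hθ i)

theorem chiSq_nonneg {k : ℕ} (hm0 : 0 < m k) {θ : M.Param} (hθ : θ ∈ M.params) (x : Fin n → ℝ) :
    0 ≤ M.chiSq m k θ x :=
  Finset.sum_nonneg fun i _ => div_nonneg (sq_nonneg _) (mean_pos hm0 hθ i).le

theorem bddBelow_chiSq {k : ℕ} (hm0 : 0 < m k) (x : Fin n → ℝ) :
    BddBelow (Set.range fun θ : M.params => M.chiSq m k θ x) :=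
  ⟨0, Set.forall_mem_range.2 fun θ => chiSq_nonneg hm0 θ.2 x⟩

theorem T_pearson (k : ℕ) (θ : M.Param) (x : Fin n → ℝ) :
    M.T m .pearson k θ x = M.chiSq m k θ x + M.pen k θ := rfl

theorem sum_sqrt_sub_sqrt_sq_le_T (v : Form) {k : ℕ} (hm0 : 0 < m k) {θ : M.Param}
    (hθ : θ ∈ M.params) {x : Fin n → ℝ} (hx : ∀ i, 2 ≤ x i) :
    ∑ i, (√(x i) - √(M.mean m k θ i)) ^ 2 / 2 - n ≤ M.T m v k θ x := by
  have hterm := Finset.sum_le_sum fun i (_ : i ∈ Finset.univ) =>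
    v.sqrt_sub_sqrt_sq_le_term (hx i) (mean_pos hm0 hθ i)
  have hpen := M.pen_nonneg k θ hθ
  rw [Finset.sum_sub_distrib, Finset.sum_const, Finset.card_univ, Fintype.card_fin, nsmul_one]
    at hterm
  rw [T]
  linarith

theorem bddBelow_T (v : Form) {k : ℕ} (hm0 : 0 < m k) {x : Fin n → ℝ} (hx : ∀ i, 2 ≤ x i) :
    BddBelow (Set.range fun θ : M.params => M.T m v k θ x) := by
  refine ⟨-n, Set.forall_mem_range.2 fun θ => ?_⟩
  have := sum_sqrt_sub_sqrt_sq_le_T v hm0 θ.2 hx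
  have : 0 ≤ ∑ i, (√(x i) - √(M.mean m k θ i)) ^ 2 / 2 :=
    Finset.sum_nonneg fun i _ => by positivity
  linarith

theorem isFit_of_T_le (v : Form) (hm0 : ∀ k, 0 < m k) (hm : Tendsto m atTop atTop)
    (hp : IsStableRate p) (hx : IsNear m p x) (hρ : ρ =o[atTop] fun _ => (1 : ℝ))
    (hmρ : (fun k => (√(m k))⁻¹) =O[atTop] ρ) (hθ : ∀ k, θ k ∈ M.params)
    (hT : ∀ k, M.T m v k (θ k) (x k) ≤ u k) (hu : u =O[atTop] fun k => m k * ρ k ^ 2) :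
    M.IsFit m ρ x θ := by
  have hx2 := hx.eventually_two_le hp hm0 hm
  suffices hsqrt : ∀ i, (fun k => √(x k i) - √(M.mean m k (θ k) i)) =O[atTop]
      fun k => √(m k) * ρ k by
    have hfit := fun i => isTheta_and_sub_isBigO_of_sqrt_sub_sqrt hm0
      (hx2.mono fun k hk => by linarith [hk i]) (fun k => mean_pos (hm0 k) (hθ k) i)
      (hx.isTheta hp hm i) hρ (hsqrt i)
    exact ⟨hθ, fun i => (hfit i).1, fun i => (hfit i).2⟩
  intro i
  have hsq : (fun k => (√(x k i) - √(M.mean m k (θ k) i)) ^ 2) =O[atTop]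
      fun k => (√(m k) * ρ k) ^ 2 := by
    have hbound : (fun k => 2 * (u k + n * 1)) =O[atTop] fun k => m k * ρ k ^ 2 :=
      (hu.add ((one_isBigO_mul_sq hm0 hmρ).const_mul_left n)).const_mul_left 2
    simp only [mul_pow, Real.sq_sqrt (hm0 _).le]
    refine IsBigO.trans (.of_norm_eventuallyLE ?_) hbound
    filter_upwards [hx2] with k hk
    have := sum_sqrt_sub_sqrt_sq_le_T v (hm0 k) (hθ k) hk
    have := Finset.single_le_sum (f := fun i => (√(x k i) - √(M.mean m k (θ k) i)) ^ 2 / 2)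
      (fun i _ => by positivity) (Finset.mem_univ i)
    rw [Real.norm_of_nonneg (sq_nonneg _)]
    linarith [hT k]
  exact hsq.of_pow two_ne_zero

theorem T_sub_T_pearson_sub_isBigO (v : Form) (hm0 : ∀ k, 0 < m k)
    (hρ : ρ =o[atTop] fun _ => (1 : ℝ)) (hmρ : (fun k => (√(m k))⁻¹) =O[atTop] ρ)
    (hx : M.IsFit m ρ x θ) (hy : M.IsFit m ρ y θ)
    (hxy : ∀ i, (fun k => x k i - y k i) =O[atTop] u) :
    (fun k => (M.T m v k (θ k) (x k) - M.T m .pearson k (θ k) (x k)) -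
      (M.T m v k (θ k) (y k) - M.T m .pearson k (θ k) (y k))) =O[atTop]
      fun k => ρ k ^ 2 * u k := by
  refine (IsBigO.fun_sum fun i (_ : i ∈ Finset.univ) =>
    (v.term_sub_pearson_sub_isBigO hm0 (fun k => mean_pos (hm0 k) (hx.mem k) i)
      (hx.isTheta_mean i).2 hρ hmρ (hx.sub_isBigO i) (hy.sub_isBigO i)).trans
        ((isBigO_refl _ _).mul (hxy i))).congr_left fun k => ?_
  simp only [Finset.sum_sub_distrib, T]
  ring

theorem T_mean (v : Form) (k : ℕ) (θ : M.Param) : M.T m v k θ (M.mean m k θ) = M.pen k θ := by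
  simp only [T, Form.term_self, Finset.sum_const_zero, zero_add]

theorem T_sub_T_pearson_isBigO (v : Form) (hm0 : ∀ k, 0 < m k)
    (hρ : ρ =o[atTop] fun _ => (1 : ℝ)) (hmρ : (fun k => (√(m k))⁻¹) =O[atTop] ρ)
    (hx : M.IsFit m ρ x θ) :
    (fun k => M.T m v k (θ k) (x k) - M.T m .pearson k (θ k) (x k)) =O[atTop]
      fun k => m k * ρ k ^ 3 := by
  have := T_sub_T_pearson_sub_isBigO v hm0 hρ hmρ hx
    ⟨hx.mem, hx.isTheta_mean, fun i => (isBigO_zero _ _).congr_left fun k => (sub_self _).symm⟩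
    hx.sub_isBigO
  simp only [T_mean, sub_self, sub_zero] at this
  exact this.congr_right fun k => by ring

theorem IsFit.chiSq_isBigO (hm0 : ∀ k, 0 < m k) (hx : M.IsFit m ρ x θ) :
    (fun k => M.chiSq m k (θ k) (x k)) =O[atTop] fun k => m k * ρ k ^ 2 := by
  refine IsBigO.fun_sum fun i _ => ?_
  have hinv : (fun k => (M.mean m k (θ k) i)⁻¹) =O[atTop] fun k => (m k)⁻¹ :=
    (hx.isTheta_mean i).2.inv_rev (.of_forall fun k hk => absurd hk (hm0 k).ne')
  refine (((hx.sub_isBigO i).pow 2).mul hinv).congr_right fun k => ?_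
  have := (hm0 k).ne'
  field_simp

theorem chiSq_sub_chiSq_sub_isBigO {θ' : ℕ → M.Param} (hm0 : ∀ k, 0 < m k)
    (hm : Tendsto m atTop atTop) (hp : IsStableRate p) (hx : IsNear m p x)
    (hθ : ∀ i, (fun _ => (1 : ℝ)) =O[atTop] fun k => M.rate k (θ k) i)
    (hθ' : ∀ i, (fun _ => (1 : ℝ)) =O[atTop] fun k => M.rate k (θ' k) i)
    (hθ0 : ∀ k, θ k ∈ M.params) (hθ'0 : ∀ k, θ' k ∈ M.params) :
    (fun k => (M.chiSq m k (θ k) (x k) - M.chiSq m k (θ k) fun i => m k * p k i) -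
      (M.chiSq m k (θ' k) (x k) - M.chiSq m k (θ' k) fun i => m k * p k i)) =O[atTop]
      fun k => √(m k) * ‖M.rate k (θ k) - M.rate k (θ' k)‖ := by
  have hinv : ∀ {f : ℕ → ℝ}, (fun _ => (1 : ℝ)) =O[atTop] f →
      (fun k => (f k)⁻¹) =O[atTop] fun _ => (1 : ℝ) := fun hf => by
    simpa only [inv_one] using hf.inv_rev (.of_forall fun k hk => absurd hk one_ne_zero)
  have hbin : ∀ i, (fun k => (x k i - m k * p k i) * ((x k i + m k * p k i) * (m k)⁻¹) *
      ((M.rate k (θ' k) - M.rate k (θ k)) i * ((M.rate k (θ k) i)⁻¹ * (M.rate k (θ' k) i)⁻¹)))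
      =O[atTop] fun k => √(m k) * ‖M.rate k (θ k) - M.rate k (θ' k)‖ := by
    intro i
    have hsum : (fun k => (x k i + m k * p k i) * (m k)⁻¹) =O[atTop] fun _ => (1 : ℝ) :=
      (((hx.isTheta hp hm i).1.add (hp.isTheta_mul i).1).mul (isBigO_refl _ _)).congr_right
        fun k => mul_inv_cancel₀ (hm0 k).ne'
    have hdiff : (fun k => (M.rate k (θ' k) - M.rate k (θ k)) i) =O[atTop]
        fun k => ‖M.rate k (θ k) - M.rate k (θ' k)‖ :=
      .of_norm_le fun k => (norm_le_pi_norm _ i).trans_eq (norm_sub_rev _ _)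
    refine (((hx i).mul hsum).mul (hdiff.mul ((hinv (hθ i)).mul (hinv (hθ' i))))).congr_right
      fun k => by ring
  refine (IsBigO.fun_sum fun i (_ : i ∈ Finset.univ) => hbin i).congr_left fun k => ?_
  simp only [chiSq, mean, ← Finset.sum_sub_distrib]
  refine Finset.sum_congr rfl fun i _ => ?_
  have h1 := (M.rate_pos k _ (hθ0 k) i).ne'
  have h2 := (M.rate_pos k _ (hθ'0 k) i).ne'
  have h3 := (hm0 k).ne'
  rw [Pi.sub_apply]
  field_simp
  ring

theorem IsFit.T_isBigO (v : Form) (hm0 : ∀ k, 0 < m k)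
    (hρ : ρ =o[atTop] fun _ => (1 : ℝ)) (hmρ : (fun k => (√(m k))⁻¹) =O[atTop] ρ)
    (hx : M.IsFit m ρ x θ) (hpen : (fun k => M.pen k (θ k)) =O[atTop] fun _ => (1 : ℝ)) :
    (fun k => M.T m v k (θ k) (x k)) =O[atTop] fun k => m k * ρ k ^ 2 := by
  refine (((T_sub_T_pearson_isBigO v hm0 hρ hmρ hx).trans (mul_cube_isLittleO hρ).isBigO).add
    ((hx.chiSq_isBigO hm0).add (hpen.trans (one_isBigO_mul_sq hm0 hmρ)))).congr_left fun k => ?_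
  rw [T_pearson]
  ring

theorem Tmin_sub_Tmin_isBigO (v w : Form) (hm0 : ∀ k, 0 < m k) (hm : Tendsto m atTop atTop)
    (hp : IsStableRate p) (hx : IsNear m p x) (hρ : ρ =o[atTop] fun _ => (1 : ℝ))
    (hmρ : (fun k => (√(m k))⁻¹) =O[atTop] ρ) (hθ : M.IsFit m ρ x θ)
    (hpen : (fun k => M.pen k (θ k)) =O[atTop] fun _ => (1 : ℝ)) :
    (fun k => M.Tmin m v k (x k) - M.Tmin m w k (x k)) =O[atTop] fun k => m k * ρ k ^ 3 := by
  choose t s ht hs hts using fun k => exists_abs_ciInf_sub_ciInf_sub_le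
    (fun z : M.params => M.T m v k z (x k)) (fun z : M.params => M.T m w k z (x k)) 0
    ⟨θ k, hθ.mem k⟩ (inv_pos.2 (Real.sqrt_pos.2 (hm0 k)))
  have hdiff : ∀ {z : ℕ → M.Param}, M.IsFit m ρ x z →
      (fun k => |M.T m v k (z k) (x k) - M.T m w k (z k) (x k) - 0|) =O[atTop]
        fun k => m k * ρ k ^ 3 := fun hz =>
    (((T_sub_T_pearson_isBigO v hm0 hρ hmρ hz).sub
      (T_sub_T_pearson_isBigO w hm0 hρ hmρ hz)).congr_left fun k => by ring).norm_left
  have hε : (fun k => (√(m k))⁻¹) =O[atTop] fun k => m k * ρ k ^ 3 := by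
    refine ((isBigO_refl m atTop).mul (hmρ.pow 3)).congr_left fun k => ?_
    have hsq : √(m k) ≠ 0 := (Real.sqrt_pos.2 (hm0 k)).ne'
    nth_rewrite 1 [← Real.sq_sqrt (hm0 k).le]
    field_simp
  have hfit_t := isFit_of_T_le v hm0 hm hp hx hρ hmρ (fun k => (t k).2) ht
    (hθ.T_isBigO v hm0 hρ hmρ hpen)
  have hfit_s := isFit_of_T_le w hm0 hm hp hx hρ hmρ (fun k => (s k).2) hs
    (hθ.T_isBigO w hm0 hρ hmρ hpen)
  refine IsBigO.trans (.of_norm_eventuallyLE ?_) (((hdiff hfit_t).add (hdiff hfit_s)).add hε)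
  filter_upwards [hx.eventually_two_le hp hm0 hm] with k hk
  have := hts k (bddBelow_T v (hm0 k) hk) (bddBelow_T w (hm0 k) hk)
  rwa [sub_zero] at this

end BinModel

/-! ### The minima under the correct hypothesis -/

namespace BinModel

variable {n : ℕ} {M : BinModel n} {m : ℕ → ℝ} {x : ℕ → Fin n → ℝ} {a : ℕ → M.Param}

theorem pen_isBigO_one (hmem : ∀ k, a k ∈ M.params) (h : ∃ C : ℝ, ∀ k, M.pen k (a k) ≤ C) :
    (fun k => M.pen k (a k)) =O[atTop] fun _ => (1 : ℝ) := by
  obtain ⟨C, hC⟩ := h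
  refine .of_bound C (.of_forall fun k => ?_)
  rw [norm_one, mul_one, Real.norm_of_nonneg (M.pen_nonneg k _ (hmem k))]
  exact hC k

theorem chiSqMin_le {k : ℕ} (hm0 : 0 < m k) {θ : M.Param} (hθ : θ ∈ M.params) (x : Fin n → ℝ) :
    M.chiSqMin m k x ≤ M.chiSq m k θ x :=
  ciInf_le (bddBelow_chiSq hm0 x) (⟨θ, hθ⟩ : M.params)

theorem chiSqMin_nonneg {k : ℕ} (hm0 : 0 < m k) (x : Fin n → ℝ) : 0 ≤ M.chiSqMin m k x :=
  Real.iInf_nonneg fun θ => chiSq_nonneg hm0 θ.2 x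

theorem bddBelow_T_pearson {k : ℕ} (hm0 : 0 < m k) (x : Fin n → ℝ) :
    BddBelow (Set.range fun θ : M.params => M.T m .pearson k θ x) :=
  ⟨0, Set.forall_mem_range.2 fun θ =>
    add_nonneg (chiSq_nonneg hm0 θ.2 x) (M.pen_nonneg k θ θ.2)⟩

theorem Tmin_pearson_le {k : ℕ} (hm0 : 0 < m k) {θ : M.Param} (hθ : θ ∈ M.params)
    (x : Fin n → ℝ) : M.Tmin m .pearson k x ≤ M.chiSq m k θ x + M.pen k θ :=
  ciInf_le (bddBelow_T_pearson hm0 x) (⟨θ, hθ⟩ : M.params)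

theorem chiSqMin_le_Tmin_pearson {k : ℕ} (hm0 : 0 < m k) (x : Fin n → ℝ) :
    M.chiSqMin m k x ≤ M.Tmin m .pearson k x :=
  ciInf_mono (bddBelow_chiSq hm0 x) fun θ => le_add_of_nonneg_right (M.pen_nonneg k θ θ.2)

namespace IsTruth

theorem isStableRate (ha : M.IsTruth a) : IsStableRate fun k => M.rate k (a k) := ha.rate_bounds

theorem isFit (ha : M.IsTruth a) (hx : IsNear m (fun k => M.rate k (a k)) x) :
    M.IsFit m (fun k => (√(m k))⁻¹) x a where
  mem := ha.mem
  isTheta_mean := ha.isStableRate.isTheta_mul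
  sub_isBigO i := (hx i).congr_right fun k => by rw [← div_eq_mul_inv, Real.div_sqrt]

theorem chiSq_isBigO_one (ha : M.IsTruth a) (hm0 : ∀ k, 0 < m k)
    (hx : IsNear m (fun k => M.rate k (a k)) x) :
    (fun k => M.chiSq m k (a k) (x k)) =O[atTop] fun _ => (1 : ℝ) :=
  ((ha.isFit hx).chiSq_isBigO hm0).congr_right (mul_inv_sqrt_pow_two hm0)

theorem chiSqMin_isBigO_one (ha : M.IsTruth a) (hm0 : ∀ k, 0 < m k)
    (hx : IsNear m (fun k => M.rate k (a k)) x) :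
    (fun k => M.chiSqMin m k (x k)) =O[atTop] fun _ => (1 : ℝ) := by
  refine .trans (.of_norm_le fun k => ?_) (ha.chiSq_isBigO_one hm0 hx)
  rw [Real.norm_of_nonneg (chiSqMin_nonneg (hm0 k) _)]
  exact chiSqMin_le (hm0 k) (ha.mem k) _

theorem chiSqMin_mean (ha : M.IsTruth a) (hm0 : ∀ k, 0 < m k) (k : ℕ) :
    M.chiSqMin m k (M.mean m k (a k)) = 0 := by
  refine le_antisymm ((chiSqMin_le (hm0 k) (ha.mem k) _).trans_eq ?_) (chiSqMin_nonneg (hm0 k) _)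
  simp only [chiSq, sub_self, ne_eq, OfNat.ofNat_ne_zero, not_false_eq_true, zero_pow, zero_div,
    Finset.sum_const_zero]

theorem Tmin_sub_Tmin_pearson_isBigO (ha : M.IsTruth a) (hm0 : ∀ k, 0 < m k)
    (hm : Tendsto m atTop atTop) (hx : IsNear m (fun k => M.rate k (a k)) x) (v : Form) :
    (fun k => M.Tmin m v k (x k) - M.Tmin m .pearson k (x k)) =O[atTop]
      fun k => (√(m k))⁻¹ := by
  refine (Tmin_sub_Tmin_isBigO v .pearson hm0 hm ha.isStableRate hx (inv_sqrt_isLittleO_one hm)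
    (isBigO_refl _ _) (ha.isFit hx) (pen_isBigO_one ha.mem ha.pen_bound)).congr_right fun k => ?_
  rw [pow_succ, ← mul_assoc, mul_inv_sqrt_pow_two hm0, one_mul]

theorem Tmin_isBigO_one (ha : M.IsTruth a) (hm0 : ∀ k, 0 < m k)
    (hm : Tendsto m atTop atTop) (hx : IsNear m (fun k => M.rate k (a k)) x) (v : Form) :
    (fun k => M.Tmin m v k (x k)) =O[atTop] fun _ => (1 : ℝ) := by
  have hpearson : (fun k => M.Tmin m .pearson k (x k)) =O[atTop] fun _ => (1 : ℝ) := by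
    refine .trans (.of_norm_le fun k => ?_)
      ((ha.chiSq_isBigO_one hm0 hx).add (pen_isBigO_one ha.mem ha.pen_bound))
    rw [Real.norm_of_nonneg ((chiSqMin_nonneg (hm0 k) _).trans
      (chiSqMin_le_Tmin_pearson (hm0 k) _))]
    exact Tmin_pearson_le (hm0 k) (ha.mem k) _
  exact (((ha.Tmin_sub_Tmin_pearson_isBigO hm0 hm hx v).trans
    (inv_sqrt_isLittleO_one hm).isBigO).add hpearson).congr_left fun k => sub_add_cancel _ _

end IsTruth

end BinModel

/-! ### Quadratic growth at the best fit -/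

section Growth

open scoped Nat

variable {E : Type*} [NormedAddCommGroup E] [NormedSpace ℝ E]

/-- The linear term of the Taylor expansion at `b` vanishes, and the quadratic term is at least
`c / 2 * ‖θ - b‖ ^ 2`. -/
theorem add_mul_norm_sub_sq_le_of_isLocalMin {f : E → ℝ} {b : E} {r c K : ℝ}
    (hf : ContDiffOn ℝ 3 f (Metric.ball b r)) (hmin : IsLocalMin f b)
    (hess : ∀ v, c * ‖v‖ ^ 2 ≤ iteratedFDeriv ℝ 2 f b ![v, v])
    (hK : ∀ θ ∈ Metric.ball b r, ‖iteratedFDeriv ℝ 3 f θ‖ ≤ K) {θ : E}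
    (hθ : θ ∈ Metric.ball b r) :
    f b + (c / 2 - K / 2 * ‖θ - b‖) * ‖θ - b‖ ^ 2 ≤ f θ := by
  obtain ⟨v, rfl⟩ : ∃ v, θ = b + v := ⟨θ - b, (add_sub_cancel b θ).symm⟩
  have hsegment : ∀ t ∈ Set.Icc (0 : ℝ) 1, b + t • v ∈ Metric.ball b r := fun t ht =>
    (convex_ball b r).add_smul_mem (Metric.mem_ball_self (Metric.pos_of_mem_ball hθ)) hθ ht
  have htaylor := map_add_eq_sum_add_integral_iteratedFDeriv (f := f) (n := 2)
    fun t ht => hf.contDiffAt (Metric.isOpen_ball.mem_nhds (hsegment t ht))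
  have hlinear : iteratedFDeriv ℝ 1 f b (fun _ => v) = 0 := by
    rw [iteratedFDeriv_one_apply, hmin.fderiv_eq_zero, zero_apply]
  have hremainder : ‖∫ t in (0 : ℝ)..1, (1 - t) ^ 2 • iteratedFDeriv ℝ 3 f (b + t • v) fun _ => v‖
      ≤ K * ‖v‖ ^ 3 * |1 - 0| := by
    refine intervalIntegral.norm_integral_le_of_norm_le_const fun t ht => ?_
    rw [Set.uIoc_of_le zero_le_one] at ht
    have hterm := (iteratedFDeriv ℝ 3 f (b + t • v)).le_of_opNorm_le
      (hK _ (hsegment t ⟨ht.1.le, ht.2⟩)) fun _ => v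
    rw [Fin.prod_const] at hterm
    rw [norm_smul, Real.norm_of_nonneg (sq_nonneg _)]
    exact (mul_le_of_le_one_left (norm_nonneg _)
      (pow_le_one₀ (by linarith [ht.2]) (by linarith [ht.1]))).trans hterm
  have hquadratic := hess v
  rw [show ![v, v] = fun _ => v from List.ofFn_inj.1 rfl] at hquadratic
  simp only [Finset.sum_range_succ, Finset.sum_range_zero, iteratedFDeriv_zero_apply, hlinear,
    Nat.factorial, smul_eq_mul, Nat.reduceAdd, Nat.cast_one, mul_one] at htaylor
  rw [sub_zero, abs_one, mul_one, Real.norm_eq_abs] at hremainder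
  rw [htaylor, add_sub_cancel_left]
  linear_combination hquadratic / 2 + (abs_le.1 hremainder).1 / 2

theorem norm_iteratedFDeriv_inv_le {x c : ℝ} (hc : 0 < c) (hcx : c ≤ x) {i N : ℕ} (hi : i ≤ N) :
    ‖iteratedFDeriv ℝ i Inv.inv x‖ ≤ N ! * max 1 c⁻¹ ^ (N + 1) := by
  have hx : 0 < x := hc.trans_le hcx
  rw [norm_iteratedFDeriv_eq_norm_iteratedDeriv, iteratedDeriv_eq_iterate, iter_deriv_inv']
  simp only [show (-1 - i : ℤ) = -(i + 1 : ℕ) by push_cast; ring, zpow_neg, zpow_natCast,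
    norm_mul, norm_pow, norm_neg, norm_one, one_pow, one_mul, Real.norm_natCast, norm_inv,
    Real.norm_of_nonneg hx.le, ← inv_pow]
  gcongr ?_ * ?_
  · exact_mod_cast Nat.factorial_le hi
  · calc x⁻¹ ^ (i + 1) ≤ max 1 c⁻¹ ^ (i + 1) := by
          gcongr
          exact (inv_anti₀ hc hcx).trans (le_max_right _ _)
      _ ≤ _ := pow_le_pow_right₀ (le_max_left _ _) (by lia)

theorem norm_iteratedFDeriv_fun_inv_le {f : E → ℝ} {s : Set E} {N : ℕ} {c D : ℝ} {x : E}
    (hs : IsOpen s) (hf : ContDiffOn ℝ N f s) (hpos : ∀ y ∈ s, 0 < f y) (hx : x ∈ s) (hc : 0 < c)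
    (hcx : c ≤ f x) (hD : ∀ i, 1 ≤ i → i ≤ N → ‖iteratedFDeriv ℝ i f x‖ ≤ D ^ i) :
    ‖iteratedFDeriv ℝ N (fun y => (f y)⁻¹) x‖ ≤ N ! * (N ! * max 1 c⁻¹ ^ (N + 1)) * D ^ N := by
  rw [← iteratedFDerivWithin_of_isOpen N hs hx]
  refine norm_iteratedFDerivWithin_comp_le (g := Inv.inv) (t := Set.Ioi 0)
    (contDiffOn_id.inv fun y hy => hy.ne') hf le_rfl isOpen_Ioi.uniqueDiffOn hs.uniqueDiffOn
    hpos hx (fun i hi => ?_) fun i h1 hi => ?_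
  · rw [iteratedFDerivWithin_of_isOpen i isOpen_Ioi (hpos x hx)]
    exact norm_iteratedFDeriv_inv_le hc hcx hi
  · rw [iteratedFDerivWithin_of_isOpen i hs hx]
    exact hD i h1 hi

end Growth

namespace BinModel

open scoped Nat

variable {n : ℕ} {M : BinModel n} {p : ℕ → Fin n → ℝ} {b : ℕ → M.Param}

theorem deviation_eq_sum_smul_inv_add {k : ℕ} {θ : M.Param} (hθ : θ ∈ M.params) (q : Fin n → ℝ) :
    M.deviation k q θ =
      ∑ i, (q i ^ 2 • (M.rate k θ i)⁻¹ + (M.rate k θ i - 2 * q i)) := by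
  refine Finset.sum_congr rfl fun i _ => ?_
  have := (M.rate_pos k θ hθ i).ne'
  rw [smul_eq_mul]
  field_simp
  ring

theorem contDiffOn_deviation (M : BinModel n) (k : ℕ) (q : Fin n → ℝ) :
    ContDiffOn ℝ 3 (M.deviation k q) M.params :=
  ContDiffOn.sum fun i _ => ((contDiffOn_const.sub (M.rate_smooth k i)).pow 2).div
    (M.rate_smooth k i) fun θ hθ => (M.rate_pos k θ hθ i).ne'

theorem norm_iteratedFDeriv_deviation_le {k : ℕ} {q : Fin n → ℝ} {s : Set M.Param} {θ : M.Param}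
    {c A D : ℝ} (hs : IsOpen s) (hsub : s ⊆ M.params) (hθ : θ ∈ s) (hc : 0 < c) (hD1 : 1 ≤ D)
    (hq : ∀ i, |q i| ≤ A) (hcr : ∀ i, c ≤ M.rate k θ i)
    (hD : ∀ i, ∀ j ∈ Finset.Icc 1 3, ‖iteratedFDeriv ℝ j (fun θ => M.rate k θ i) θ‖ ≤ D) :
    ‖iteratedFDeriv ℝ 3 (M.deviation k q) θ‖ ≤
      n * (A ^ 2 * (3 ! * (3 ! * max 1 c⁻¹ ^ 4) * D ^ 3) + D) := by
  have hsmooth i : ContDiffAt ℝ 3 (fun θ => M.rate k θ i) θ :=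
    ((M.rate_smooth k i).mono hsub).contDiffAt (hs.mem_nhds hθ)
  have hinv_smooth i : ContDiffAt ℝ 3 (fun θ => (M.rate k θ i)⁻¹) θ :=
    (hsmooth i).inv (M.rate_pos k θ (hsub hθ) i).ne'
  have hinv i : ‖iteratedFDeriv ℝ 3 (fun θ => (M.rate k θ i)⁻¹) θ‖ ≤
      3 ! * (3 ! * max 1 c⁻¹ ^ 4) * D ^ 3 :=
    norm_iteratedFDeriv_fun_inv_le hs ((M.rate_smooth k i).mono hsub)
      (fun y hy => M.rate_pos k y (hsub hy) i) hθ hc (hcr i) fun j h1 h3 =>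
        (hD i j (Finset.mem_Icc.2 ⟨h1, h3⟩)).trans (le_self_pow₀ hD1 (by lia))
  have hbin i : ‖iteratedFDeriv ℝ 3 (fun θ => q i ^ 2 • (M.rate k θ i)⁻¹ +
      (M.rate k θ i - 2 * q i)) θ‖ ≤ A ^ 2 * (3 ! * (3 ! * max 1 c⁻¹ ^ 4) * D ^ 3) + D := by
    rw [fun_iteratedFDeriv_add_apply ((hinv_smooth i).const_smul _)
        ((hsmooth i).sub contDiffAt_const),
      iteratedFDeriv_const_smul_apply' (hinv_smooth i),
      fun_iteratedFDeriv_sub_apply (hsmooth i) contDiffAt_const,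
      iteratedFDeriv_const_of_ne three_ne_zero, Pi.zero_apply, sub_zero]
    refine (norm_add_le _ _).trans (add_le_add ?_ (hD i 3 (by simp)))
    rw [norm_smul, norm_pow, Real.norm_eq_abs]
    gcongr
    exacts [hq i, hinv i]
  have heq : M.deviation k q =ᶠ[𝓝 θ]
      fun θ => ∑ i, (q i ^ 2 • (M.rate k θ i)⁻¹ + (M.rate k θ i - 2 * q i)) :=
    (hs.eventually_mem hθ).mono fun y hy => deviation_eq_sum_smul_inv_add (hsub hy) q
  rw [(heq.iteratedFDeriv ℝ 3).eq_of_nhds, iteratedFDeriv_fun_sum_apply fun i _ =>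
    ((hinv_smooth i).const_smul _).add ((hsmooth i).sub contDiffAt_const)]
  refine (norm_sum_le_of_le _ fun i _ => hbin i).trans_eq ?_
  rw [Finset.sum_const, Finset.card_univ, Fintype.card_fin, nsmul_eq_mul]

theorem norm_rate_sub_le {k : ℕ} {s : Set M.Param} {θ θ' : M.Param} {D : ℝ}
    (hs : IsOpen s) (hconvex : Convex ℝ s) (hsub : s ⊆ M.params) (hD0 : 0 ≤ D)
    (hD : ∀ θ ∈ s, ∀ i, ‖iteratedFDeriv ℝ 1 (fun θ => M.rate k θ i) θ‖ ≤ D)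
    (hθ : θ ∈ s) (hθ' : θ' ∈ s) : ‖M.rate k θ - M.rate k θ'‖ ≤ D * ‖θ - θ'‖ := by
  refine (pi_norm_le_iff_of_nonneg (by positivity)).2 fun i => ?_
  refine hconvex.norm_image_sub_le_of_norm_fderiv_le (𝕜 := ℝ) (f := fun θ => M.rate k θ i)
    (fun y hy => ?_) (fun y hy => ?_) hθ' hθ
  · exact (((M.rate_smooth k i).mono hsub).contDiffAt (hs.mem_nhds hy)).differentiableAt
      (by norm_num)
  · exact norm_iteratedFDeriv_one (𝕜 := ℝ) (x := y) (fun θ => M.rate k θ i) ▸ hD y hy i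

namespace IsBestFit

theorem mem (hb : M.IsBestFit p b) (k : ℕ) : b k ∈ M.params := by
  obtain ⟨r, C, hr, hrC⟩ := hb.smooth_near
  exact (hrC k).1 (Metric.mem_ball_self hr)

theorem deviation_le (hb : M.IsBestFit p b) (k : ℕ) {θ : M.Param} (hθ : θ ∈ M.params) :
    M.deviation k (p k) (b k) ≤ M.deviation k (p k) θ := by
  obtain rfl | hne := eq_or_ne θ (b k)
  · rfl
  · obtain ⟨κ, hκ, hsep⟩ := hb.separated ‖θ - b k‖ (norm_pos_iff.2 (sub_ne_zero.2 hne))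
    linarith [hsep k θ hθ le_rfl]

theorem pen_isBigO_one (hb : M.IsBestFit p b) :
    (fun k => M.pen k (b k)) =O[atTop] fun _ => (1 : ℝ) := by
  obtain ⟨r, C, hr, hrC⟩ := hb.smooth_near
  exact BinModel.pen_isBigO_one hb.mem ⟨C, fun k => ((hrC k).2 _ (Metric.mem_ball_self hr)).1⟩

theorem exists_norm_rate_sub_le (hb : M.IsBestFit p b) :
    ∃ r L : ℝ, 0 < r ∧ 0 < L ∧ ∀ k, ∀ θ ∈ Metric.ball (b k) r,
      ‖M.rate k θ - M.rate k (b k)‖ ≤ L * ‖θ - b k‖ := by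
  obtain ⟨r, C, hr, hrC⟩ := hb.smooth_near
  refine ⟨r, max C 1, hr, by positivity, fun k θ hθ => ?_⟩
  exact norm_rate_sub_le Metric.isOpen_ball (convex_ball _ _) (hrC k).1 (by positivity)
    (fun y hy i => (((hrC k).2 y hy).2 i 1 (by simp)).trans (le_max_left _ _)) hθ
    (Metric.mem_ball_self hr)

theorem exists_rate_bounds (hb : M.IsBestFit p b) :
    ∃ r c D : ℝ, 0 < r ∧ 0 < c ∧ 1 ≤ D ∧ ∀ k, Metric.ball (b k) r ⊆ M.params ∧
      ∀ θ ∈ Metric.ball (b k) r, ∀ i, c ≤ M.rate k θ i ∧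
        ∀ j ∈ Finset.Icc 1 3, ‖iteratedFDeriv ℝ j (fun θ => M.rate k θ i) θ‖ ≤ D := by
  obtain ⟨r, C, hr, hrC⟩ := hb.smooth_near
  obtain ⟨c, hc, hcb⟩ := hb.rate_lower
  obtain ⟨r', L, hr', hL, hlip⟩ := hb.exists_norm_rate_sub_le
  refine ⟨min r (min r' (c / (2 * L))), c / 2, max C 1, by positivity, by positivity,
    le_max_right _ _, fun k => ?_⟩
  have hsub : Metric.ball (b k) (min r (min r' (c / (2 * L)))) ⊆ Metric.ball (b k) r :=
    Metric.ball_subset_ball (min_le_left _ _)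
  refine ⟨hsub.trans (hrC k).1, fun θ hθ i => ⟨?_, fun j hj =>
    (((hrC k).2 θ (hsub hθ)).2 i j hj).trans (le_max_left _ _)⟩⟩
  rw [mem_ball_iff_norm, lt_min_iff, lt_min_iff, lt_div_iff₀ (by positivity)] at hθ
  have := (abs_le.1 ((norm_le_pi_norm _ i).trans (hlip k θ (mem_ball_iff_norm.2 hθ.2.1)))).1
  simp only [Pi.sub_apply] at this
  linarith [hcb k i]

theorem exists_quadratic_growth (hb : M.IsBestFit p b) (hp : IsStableRate p) :
    ∃ r c : ℝ, 0 < r ∧ 0 < c ∧ ∀ k, ∀ θ ∈ Metric.ball (b k) r,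
      M.deviation k (p k) (b k) + c * ‖θ - b k‖ ^ 2 ≤ M.deviation k (p k) θ := by
  obtain ⟨r, c, D, hr, hc, hD1, hbounds⟩ := hb.exists_rate_bounds
  obtain ⟨a, ha, hess⟩ := hb.hessian
  obtain ⟨c', A, hc', hA⟩ := hp
  set K := n * (A ^ 2 * (3 ! * (3 ! * max 1 c⁻¹ ^ 4) * D ^ 3) + D)
  have : 0 ≤ K := by positivity
  refine ⟨min r (a / (2 * (K + 1))), a / 4, by positivity, by positivity, fun k θ hθ => ?_⟩
  have hmin : IsLocalMin (M.deviation k (p k)) (b k) :=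
    mem_of_superset (Metric.ball_mem_nhds _ hr) fun θ hθ => hb.deviation_le k ((hbounds k).1 hθ)
  have hgrowth := add_mul_norm_sub_sq_le_of_isLocalMin (K := K)
    ((M.contDiffOn_deviation k (p k)).mono (hbounds k).1) hmin (hess k)
    (fun y hy => norm_iteratedFDeriv_deviation_le Metric.isOpen_ball (hbounds k).1 hy hc hD1
      (fun i => (abs_of_nonneg (hc'.le.trans (hA k i).1)).trans_le (hA k i).2)
      (fun i => ((hbounds k).2 y hy i).1) fun i => ((hbounds k).2 y hy i).2)
    (Metric.ball_subset_ball (min_le_left _ _) hθ)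
  refine le_trans ?_ hgrowth
  gcongr
  rw [mem_ball_iff_norm, lt_min_iff, lt_div_iff₀ (by positivity)] at hθ
  nlinarith [hθ.2, norm_nonneg (θ - b k)]

end IsBestFit

end BinModel

/-! ### Localization of near-minimizers -/

theorem sq_isBigO_abs_add_one {α : Type*} {f : Filter α} {z u : α → ℝ}
    (h : (fun k => z k ^ 2) =O[f] fun k => |u k| + |z k|) :
    (fun k => z k ^ 2) =O[f] fun k => |u k| + 1 := by
  obtain ⟨C, hC⟩ := h.bound
  refine .of_bound (2 * |C| + C ^ 2) (hC.mono fun k hk => ?_)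
  rw [Real.norm_of_nonneg (by positivity), Real.norm_of_nonneg (by positivity)] at hk ⊢
  have hle : z k ^ 2 ≤ |C| * |u k| + |C| * |z k| :=
    hk.trans ((mul_le_mul_of_nonneg_right (le_abs_self C) (by positivity)).trans_eq (mul_add _ _ _))
  have hyoung : 2 * |C| * |z k| ≤ C ^ 2 + z k ^ 2 := by
    simpa only [sq_abs] using two_mul_le_add_sq |C| |z k|
  have : 0 ≤ C ^ 2 * |u k| := by positivity
  rw [mul_add, add_mul]
  linarith [abs_nonneg C]

namespace BinModel

variable {n : ℕ} {M : BinModel n} {m ρ u : ℕ → ℝ} {p x y : ℕ → Fin n → ℝ} {b θ : ℕ → M.Param}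

theorem chiSq_mul {k : ℕ} (hm0 : 0 < m k) (θ : M.Param) (q : Fin n → ℝ) :
    M.chiSq m k θ (fun i => m k * q i) = m k * M.deviation k q θ := by
  rw [chiSq, deviation, Finset.mul_sum]
  refine Finset.sum_congr rfl fun i _ => ?_
  rw [mean, ← mul_sub, mul_pow, sq, mul_assoc, mul_div_mul_left _ _ hm0.ne', mul_div_assoc]

theorem sq_sub_mean_div_le_chiSq {k : ℕ} (hm0 : 0 < m k) {θ : M.Param} (hθ : θ ∈ M.params)
    (x : Fin n → ℝ) (i : Fin n) :
    (x i - M.mean m k θ i) ^ 2 / M.mean m k θ i ≤ M.chiSq m k θ x :=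
  Finset.single_le_sum (f := fun i => (x i - M.mean m k θ i) ^ 2 / M.mean m k θ i)
    (fun i _ => div_nonneg (sq_nonneg _) (mean_pos hm0 hθ i).le) (Finset.mem_univ i)

/-- The bin `(x - l) ^ 2 / l = x ^ 2 / l + l - 2 * x` of the chi-square bounds both the predicted
mean `l` and its inverse. -/
theorem rate_isTheta_one (hm0 : ∀ k, 0 < m k) (hx : ∀ i, (fun k => x k i) =Θ[atTop] m)
    (hθ : ∀ k, θ k ∈ M.params) (hχ : (fun k => M.chiSq m k (θ k) (x k)) =O[atTop] m) (i : Fin n) :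
    (fun k => M.rate k (θ k) i) =Θ[atTop] fun _ => (1 : ℝ) := by
  have hl k : 0 < M.mean m k (θ k) i := mean_pos (hm0 k) (hθ k) i
  have hbound : (fun k => M.chiSq m k (θ k) (x k) + 2 * x k i) =O[atTop] m :=
    hχ.add ((hx i).1.const_mul_left 2)
  have hbin k : x k i ^ 2 / M.mean m k (θ k) i + M.mean m k (θ k) i ≤
      M.chiSq m k (θ k) (x k) + 2 * x k i := by
    refine le_trans (le_of_eq ?_)
      (add_le_add_left (sq_sub_mean_div_le_chiSq (hm0 k) (hθ k) (x k) i) _)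
    have := (hl k).ne'
    field_simp
    ring
  have hupper : (fun k => M.mean m k (θ k) i) =O[atTop] m := by
    refine .trans (.of_norm_le fun k => ?_) hbound
    rw [Real.norm_of_nonneg (hl k).le]
    linarith [hbin k, div_nonneg (sq_nonneg (x k i)) (hl k).le]
  have hlower : (fun k => x k i ^ 2 / M.mean m k (θ k) i) =O[atTop] m := by
    refine .trans (.of_norm_le fun k => ?_) hbound
    rw [Real.norm_of_nonneg (div_nonneg (sq_nonneg _) (hl k).le)]
    linarith [hbin k, hl k]
  refine ⟨?_, ?_⟩
  · refine (hupper.mul (isBigO_refl (fun k => (m k)⁻¹) _)).congr (fun k => ?_) fun k => ?_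
    · rw [mean, mul_comm (m k), mul_inv_cancel_right₀ (hm0 k).ne']
    · exact mul_inv_cancel₀ (hm0 k).ne'
  · have hinv := ((((hx i).2.pow 2).mul (isBigO_refl (fun k => (M.mean m k (θ k) i)⁻¹) _)).trans
      hlower).mul (isBigO_refl (fun k => M.rate k (θ k) i * (m k)⁻¹) _)
    refine hinv.congr (fun k => ?_) fun k => ?_
    · have := (M.rate_pos k (θ k) (hθ k) i).ne'
      have := (hm0 k).ne'
      rw [mean]
      field_simp
    · have := (hm0 k).ne'
      field_simp

namespace IsBestFit

theorem tendsto_sub_of_deviation (hb : M.IsBestFit p b) (hθ : ∀ k, θ k ∈ M.params)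
    (h : Tendsto (fun k => M.deviation k (p k) (θ k) - M.deviation k (p k) (b k)) atTop (𝓝 0)) :
    Tendsto (fun k => θ k - b k) atTop (𝓝 0) := by
  refine NormedAddGroup.tendsto_nhds_zero.2 fun ε hε => ?_
  obtain ⟨κ, hκ, hsep⟩ := hb.separated ε hε
  filter_upwards [h.eventually_lt_const hκ] with k hk
  by_contra! hge
  linarith [hsep k (θ k) (hθ k) hge]

theorem norm_rate_sub_isBigO (hb : M.IsBestFit p b)
    (h : Tendsto (fun k => θ k - b k) atTop (𝓝 0)) :
    (fun k => ‖M.rate k (θ k) - M.rate k (b k)‖) =O[atTop] fun k => ‖θ k - b k‖ := by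
  obtain ⟨r, L, hr, -, hlip⟩ := hb.exists_norm_rate_sub_le
  refine .of_bound L ?_
  filter_upwards [h.norm.eventually_lt_const (by rwa [norm_zero])] with k hk
  simpa only [norm_norm] using hlip k (θ k) (mem_ball_iff_norm.2 hk)

theorem norm_sub_sq_isBigO_deviation (hb : M.IsBestFit p b) (hp : IsStableRate p)
    (h : Tendsto (fun k => θ k - b k) atTop (𝓝 0)) :
    (fun k => ‖θ k - b k‖ ^ 2) =O[atTop] fun k =>
      M.deviation k (p k) (θ k) - M.deviation k (p k) (b k) := by
  obtain ⟨r, c, hr, hc, hgrowth⟩ := hb.exists_quadratic_growth hp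
  refine .of_bound c⁻¹ ?_
  filter_upwards [h.norm.eventually_lt_const (u := r) (by rwa [norm_zero])] with k hk
  have := hgrowth k (θ k) (mem_ball_iff_norm.2 hk)
  rw [Real.norm_of_nonneg (sq_nonneg _), inv_mul_eq_div, le_div_iff₀ hc]
  exact le_trans (by linarith) (le_abs_self _)

theorem inv_rate_isBigO_one (hb : M.IsBestFit p b) (i : Fin n) :
    (fun k => (M.rate k (b k) i)⁻¹) =O[atTop] fun _ => (1 : ℝ) := by
  obtain ⟨c, hc, hrate⟩ := hb.rate_lower
  refine .of_bound c⁻¹ (.of_forall fun k => ?_)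
  rw [norm_one, mul_one, Real.norm_of_nonneg (inv_nonneg.2 (hc.le.trans (hrate k i)))]
  exact inv_anti₀ hc (hrate k i)

theorem sq_div_rate_isBigO_deviation (hb : M.IsBestFit p b) (i : Fin n) :
    (fun k => (p k i - M.rate k (b k) i) ^ 2 / M.rate k (b k) i) =O[atTop]
      fun k => M.deviation k (p k) (b k) :=
  isBigO_sum_of_nonneg (fun k j => div_nonneg (sq_nonneg (p k j - M.rate k (b k) j))
    (M.rate_pos k _ (hb.mem k) j).le) i

theorem rate_isTheta_one (hb : M.IsBestFit p b) (hm0 : ∀ k, 0 < m k) (hp : IsStableRate p)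
    (hdev : (fun k => M.deviation k (p k) (b k)) =O[atTop] fun _ => (1 : ℝ)) (i : Fin n) :
    (fun k => M.rate k (b k) i) =Θ[atTop] fun _ => (1 : ℝ) := by
  refine BinModel.rate_isTheta_one hm0 hp.isTheta_mul hb.mem ?_ i
  exact ((isBigO_refl m atTop).mul hdev).congr (fun k => (chiSq_mul (hm0 k) _ _).symm)
    fun k => mul_one _

theorem mean_isTheta (hb : M.IsBestFit p b) (hm0 : ∀ k, 0 < m k) (hp : IsStableRate p)
    (hdev : (fun k => M.deviation k (p k) (b k)) =O[atTop] fun _ => (1 : ℝ)) (i : Fin n) :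
    (fun k => M.mean m k (b k) i) =Θ[atTop] m := by
  change (fun k => m k * M.rate k (b k) i) =Θ[atTop] m
  have := (isTheta_refl m atTop).mul (hb.rate_isTheta_one hm0 hp hdev i)
  simpa only [mul_one] using this

theorem rate_isTheta_one_of_chiSq_le (hb : M.IsBestFit p b) (hm0 : ∀ k, 0 < m k)
    (hm : Tendsto m atTop atTop) (hp : IsStableRate p)
    (hdev : (fun k => M.deviation k (p k) (b k)) =O[atTop] fun _ => (1 : ℝ)) (hx : IsNear m p x)
    (hθ : ∀ k, θ k ∈ M.params)
    (hle : ∀ k, M.chiSq m k (θ k) (x k) ≤ M.chiSq m k (b k) (x k) + u k) (hu : u =O[atTop] m)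
    (i : Fin n) : (fun k => M.rate k (θ k) i) =Θ[atTop] fun _ => (1 : ℝ) := by
  have hmean i := hb.mean_isTheta hm0 hp hdev i
  have hfit : M.IsFit m (fun _ => 1) x b :=
    ⟨hb.mem, hmean, fun i => ((hx.isTheta hp hm i).1.sub (hmean i).1).congr_right
      fun k => (mul_one _).symm⟩
  have hχ : (fun k => M.chiSq m k (b k) (x k)) =O[atTop] m :=
    (hfit.chiSq_isBigO hm0).congr_right fun k => by rw [one_pow, mul_one]
  refine BinModel.rate_isTheta_one hm0 (hx.isTheta hp hm) hθ (.trans (.of_norm_le fun k => ?_)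
    (hχ.add hu)) i
  rw [Real.norm_of_nonneg (chiSq_nonneg (hm0 k) (hθ k) _)]
  exact hle k

theorem mul_deviation_sub_isBigO (hb : M.IsBestFit p b) (hm0 : ∀ k, 0 < m k)
    (hm : Tendsto m atTop atTop) (hp : IsStableRate p)
    (hdev : (fun k => M.deviation k (p k) (b k)) =O[atTop] fun _ => (1 : ℝ)) (hx : IsNear m p x)
    (hθ : ∀ k, θ k ∈ M.params)
    (hle : ∀ k, M.chiSq m k (θ k) (x k) ≤ M.chiSq m k (b k) (x k) + u k) (hu : u =O[atTop] m) :
    (fun k => m k * (M.deviation k (p k) (θ k) - M.deviation k (p k) (b k))) =O[atTop]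
      fun k => |u k| + √(m k) * ‖M.rate k (θ k) - M.rate k (b k)‖ := by
  obtain ⟨C, hC⟩ := (chiSq_sub_chiSq_sub_isBigO hm0 hm hp hx
    (fun i => (hb.rate_isTheta_one_of_chiSq_le hm0 hm hp hdev hx hθ hle hu i).2)
    (fun i => (hb.rate_isTheta_one hm0 hp hdev i).2) hθ hb.mem).bound
  refine .of_bound (max 1 C) (hC.mono fun k hk => ?_)
  have hr : 0 ≤ √(m k) * ‖M.rate k (θ k) - M.rate k (b k)‖ := by positivity
  rw [Real.norm_of_nonneg hr, Real.norm_eq_abs, chiSq_mul (hm0 k), chiSq_mul (hm0 k)] at hk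
  rw [Real.norm_of_nonneg (mul_nonneg (hm0 k).le (sub_nonneg.2 (hb.deviation_le k (hθ k)))),
    Real.norm_of_nonneg (add_nonneg (abs_nonneg _) hr)]
  have h1 := mul_le_mul_of_nonneg_right (le_max_left 1 C) (abs_nonneg (u k))
  have h2 := mul_le_mul_of_nonneg_right (le_max_right 1 C) hr
  linarith [hle k, le_abs_self (u k), (abs_le.1 hk).1]

theorem tendsto_sub_of_chiSq_le (hb : M.IsBestFit p b) (hm0 : ∀ k, 0 < m k)
    (hm : Tendsto m atTop atTop) (hp : IsStableRate p)
    (hdev : (fun k => M.deviation k (p k) (b k)) =O[atTop] fun _ => (1 : ℝ)) (hx : IsNear m p x)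
    (hθ : ∀ k, θ k ∈ M.params)
    (hle : ∀ k, M.chiSq m k (θ k) (x k) ≤ M.chiSq m k (b k) (x k) + u k) (hu : u =o[atTop] m) :
    Tendsto (fun k => θ k - b k) atTop (𝓝 0) := by
  have hrate : (fun k => ‖M.rate k (θ k) - M.rate k (b k)‖) =O[atTop] fun _ => (1 : ℝ) :=
    (isBigO_pi.2 fun i =>
      (hb.rate_isTheta_one_of_chiSq_le hm0 hm hp hdev hx hθ hle hu.isBigO i).1.sub
        (hb.rate_isTheta_one hm0 hp hdev i).1).norm_left
  have hbound : (fun k => |u k| + √(m k) * ‖M.rate k (θ k) - M.rate k (b k)‖) =o[atTop] m := by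
    refine hu.abs_left.add (((isBigO_refl _ _).mul hrate).trans_isLittleO ?_)
    simpa only [mul_one] using sqrt_isLittleO hm
  refine hb.tendsto_sub_of_deviation hθ ?_
  refine ((hb.mul_deviation_sub_isBigO hm0 hm hp hdev hx hθ hle hu.isBigO).trans_isLittleO
    hbound).tendsto_div_nhds_zero.congr fun k => ?_
  rw [mul_div_cancel_left₀ _ (hm0 k).ne']

/-- With `z = √m * ‖θ - b‖`, quadratic growth gives `z ^ 2 = O(|u| + z)`. -/
theorem mul_norm_sub_sq_isBigO (hb : M.IsBestFit p b) (hm0 : ∀ k, 0 < m k)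
    (hm : Tendsto m atTop atTop) (hp : IsStableRate p)
    (hdev : (fun k => M.deviation k (p k) (b k)) =O[atTop] fun _ => (1 : ℝ)) (hx : IsNear m p x)
    (hθ : ∀ k, θ k ∈ M.params)
    (hle : ∀ k, M.chiSq m k (θ k) (x k) ≤ M.chiSq m k (b k) (x k) + u k) (hu : u =o[atTop] m) :
    (fun k => m k * ‖θ k - b k‖ ^ 2) =O[atTop] fun k => |u k| + 1 := by
  have htendsto := hb.tendsto_sub_of_chiSq_le hm0 hm hp hdev hx hθ hle hu
  suffices (fun k => (√(m k) * ‖θ k - b k‖) ^ 2) =O[atTop]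
      fun k => |u k| + |√(m k) * ‖θ k - b k‖| from
    (sq_isBigO_abs_add_one this).congr_left fun k => by rw [mul_pow, Real.sq_sqrt (hm0 k).le]
  have hbound : (fun k => |u k| + √(m k) * ‖M.rate k (θ k) - M.rate k (b k)‖) =O[atTop]
      fun k => |u k| + |√(m k) * ‖θ k - b k‖| := by
    obtain ⟨C, hC⟩ := (hb.norm_rate_sub_isBigO htendsto).bound
    refine .of_bound (max 1 C) (hC.mono fun k hk => ?_)
    rw [norm_norm, norm_norm] at hk
    have h1 := mul_le_mul_of_nonneg_right (le_max_left 1 C) (abs_nonneg (u k))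
    have h2 := mul_le_mul_of_nonneg_left (hk.trans (mul_le_mul_of_nonneg_right
      (le_max_right 1 C) (norm_nonneg _))) (Real.sqrt_nonneg (m k))
    rw [abs_of_nonneg (by positivity : 0 ≤ √(m k) * ‖θ k - b k‖), Real.norm_of_nonneg
      (by positivity), Real.norm_of_nonneg (by positivity)]
    linarith
  have hgrowth := ((isBigO_refl m _).mul (hb.norm_sub_sq_isBigO_deviation hp htendsto)).trans
    ((hb.mul_deviation_sub_isBigO hm0 hm hp hdev hx hθ hle hu.isBigO).trans hbound)
  exact hgrowth.congr_left fun k => by rw [mul_pow, Real.sq_sqrt (hm0 k).le]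

end IsBestFit

end BinModel

/-! ### The minima under the wrong hypothesis -/

namespace BinModel

variable {n : ℕ} {M : BinModel n} {m ρ u : ℕ → ℝ} {p x y : ℕ → Fin n → ℝ} {b θ : ℕ → M.Param}

theorem IsFit.of_isNear (hy : M.IsFit m ρ y θ) (hmρ : (fun k => (√(m k))⁻¹) =O[atTop] ρ)
    (hx : IsNear m p x) (hyp : IsNear m p y) : M.IsFit m ρ x θ where
  mem := hy.mem
  isTheta_mean := hy.isTheta_mean
  sub_isBigO i := ((((hx i).sub (hyp i)).trans (sqrt_isBigO_mul hmρ)).add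
    (hy.sub_isBigO i)).congr_left fun k => by ring

/-- The part of the Pearson chi-square at `θ` that is linear in the deviations `x - m p` of the data
`x` from the mean counts `m p`; at the best fit it is the paper's `D₂`. -/
noncomputable def linearPart (M : BinModel n) (m : ℕ → ℝ) (k : ℕ) (p : Fin n → ℝ) (θ : M.Param)
    (x : Fin n → ℝ) : ℝ :=
  2 * ∑ i, (p i - M.rate k θ i) / M.rate k θ i * (x i - m k * p i)

theorem chiSq_eq_add_linearPart_add {k : ℕ} (hm0 : 0 < m k) {θ : M.Param} (hθ : θ ∈ M.params)
    (p x : Fin n → ℝ) :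
    M.chiSq m k θ x = m k * M.deviation k p θ + M.linearPart m k p θ x +
      ∑ i, (x i - m k * p i) ^ 2 / M.mean m k θ i := by
  rw [chiSq, deviation, linearPart, Finset.mul_sum, Finset.mul_sum, ← Finset.sum_add_distrib,
    ← Finset.sum_add_distrib]
  refine Finset.sum_congr rfl fun i _ => ?_
  have := (M.rate_pos k θ hθ i).ne'
  rw [mean]
  field_simp
  ring

namespace IsBestFit

theorem norm_sub_isBigO (hb : M.IsBestFit p b) (hm0 : ∀ k, 0 < m k)
    (hm : Tendsto m atTop atTop) (hp : IsStableRate p)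
    (hdev : (fun k => M.deviation k (p k) (b k)) =O[atTop] fun _ => (1 : ℝ)) (hx : IsNear m p x)
    (hθ : ∀ k, θ k ∈ M.params)
    (hle : ∀ k, M.chiSq m k (θ k) (x k) ≤ M.chiSq m k (b k) (x k)) :
    (fun k => ‖θ k - b k‖) =O[atTop] fun k => (√(m k))⁻¹ := by
  have h := hb.mul_norm_sub_sq_isBigO hm0 hm hp hdev hx hθ (u := fun _ => 0)
    (fun k => by rw [add_zero]; exact hle k) (isLittleO_zero _ _)
  simp only [abs_zero, zero_add] at h
  refine .of_pow two_ne_zero ?_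
  refine (((isBigO_refl (fun k => (m k)⁻¹) atTop).mul h).congr_left fun k => ?_).congr_right
    fun k => ?_
  · rw [inv_mul_cancel_left₀ (hm0 k).ne', Pi.pow_apply]
  · rw [mul_one, Pi.pow_apply, inv_pow, Real.sq_sqrt (hm0 k).le]

theorem chiSqMin_sub_chiSq_isBigO_one (hb : M.IsBestFit p b) (hm0 : ∀ k, 0 < m k)
    (hm : Tendsto m atTop atTop) (hp : IsStableRate p)
    (hdev : (fun k => M.deviation k (p k) (b k)) =O[atTop] fun _ => (1 : ℝ))
    (hx : IsNear m p x) :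
    (fun k => M.chiSqMin m k (x k) - M.chiSq m k (b k) (x k)) =O[atTop] fun _ => (1 : ℝ) := by
  choose t ht_le ht_min using fun k => exists_le_and_le_ciInf_add
    (fun z : M.params => M.chiSq m k z (x k)) ⟨b k, hb.mem k⟩ one_pos
  have ht k : (t k : M.Param) ∈ M.params := (t k).2
  have hnorm := hb.norm_sub_isBigO hm0 hm hp hdev hx ht ht_le
  have htendsto : Tendsto (fun k => (t k : M.Param) - b k) atTop (𝓝 0) :=
    (isLittleO_one_iff ℝ).1 (hnorm.norm_left.of_norm_left.trans_isLittleO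
      (inv_sqrt_isLittleO_one hm) |>.of_norm_left)
  have hcross : (fun k => (M.chiSq m k (t k) (x k) - M.chiSq m k (t k) fun i => m k * p k i) -
      (M.chiSq m k (b k) (x k) - M.chiSq m k (b k) fun i => m k * p k i)) =O[atTop]
      fun _ => (1 : ℝ) := by
    refine (chiSq_sub_chiSq_sub_isBigO hm0 hm hp hx (fun i =>
      (hb.rate_isTheta_one_of_chiSq_le hm0 hm hp hdev hx ht (u := fun _ => 0)
        (fun k => by rw [add_zero]; exact ht_le k) (isBigO_zero _ _) i).2)
      (fun i => (hb.rate_isTheta_one hm0 hp hdev i).2) ht hb.mem).trans ?_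
    exact ((isBigO_refl _ _).mul ((hb.norm_rate_sub_isBigO htendsto).trans hnorm)).congr_right
      fun k => mul_inv_cancel₀ (Real.sqrt_pos.2 (hm0 k)).ne'
  refine .trans (.of_norm_le fun k => ?_)
    (hcross.norm_left.add (isBigO_refl (fun _ => (1 : ℝ)) atTop))
  have hmin := chiSqMin_le (hm0 k) (hb.mem k) (x k)
  have hbest := mul_le_mul_of_nonneg_left (hb.deviation_le k (ht k)) (hm0 k).le
  rw [← chiSq_mul (hm0 k), ← chiSq_mul (hm0 k)] at hbest
  have ht_min : M.chiSq m k (t k) (x k) ≤ M.chiSqMin m k (x k) + 1 := ht_min k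
  rw [Real.norm_of_nonpos (sub_nonpos.2 hmin), Real.norm_eq_abs]
  linarith [neg_abs_le ((M.chiSq m k (t k) (x k) - M.chiSq m k (t k) fun i => m k * p k i) -
    (M.chiSq m k (b k) (x k) - M.chiSq m k (b k) fun i => m k * p k i))]

theorem chiSq_sub_isBigO_one (hb : M.IsBestFit p b) (hm0 : ∀ k, 0 < m k) (hp : IsStableRate p)
    (hdev : (fun k => M.deviation k (p k) (b k)) =O[atTop] fun _ => (1 : ℝ))
    (hx : IsNear m p x) :
    (fun k => M.chiSq m k (b k) (x k) -
      (m k * M.deviation k (p k) (b k) + M.linearPart m k (p k) (b k) (x k))) =O[atTop]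
      fun _ => (1 : ℝ) := by
  have hinv i : (fun k => (M.mean m k (b k) i)⁻¹) =O[atTop] fun k => (m k)⁻¹ :=
    (hb.mean_isTheta hm0 hp hdev i).2.inv_rev (.of_forall fun k hk => absurd hk (hm0 k).ne')
  refine ((IsBigO.fun_sum fun i (_ : i ∈ Finset.univ) =>
    ((hx i).pow 2).mul (hinv i)).congr_left fun k => ?_).congr_right fun k => ?_
  · rw [chiSq_eq_add_linearPart_add (hm0 k) (hb.mem k) (p k), add_sub_cancel_left]
    rfl
  · rw [Real.sq_sqrt (hm0 k).le, mul_inv_cancel₀ (hm0 k).ne']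

theorem chiSqMin_sub_isBigO_one (hb : M.IsBestFit p b) (hm0 : ∀ k, 0 < m k)
    (hm : Tendsto m atTop atTop) (hp : IsStableRate p)
    (hdev : (fun k => M.deviation k (p k) (b k)) =O[atTop] fun _ => (1 : ℝ))
    (hx : IsNear m p x) :
    (fun k => M.chiSqMin m k (x k) -
      (m k * M.deviation k (p k) (b k) + M.linearPart m k (p k) (b k) (x k))) =O[atTop]
      fun _ => (1 : ℝ) :=
  ((hb.chiSqMin_sub_chiSq_isBigO_one hm0 hm hp hdev hx).add
    (hb.chiSq_sub_isBigO_one hm0 hp hdev hx)).congr_left fun k => by ring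

theorem Tmin_pearson_sub_chiSqMin_isBigO_one (hb : M.IsBestFit p b) (hm0 : ∀ k, 0 < m k)
    (hm : Tendsto m atTop atTop) (hp : IsStableRate p)
    (hdev : (fun k => M.deviation k (p k) (b k)) =O[atTop] fun _ => (1 : ℝ))
    (hx : IsNear m p x) :
    (fun k => M.Tmin m .pearson k (x k) - M.chiSqMin m k (x k)) =O[atTop] fun _ => (1 : ℝ) := by
  refine .trans (.of_norm_le fun k => ?_)
    (hb.pen_isBigO_one.sub (hb.chiSqMin_sub_chiSq_isBigO_one hm0 hm hp hdev hx))
  rw [Real.norm_of_nonneg (sub_nonneg.2 (chiSqMin_le_Tmin_pearson (hm0 k) _))]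
  linarith [Tmin_pearson_le (hm0 k) (hb.mem k) (x k)]

theorem sub_rate_isBigO (hb : M.IsBestFit p b) (hm0 : ∀ k, 0 < m k) (hp : IsStableRate p)
    (hρ : ρ =O[atTop] fun _ => (1 : ℝ))
    (hdev : (fun k => M.deviation k (p k) (b k)) =O[atTop] fun k => ρ k ^ 2) (i : Fin n) :
    (fun k => p k i - M.rate k (b k) i) =O[atTop] ρ := by
  have hrate := (hb.rate_isTheta_one hm0 hp
    (hdev.trans ((hρ.pow 2).congr_right fun _ => one_pow 2)) i).1
  refine .of_pow two_ne_zero ?_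
  refine (((hb.sq_div_rate_isBigO_deviation i).trans hdev).mul hrate).congr (fun k => ?_)
    fun k => mul_one _
  rw [div_mul_cancel₀ _ (M.rate_pos k _ (hb.mem k) i).ne', Pi.pow_apply]

theorem linearPart_isBigO (hb : M.IsBestFit p b) (hm0 : ∀ k, 0 < m k) (hp : IsStableRate p)
    (hρ : ρ =O[atTop] fun _ => (1 : ℝ))
    (hdev : (fun k => M.deviation k (p k) (b k)) =O[atTop] fun k => ρ k ^ 2)
    (hx : IsNear m p x) :
    (fun k => M.linearPart m k (p k) (b k) (x k)) =O[atTop] fun k => √(m k) * ρ k := by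
  refine (IsBigO.fun_sum fun i (_ : i ∈ Finset.univ) => ?_).const_mul_left 2
  exact (((hb.sub_rate_isBigO hm0 hp hρ hdev i).mul (hb.inv_rate_isBigO_one i)).mul
    (hx i)).congr_right fun k => by ring

theorem isFit (hb : M.IsBestFit p b) (hm0 : ∀ k, 0 < m k) (hp : IsStableRate p)
    (hρ : ρ =O[atTop] fun _ => (1 : ℝ)) (hmρ : (fun k => (√(m k))⁻¹) =O[atTop] ρ)
    (hdev : (fun k => M.deviation k (p k) (b k)) =O[atTop] fun k => ρ k ^ 2)
    (hx : IsNear m p x) : M.IsFit m ρ x b where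
  mem := hb.mem
  isTheta_mean := hb.mean_isTheta hm0 hp (hdev.trans ((hρ.pow 2).congr_right fun _ => one_pow 2))
  sub_isBigO i := by
    refine (((hx i).trans (sqrt_isBigO_mul hmρ)).add
      ((isBigO_refl m atTop).mul (hb.sub_rate_isBigO hm0 hp hρ hdev i))).congr_left fun k => ?_
    rw [mean]
    ring

end IsBestFit

end BinModel

namespace BinModel.IsBestFit

variable {n : ℕ} {M : BinModel n} {m ρ : ℕ → ℝ} {p x y : ℕ → Fin n → ℝ} {b θ : ℕ → M.Param}

/-- The forms differ at `θ` and at `b` by `O(m ρ ^ 3)` and the penalty at `b` is bounded, so the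
chi-square at `θ` exceeds that at `b` by at most `o(m ρ ^ 2)`. -/
theorem norm_sub_isLittleO (hb : M.IsBestFit p b) (v : Form) (hm0 : ∀ k, 0 < m k)
    (hm : Tendsto m atTop atTop) (hp : IsStableRate p) (hρ : ρ =o[atTop] fun _ => (1 : ℝ))
    (hmρ : (fun k => (√(m k))⁻¹) =o[atTop] ρ)
    (hdev : (fun k => M.deviation k (p k) (b k)) =O[atTop] fun k => ρ k ^ 2)
    (hx : IsNear m p x) (hθ : M.IsFit m ρ x θ)
    (hle : ∀ k, M.T m v k (θ k) (x k) ≤ M.T m v k (b k) (x k)) :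
    (fun k => ‖θ k - b k‖) =o[atTop] ρ := by
  have hone := one_isLittleO_mul_sq hm0 hmρ
  have hexcess {z : ℕ → M.Param} (hz : M.IsFit m ρ x z) :
      (fun k => M.T m v k (z k) (x k) - M.T m .pearson k (z k) (x k)) =o[atTop]
        fun k => m k * ρ k ^ 2 :=
    (T_sub_T_pearson_isBigO v hm0 hρ hmρ.isBigO hz).trans_isLittleO (mul_cube_isLittleO hρ)
  set u : ℕ → ℝ := fun k => (M.T m v k (b k) (x k) - M.T m .pearson k (b k) (x k)) -
    (M.T m v k (θ k) (x k) - M.T m .pearson k (θ k) (x k)) + M.pen k (b k)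
  have hu : u =o[atTop] fun k => m k * ρ k ^ 2 :=
    ((hexcess (hb.isFit hm0 hp hρ.isBigO hmρ.isBigO hdev hx)).sub (hexcess hθ)).add
      (hb.pen_isBigO_one.trans_isLittleO hone)
  have hρ2 : (fun k => ρ k ^ 2) =O[atTop] fun _ => (1 : ℝ) :=
    (hρ.isBigO.pow 2).congr_right fun _ => one_pow 2
  have hum : u =o[atTop] m :=
    hu.trans_isBigO (((isBigO_refl m atTop).mul hρ2).congr_right fun _ => mul_one _)
  have hchi k : M.chiSq m k (θ k) (x k) ≤ M.chiSq m k (b k) (x k) + u k := by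
    simp only [u, T_pearson]
    linarith [hle k, M.pen_nonneg k _ (hθ.mem k)]
  have h := (hb.mul_norm_sub_sq_isBigO hm0 hm hp (hdev.trans hρ2) hx hθ.mem hchi
    hum).trans_isLittleO (hu.abs_left.add hone)
  refine IsLittleO.of_pow (n := 2) ?_ two_ne_zero
  refine ((isBigO_refl (fun k => (m k)⁻¹) atTop).mul_isLittleO h).congr (fun k => ?_) fun k => ?_
  · rw [inv_mul_cancel_left₀ (hm0 k).ne', Pi.pow_apply]
  · rw [inv_mul_cancel_left₀ (hm0 k).ne', Pi.pow_apply]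

theorem T_sub_T_sub_linearPart_isLittleO (hb : M.IsBestFit p b) (v : Form) (hm0 : ∀ k, 0 < m k)
    (hm : Tendsto m atTop atTop) (hp : IsStableRate p) (hρ : ρ =o[atTop] fun _ => (1 : ℝ))
    (hmρ : (fun k => (√(m k))⁻¹) =o[atTop] ρ)
    (hdev : (fun k => M.deviation k (p k) (b k)) =O[atTop] fun k => ρ k ^ 2)
    (hx : IsNear m p x) (hθ : M.IsFit m ρ x θ) (hnorm : (fun k => ‖θ k - b k‖) =o[atTop] ρ) :
    (fun k => M.T m v k (θ k) (x k) - M.T m v k (θ k) (fun i => m k * p k i) -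
      M.linearPart m k (p k) (b k) (x k)) =o[atTop] fun k => √(m k) * ρ k := by
  have hdev_one : (fun k => M.deviation k (p k) (b k)) =O[atTop] fun _ => (1 : ℝ) :=
    hdev.trans ((hρ.isBigO.pow 2).congr_right fun _ => one_pow 2)
  have hsub : ∀ i, (fun k => x k i - m k * p k i) =O[atTop] fun k => √(m k) := hx
  have hexcess := (T_sub_T_pearson_sub_isBigO v hm0 hρ hmρ.isBigO hθ
    (hθ.of_isNear hmρ.isBigO (isNear_mul m p) hx) hsub).trans_isLittleO
      (((isBigO_refl (fun k => √(m k) * ρ k) atTop).mul_isLittleO hρ).congr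
        (f₂ := fun k => ρ k ^ 2 * √(m k)) (fun k => by ring) fun k => mul_one _)
  have htendsto : Tendsto (fun k => θ k - b k) atTop (𝓝 0) :=
    (isLittleO_one_iff ℝ).1 ((hnorm.trans hρ).of_norm_left)
  have hinv i : (fun _ => (1 : ℝ)) =O[atTop] fun k => M.rate k (θ k) i := by
    refine ((isBigO_refl (fun k => (m k)⁻¹) atTop).mul (hθ.isTheta_mean i).2).congr (fun k => ?_)
      fun k => ?_
    · exact inv_mul_cancel₀ (hm0 k).ne'
    · rw [mean, inv_mul_cancel_left₀ (hm0 k).ne']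
  have hcross := (chiSq_sub_chiSq_sub_isBigO hm0 hm hp hx hinv
    (fun i => (hb.rate_isTheta_one hm0 hp hdev_one i).2) hθ.mem hb.mem).trans_isLittleO
      ((isBigO_refl (fun k => √(m k)) atTop).mul_isLittleO
        ((hb.norm_rate_sub_isBigO htendsto).trans_isLittleO hnorm))
  have hbest := (hb.chiSq_sub_isBigO_one hm0 hp hdev_one hx).trans_isLittleO
    (one_isLittleO_sqrt_mul hm0 hmρ)
  refine ((hexcess.add hcross).add hbest).congr_left fun k => ?_
  simp only [T_pearson, chiSq_mul (hm0 k)]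
  ring

theorem Tmin_sub_Tmin_sub_linearPart_isLittleO (hb : M.IsBestFit p b) (v : Form)
    (hm0 : ∀ k, 0 < m k) (hm : Tendsto m atTop atTop) (hp : IsStableRate p)
    (hρ : ρ =o[atTop] fun _ => (1 : ℝ)) (hmρ : (fun k => (√(m k))⁻¹) =o[atTop] ρ)
    (hdev : (fun k => M.deviation k (p k) (b k)) =O[atTop] fun k => ρ k ^ 2)
    (hx : IsNear m p x) :
    (fun k => M.Tmin m v k (x k) - M.Tmin m v k (fun i => m k * p k i) -
      M.linearPart m k (p k) (b k) (x k)) =o[atTop] fun k => √(m k) * ρ k := by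
  choose t s ht hs hts using fun k => exists_abs_ciInf_sub_ciInf_sub_le
    (fun z : M.params => M.T m v k z (x k))
    (fun z : M.params => M.T m v k z fun i => m k * p k i)
    (M.linearPart m k (p k) (b k) (x k)) ⟨b k, hb.mem k⟩ one_pos
  have hmean := isNear_mul m p
  have hfit {y : ℕ → Fin n → ℝ} (hy : IsNear m p y) {z : ℕ → M.Param} (hz : ∀ k, z k ∈ M.params)
      (hle : ∀ k, M.T m v k (z k) (y k) ≤ M.T m v k (b k) (y k)) : M.IsFit m ρ y z :=
    isFit_of_T_le v hm0 hm hp hy hρ hmρ.isBigO hz hle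
      ((hb.isFit hm0 hp hρ.isBigO hmρ.isBigO hdev hy).T_isBigO v hm0 hρ hmρ.isBigO
        hb.pen_isBigO_one)
  have hfit_t := hfit hx (fun k => (t k).2) ht
  have hfit_s := hfit hmean (fun k => (s k).2) hs
  have htlin := hb.T_sub_T_sub_linearPart_isLittleO v hm0 hm hp hρ hmρ hdev hx hfit_t
    (hb.norm_sub_isLittleO v hm0 hm hp hρ hmρ hdev hx hfit_t ht)
  have hslin := hb.T_sub_T_sub_linearPart_isLittleO v hm0 hm hp hρ hmρ hdev hx
    (hfit_s.of_isNear hmρ.isBigO hx hmean)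
    (hb.norm_sub_isLittleO v hm0 hm hp hρ hmρ hdev hmean hfit_s hs)
  refine IsBigO.trans_isLittleO (.of_norm_eventuallyLE ?_)
    ((htlin.norm_left.add hslin.norm_left).add (one_isLittleO_sqrt_mul hm0 hmρ))
  filter_upwards [hx.eventually_two_le hp hm0 hm, hmean.eventually_two_le hp hm0 hm] with k hk hk'
  exact hts k (bddBelow_T v (hm0 k) hk) (bddBelow_T v (hm0 k) hk')

theorem Tmin_sub_Tmin_pearson_isLittleO (hb : M.IsBestFit p b) (v : Form)
    (hm0 : ∀ k, 0 < m k) (hm : Tendsto m atTop atTop) (hp : IsStableRate p)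
    (hρ : ρ =o[atTop] fun _ => (1 : ℝ)) (hmρ : (fun k => (√(m k))⁻¹) =O[atTop] ρ)
    (hdev : (fun k => M.deviation k (p k) (b k)) =O[atTop] fun k => ρ k ^ 2)
    (hx : IsNear m p x) :
    (fun k => M.Tmin m v k (x k) - M.Tmin m .pearson k (x k)) =o[atTop] fun k => m k * ρ k ^ 2 :=
  (Tmin_sub_Tmin_isBigO v .pearson hm0 hm hp hx hρ hmρ (hb.isFit hm0 hp hρ.isBigO hmρ hdev hx)
    hb.pen_isBigO_one).trans_isLittleO (mul_cube_isLittleO hρ)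

end BinModel.IsBestFit

namespace BinModel

variable {n : ℕ} {M : BinModel n} {m : ℕ → ℝ} {p x : ℕ → Fin n → ℝ} {b : ℕ → M.Param}

theorem chiSqMin_eq_of_isMinOn {k : ℕ} (hm0 : 0 < m k) {θ : M.Param} (hθ : θ ∈ M.params)
    {x : Fin n → ℝ} (hmin : IsMinOn (fun θ => M.chiSq m k θ x) M.params θ) :
    M.chiSqMin m k x = M.chiSq m k θ x :=
  have : Nonempty M.params := ⟨⟨θ, hθ⟩⟩
  le_antisymm (chiSqMin_le hm0 hθ x) (le_ciInf fun z => hmin z.2)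

namespace IsBestFit

theorem isMinOn_chiSq (hb : M.IsBestFit p b) {k : ℕ} (hm0 : 0 < m k) :
    IsMinOn (fun θ => M.chiSq m k θ fun i => m k * p k i) M.params (b k) := fun θ hθ => by
  simp only [Set.mem_ofPred_eq, chiSq_mul hm0]
  exact mul_le_mul_of_nonneg_left (hb.deviation_le k hθ) hm0.le

theorem chiSqMin_mul (hb : M.IsBestFit p b) {k : ℕ} (hm0 : 0 < m k) :
    M.chiSqMin m k (fun i => m k * p k i) = m k * M.deviation k (p k) (b k) := by
  rw [chiSqMin_eq_of_isMinOn hm0 (hb.mem k) (hb.isMinOn_chiSq hm0), chiSq_mul hm0]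

theorem deviation_isBigO_norm_sq (hb : M.IsBestFit p b) :
    (fun k => M.deviation k (p k) (b k)) =O[atTop] fun k => ‖p k - M.rate k (b k)‖ ^ 2 := by
  refine IsBigO.fun_sum fun i _ => ?_
  have hbin : (fun k => p k i - M.rate k (b k) i) =O[atTop] fun k => ‖p k - M.rate k (b k)‖ :=
    .of_norm_le fun k => norm_le_pi_norm (p k - M.rate k (b k)) i
  exact ((hbin.pow 2).mul (hb.inv_rate_isBigO_one i)).congr_right fun k => mul_one _

theorem deviation_isBigO_one (hb : M.IsBestFit p b)
    (hδ : ∀ i, (fun k => p k i - M.rate k (b k) i) =O[atTop] fun _ => (1 : ℝ)) :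
    (fun k => M.deviation k (p k) (b k)) =O[atTop] fun _ => (1 : ℝ) := by
  have hnorm : (fun k => ‖p k - M.rate k (b k)‖) =O[atTop] fun _ => (1 : ℝ) :=
    (isBigO_pi.2 hδ).norm_left
  exact hb.deviation_isBigO_norm_sq.trans ((hnorm.pow 2).congr_right fun _ => one_pow 2)

theorem sqrt_deviation_isLittleO_one (hb : M.IsBestFit p b)
    (hδ : ∀ i, (fun k => p k i - M.rate k (b k) i) =o[atTop] fun _ => (1 : ℝ)) :
    (fun k => √(M.deviation k (p k) (b k))) =o[atTop] fun _ => (1 : ℝ) := by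
  have hnorm : (fun k => ‖p k - M.rate k (b k)‖) =o[atTop] fun _ => (1 : ℝ) :=
    (isLittleO_pi.2 hδ).norm_left
  refine (isLittleO_one_iff ℝ).2 ?_
  have := (isLittleO_one_iff ℝ).1 (hb.deviation_isBigO_norm_sq.trans_isLittleO
    ((hnorm.pow two_pos).congr_right fun _ => one_pow 2))
  simpa only [Real.sqrt_zero] using this.sqrt

theorem deviation_nonneg (hb : M.IsBestFit p b) (k : ℕ) : 0 ≤ M.deviation k (p k) (b k) :=
  Finset.sum_nonneg fun i _ => div_nonneg (sq_nonneg _) (M.rate_pos k _ (hb.mem k) i).le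

theorem deviation_isBigO_sqrt_sq (hb : M.IsBestFit p b) :
    (fun k => M.deviation k (p k) (b k)) =O[atTop] fun k => √(M.deviation k (p k) (b k)) ^ 2 :=
  (isBigO_refl _ _).congr_right fun k => (Real.sq_sqrt (hb.deviation_nonneg k)).symm

theorem inv_sqrt_isLittleO_sqrt_deviation (hm0 : ∀ k, 0 < m k)
    (hD : Tendsto (fun k => m k * M.deviation k (p k) (b k)) atTop atTop) :
    (fun k => (√(m k))⁻¹) =o[atTop] fun k => √(M.deviation k (p k) (b k)) := by
  have hone : (fun _ => (1 : ℝ)) =o[atTop] fun k => √(m k * M.deviation k (p k) (b k)) :=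
    (isLittleO_const_left_of_ne one_ne_zero).2
      (tendsto_norm_atTop_atTop.comp (Real.tendsto_sqrt_atTop.comp hD))
  refine ((isBigO_refl (fun k => (√(m k))⁻¹) atTop).mul_isLittleO hone).congr
    (fun k => mul_one _) fun k => ?_
  rw [Real.sqrt_mul (hm0 k).le, inv_mul_cancel_left₀ (Real.sqrt_pos.2 (hm0 k)).ne']

section Divergent

variable (hb : M.IsBestFit p b) (hm0 : ∀ k, 0 < m k) (hm : Tendsto m atTop atTop)
  (hp : IsStableRate p)
  (hδ : ∀ i, (fun k => p k i - M.rate k (b k) i) =o[atTop] fun _ => (1 : ℝ))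
  (hD : Tendsto (fun k => m k * M.deviation k (p k) (b k)) atTop atTop) (hx : IsNear m p x)

include hb hm0 hm hp hδ hD hx

theorem Tmin_sub_Tmin_sub_linearPart_isLittleO_sqrt (v : Form) :
    (fun k => M.Tmin m v k (x k) - M.Tmin m v k (fun i => m k * p k i) -
      M.linearPart m k (p k) (b k) (x k)) =o[atTop]
      fun k => √(m k * M.deviation k (p k) (b k)) :=
  (hb.Tmin_sub_Tmin_sub_linearPart_isLittleO v hm0 hm hp (hb.sqrt_deviation_isLittleO_one hδ)
    (inv_sqrt_isLittleO_sqrt_deviation hm0 hD) hb.deviation_isBigO_sqrt_sq hx).congr_right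
    fun k => (Real.sqrt_mul (hm0 k).le _).symm

theorem Tmin_sub_Tmin_pearson_isLittleO_mul (v : Form) :
    (fun k => M.Tmin m v k (x k) - M.Tmin m .pearson k (x k)) =o[atTop]
      fun k => m k * M.deviation k (p k) (b k) :=
  (hb.Tmin_sub_Tmin_pearson_isLittleO v hm0 hm hp (hb.sqrt_deviation_isLittleO_one hδ)
    (inv_sqrt_isLittleO_sqrt_deviation hm0 hD).isBigO hb.deviation_isBigO_sqrt_sq hx).congr_right
    fun k => by rw [Real.sq_sqrt (hb.deviation_nonneg k)]

theorem chiSqMin_isEquivalent :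
    (fun k => M.chiSqMin m k (x k)) ~[atTop] fun k => m k * M.deviation k (p k) (b k) := by
  have hdev := hb.deviation_isBigO_one fun i => (hδ i).isBigO
  have hlinear := (hb.linearPart_isBigO hm0 hp (hb.sqrt_deviation_isLittleO_one hδ).isBigO
    hb.deviation_isBigO_sqrt_sq hx).congr_right fun k => (Real.sqrt_mul (hm0 k).le _).symm
  refine (((hb.chiSqMin_sub_isBigO_one hm0 hm hp hdev hx).trans_isLittleO
    (isLittleO_const_left_of_ne one_ne_zero |>.2 (tendsto_norm_atTop_atTop.comp hD))).add
      (hlinear.trans_isLittleO (sqrt_isLittleO hD))).congr_left fun k => ?_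
  rw [Pi.sub_apply]
  ring

theorem Tmin_sub_chiSqMin_isLittleO (v : Form) :
    (fun k => M.Tmin m v k (x k) - M.chiSqMin m k (x k)) =o[atTop]
      fun k => m k * M.deviation k (p k) (b k) :=
  ((hb.Tmin_sub_Tmin_pearson_isLittleO_mul hm0 hm hp hδ hD hx v).add
    ((hb.Tmin_pearson_sub_chiSqMin_isBigO_one hm0 hm hp
      (hb.deviation_isBigO_one fun i => (hδ i).isBigO) hx).trans_isLittleO
        (isLittleO_const_left_of_ne one_ne_zero |>.2
          (tendsto_norm_atTop_atTop.comp hD)))).congr_left fun _ => sub_add_sub_cancel _ _ _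

theorem Tmin_isEquivalent (v : Form) :
    (fun k => M.Tmin m v k (x k)) ~[atTop] fun k => m k * M.deviation k (p k) (b k) :=
  ((hb.Tmin_sub_chiSqMin_isLittleO hm0 hm hp hδ hD hx v).add
    (hb.chiSqMin_isEquivalent hm0 hm hp hδ hD hx)).congr_left fun k => by
      rw [Pi.sub_apply, Pi.sub_apply, sub_add_sub_cancel]

end Divergent

end IsBestFit

end BinModel

section CountData

variable {n : ℕ} {Ω : ℕ → Type*} [∀ k, MeasurableSpace (Ω k)] {P : ∀ k, Measure (Ω k)}
  [∀ k, IsProbabilityMeasure (P k)] {X : ∀ k, Ω k → Fin n → ℝ} {m : ℕ → ℝ} {p : ℕ → Fin n → ℝ}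
  {Y R : ∀ k, Ω k → ℝ}

namespace IsCountData

theorem approxNormal_sum_mul_sub {l : ℕ → Fin n → ℝ} (h : IsCountData P X l)
    (hl0 : ∀ k i, 0 < l k i) (hl : ∀ i, Tendsto (fun k => l k i) atTop atTop)
    (w : ℕ → Fin n → ℝ) :
    ApproxNormal P (fun k ω => ∑ i, w k i * (X k ω i - l k i)) (fun _ => 0)
      (fun k => ∑ i, w k i ^ 2 * l k i) := by
  have hsum := h.approxNormal_sum hl fun k i => w k i * √(l k i)
  have hY k ω i : w k i * √(l k i) * ((X k ω i - l k i) / √(l k i)) =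
      w k i * (X k ω i - l k i) := by
    rw [mul_assoc, mul_div_cancel₀ _ (Real.sqrt_pos.2 (hl0 k i)).ne']
  simpa only [hY, mul_pow, Real.sq_sqrt (hl0 _ _).le] using hsum

theorem isBigOInProb_norm_sub_mul (hX : IsCountData P X fun k i => m k * p k i)
    (hm0 : ∀ k, 0 < m k) (hm : Tendsto m atTop atTop) (hp : IsStableRate p) :
    IsBigOInProb P (fun k ω => ‖X k ω - fun i => m k * p k i‖) fun k => √(m k) :=
  hX.isBigOInProb_norm_sub (hp.tendsto_mul hm0 hm) (fun i => (hp.isTheta_mul i).1)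
    fun k => (hm0 k).le

theorem isBigOInProb_of_forall_isNear (hX : IsCountData P X fun k i => m k * p k i)
    (hm0 : ∀ k, 0 < m k) (hm : Tendsto m atTop atTop) (hp : IsStableRate p) {s : ℕ → ℝ}
    (hs : ∀ k, 0 ≤ s k) (h : ∀ ω : ∀ k, Ω k, IsNear m p (fun k => X k (ω k)) →
      (fun k => Y k (ω k)) =O[atTop] s) : IsBigOInProb P Y s :=
  (hX.isBigOInProb_norm_sub_mul hm0 hm hp).isBigOInProb_of_forall_seq hs
    fun ω hω => h ω (isNear_of_norm_isBigO hω)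

theorem isLittleOInProb_of_forall_isNear (hX : IsCountData P X fun k i => m k * p k i)
    (hm0 : ∀ k, 0 < m k) (hm : Tendsto m atTop atTop) (hp : IsStableRate p)
    (h : ∀ ω : ∀ k, Ω k, IsNear m p (fun k => X k (ω k)) →
      (fun k => Y k (ω k)) =o[atTop] fun k => R k (ω k)) : IsLittleOInProb P Y R :=
  (hX.isBigOInProb_norm_sub_mul hm0 hm hp).isLittleOInProb_of_forall_seq
    fun ω hω => h ω (isNear_of_norm_isBigO hω)

end IsCountData

end CountData

/-! ### The laws of the statistics -/

section Leading

variable {n : ℕ} {H₀ H₁ : BinModel n} {m : ℕ → ℝ} {η₀ : ℕ → H₀.Param} {ζ₀ : ℕ → H₁.Param}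

theorem D₂_eq_linearPart {k : ℕ} (hm0 : 0 < m k) (x : Fin n → ℝ) :
    D₂ H₀ H₁ m η₀ ζ₀ k x = H₁.linearPart m k (H₀.rate k (η₀ k)) (ζ₀ k) x := by
  rw [D₂, BinModel.linearPart, mul_assoc, Finset.mul_sum]
  congr 1
  refine Finset.sum_congr rfl fun i _ => ?_
  rw [mul_left_comm, ← mul_assoc √(m k), Real.mul_self_sqrt hm0.le, mul_sub,
    mul_div_cancel₀ _ hm0.ne', rateDiff]

theorem Dbar_eq_D₁ (hb : H₁.IsBestFit (fun k => H₀.rate k (η₀ k)) ζ₀) (hm0 : ∀ k, 0 < m k) :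
    Dbar H₀ H₁ m η₀ = D₁ H₀ H₁ m η₀ ζ₀ :=
  funext fun k => hb.chiSqMin_mul (hm0 k)

theorem isLeast_D₁ (hb : H₁.IsBestFit (fun k => H₀.rate k (η₀ k)) ζ₀) {k : ℕ} (hm0 : 0 < m k) :
    IsLeast ((fun ζ => H₁.chiSq m k ζ (H₀.mean m k (η₀ k))) '' H₁.params)
      (D₁ H₀ H₁ m η₀ ζ₀ k) := by
  refine ⟨⟨ζ₀ k, hb.mem k, BinModel.chiSq_mul hm0 _ _⟩, ?_⟩
  rintro _ ⟨ζ, hζ, rfl⟩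
  exact (BinModel.chiSq_mul hm0 _ _).ge.trans (hb.isMinOn_chiSq hm0 hζ)

theorem pearsonD_mean (ht : H₀.IsTruth η₀) (hm0 : ∀ k, 0 < m k) (k : ℕ) :
    pearsonD H₀ H₁ m k (H₀.mean m k (η₀ k)) = Dbar H₀ H₁ m η₀ k := by
  rw [pearsonD, ht.chiSqMin_mean hm0, sub_zero, Dbar]

theorem Dbar_isBigO (hb : H₁.IsBestFit (fun k => H₀.rate k (η₀ k)) ζ₀) (hm0 : ∀ k, 0 < m k)
    (hA0 : ∀ i, (fun k => rateDiff H₀ H₁ η₀ ζ₀ k i) =O[atTop] fun _ => (1 : ℝ)) :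
    Dbar H₀ H₁ m η₀ =O[atTop] m := by
  rw [Dbar_eq_D₁ hb hm0]
  exact ((isBigO_refl m atTop).mul (hb.deviation_isBigO_one hA0)).congr_right fun _ => mul_one _

theorem deviation_add_sTerm {k : ℕ} (hζ : ζ₀ k ∈ H₁.params) :
    H₁.deviation k (H₀.rate k (η₀ k)) (ζ₀ k) + sTerm H₀ H₁ η₀ ζ₀ k =
      ∑ i, (rateDiff H₀ H₁ η₀ ζ₀ k i / H₁.rate k (ζ₀ k) i) ^ 2 * H₀.rate k (η₀ k) i := by
  rw [BinModel.deviation, sTerm, ← Finset.sum_add_distrib]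
  refine Finset.sum_congr rfl fun i _ => ?_
  have := (H₁.rate_pos k _ hζ i).ne'
  rw [rateDiff]
  field_simp
  ring

theorem four_mul_Dbar_add_sTerm (hb : H₁.IsBestFit (fun k => H₀.rate k (η₀ k)) ζ₀)
    (hm0 : ∀ k, 0 < m k) (k : ℕ) :
    4 * Dbar H₀ H₁ m η₀ k + 4 * m k * sTerm H₀ H₁ η₀ ζ₀ k =
      4 * m k * ∑ i, (rateDiff H₀ H₁ η₀ ζ₀ k i / H₁.rate k (ζ₀ k) i) ^ 2 *
        H₀.rate k (η₀ k) i := by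
  rw [← deviation_add_sTerm (hb.mem k), Dbar_eq_D₁ hb hm0, D₁, BinModel.deviation]
  simp only [rateDiff]
  ring

theorem four_mul_Dbar_add_sTerm_nonneg (ht : H₀.IsTruth η₀)
    (hb : H₁.IsBestFit (fun k => H₀.rate k (η₀ k)) ζ₀) (hm0 : ∀ k, 0 < m k) (k : ℕ) :
    0 ≤ 4 * Dbar H₀ H₁ m η₀ k + 4 * m k * sTerm H₀ H₁ η₀ ζ₀ k := by
  rw [four_mul_Dbar_add_sTerm hb hm0]
  exact mul_nonneg (mul_nonneg zero_le_four (hm0 k).le) (Finset.sum_nonneg fun i _ =>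
    mul_nonneg (sq_nonneg _) (ht.isStableRate.pos k i).le)

theorem Dbar_isBigO_four_mul_Dbar_add_sTerm (ht : H₀.IsTruth η₀)
    (hb : H₁.IsBestFit (fun k => H₀.rate k (η₀ k)) ζ₀) (hm0 : ∀ k, 0 < m k)
    (hA0 : ∀ i, (fun k => rateDiff H₀ H₁ η₀ ζ₀ k i) =O[atTop] fun _ => (1 : ℝ)) :
    Dbar H₀ H₁ m η₀ =O[atTop]
      fun k => 4 * Dbar H₀ H₁ m η₀ k + 4 * m k * sTerm H₀ H₁ η₀ ζ₀ k := by
  have hw0 k i : 0 ≤ (rateDiff H₀ H₁ η₀ ζ₀ k i / H₁.rate k (ζ₀ k) i) ^ 2 * H₀.rate k (η₀ k) i :=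
    mul_nonneg (sq_nonneg _) (ht.isStableRate.pos k i).le
  have hratio i : (fun k => H₁.rate k (ζ₀ k) i / H₀.rate k (η₀ k) i) =O[atTop]
      fun _ => (1 : ℝ) :=
    ((hb.rate_isTheta_one hm0 ht.isStableRate (hb.deviation_isBigO_one hA0) i).div
      (ht.isStableRate.isTheta_one i)).1.congr_right fun _ => div_one _
  have hdev : (fun k => ∑ i, rateDiff H₀ H₁ η₀ ζ₀ k i ^ 2 / H₁.rate k (ζ₀ k) i) =O[atTop] fun k =>
      ∑ i, (rateDiff H₀ H₁ η₀ ζ₀ k i / H₁.rate k (ζ₀ k) i) ^ 2 * H₀.rate k (η₀ k) i := by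
    refine IsBigO.fun_sum fun i _ => ((isBigO_sum_of_nonneg hw0 i).mul (hratio i)).congr
      (fun k => ?_) fun k => mul_one _
    have := (ht.isStableRate.pos k i).ne'
    have := (H₁.rate_pos k _ (hb.mem k) i).ne'
    field_simp
  have hmul := ((isBigO_refl m atTop).mul hdev).const_mul_right (four_ne_zero' ℝ)
  refine IsBigO.congr hmul (fun k => (congr_fun (Dbar_eq_D₁ hb hm0) k).symm) fun k => ?_
  rw [four_mul_Dbar_add_sTerm hb hm0, mul_assoc]

theorem rateDiff_isLittleO_one (ht : H₀.IsTruth η₀) (hm0 : ∀ k, 0 < m k) {i : Fin n}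
    (h : (fun k => H₀.mean m k (η₀ k) i - H₁.mean m k (ζ₀ k) i) =o[atTop]
      fun k => H₀.mean m k (η₀ k) i) :
    (fun k => rateDiff H₀ H₁ η₀ ζ₀ k i) =o[atTop] fun _ => (1 : ℝ) := by
  have hscaled := (isBigO_refl (fun k => (m k)⁻¹) atTop).mul_isLittleO h
  refine IsLittleO.trans_isBigO (hscaled.congr (fun k => ?_) fun k => ?_)
    (ht.isStableRate.isTheta_one i).1
  · rw [BinModel.mean, BinModel.mean, ← mul_sub, inv_mul_cancel_left₀ (hm0 k).ne', rateDiff]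
  · rw [BinModel.mean, inv_mul_cancel_left₀ (hm0 k).ne']

theorem mul_sTerm_isLittleO (hb : H₁.IsBestFit (fun k => H₀.rate k (η₀ k)) ζ₀)
    (hm0 : ∀ k, 0 < m k)
    (hδ : ∀ i, (fun k => rateDiff H₀ H₁ η₀ ζ₀ k i) =o[atTop] fun _ => (1 : ℝ)) :
    (fun k => m k * sTerm H₀ H₁ η₀ ζ₀ k) =o[atTop] Dbar H₀ H₁ m η₀ := by
  rw [Dbar_eq_D₁ hb hm0]
  refine (isBigO_refl m atTop).mul_isLittleO (IsLittleO.fun_sum fun i _ => ?_)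
  refine ((hb.sq_div_rate_isBigO_deviation i).mul_isLittleO
    ((hδ i).mul_isBigO (hb.inv_rate_isBigO_one i))).congr (fun k => ?_)
    fun k => by rw [mul_one, mul_one]; rfl
  rw [rateDiff]
  ring

theorem four_mul_Dbar_add_sTerm_isEquivalent (hb : H₁.IsBestFit (fun k => H₀.rate k (η₀ k)) ζ₀)
    (hm0 : ∀ k, 0 < m k)
    (hδ : ∀ i, (fun k => rateDiff H₀ H₁ η₀ ζ₀ k i) =o[atTop] fun _ => (1 : ℝ)) :
    (fun k => 4 * Dbar H₀ H₁ m η₀ k + 4 * m k * sTerm H₀ H₁ η₀ ζ₀ k) ~[atTop]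
      fun k => 4 * Dbar H₀ H₁ m η₀ k := by
  refine ((mul_sTerm_isLittleO hb hm0 hδ).const_mul_right four_ne_zero
    |>.const_mul_left 4).congr_left fun k => ?_
  rw [Pi.sub_apply]
  ring

theorem pearsonD_eq_of_isMinOn {k : ℕ} (hm0 : 0 < m k) {x : Fin n → ℝ} {η : H₀.Param}
    {ζ : H₁.Param} (hη : η ∈ H₀.params ∧ IsMinOn (fun η => H₀.chiSq m k η x) H₀.params η)
    (hζ : ζ ∈ H₁.params ∧ IsMinOn (fun ζ => H₁.chiSq m k ζ x) H₁.params ζ) :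
    pearsonD H₀ H₁ m k x = H₁.chiSq m k ζ x - H₀.chiSq m k η x := by
  rw [pearsonD, BinModel.chiSqMin_eq_of_isMinOn hm0 hη.1 hη.2,
    BinModel.chiSqMin_eq_of_isMinOn hm0 hζ.1 hζ.2]

section Near

variable {x : ℕ → Fin n → ℝ} (ht : H₀.IsTruth η₀)
  (hb : H₁.IsBestFit (fun k => H₀.rate k (η₀ k)) ζ₀) (hm0 : ∀ k, 0 < m k)
  (hm : Tendsto m atTop atTop) (hx : IsNear m (fun k => H₀.rate k (η₀ k)) x)

include ht hb hm0 hx in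
theorem D₂_isBigO_sqrt
    (hA0 : ∀ i, (fun k => rateDiff H₀ H₁ η₀ ζ₀ k i) =O[atTop] fun _ => (1 : ℝ)) :
    (fun k => D₂ H₀ H₁ m η₀ ζ₀ k (x k)) =O[atTop] fun k => √(m k) :=
  (hb.linearPart_isBigO hm0 ht.isStableRate (isBigO_refl _ _)
    ((hb.deviation_isBigO_one hA0).congr_right fun _ => (one_pow 2).symm) hx).congr
    (fun k => (D₂_eq_linearPart (hm0 k) _).symm) fun _ => mul_one _

include ht hb hm0 hm hx

theorem pearsonD_sub_isBigO_one
    (hA0 : ∀ i, (fun k => rateDiff H₀ H₁ η₀ ζ₀ k i) =O[atTop] fun _ => (1 : ℝ)) :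
    (fun k => pearsonD H₀ H₁ m k (x k) - (D₁ H₀ H₁ m η₀ ζ₀ k + D₂ H₀ H₁ m η₀ ζ₀ k (x k)))
      =O[atTop] fun _ => (1 : ℝ) := by
  refine ((hb.chiSqMin_sub_isBigO_one hm0 hm ht.isStableRate (hb.deviation_isBigO_one hA0)
    hx).sub (ht.chiSqMin_isBigO_one hm0 hx)).congr_left fun k => ?_
  rw [D₂_eq_linearPart (hm0 k), pearsonD, sub_right_comm]
  rfl

variable (hδ : ∀ i, (fun k => rateDiff H₀ H₁ η₀ ζ₀ k i) =o[atTop] fun _ => (1 : ℝ))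
  (hD : Tendsto (Dbar H₀ H₁ m η₀) atTop atTop)

include hδ hD

theorem deltaT_sub_deltaT_mean_sub_D₂_isLittleO (v : Form) :
    (fun k => DeltaT H₀ H₁ m v k (x k) - DeltaT H₀ H₁ m v k (H₀.mean m k (η₀ k)) -
      D₂ H₀ H₁ m η₀ ζ₀ k (x k)) =o[atTop] fun k => √(Dbar H₀ H₁ m η₀ k) := by
  have hone : (fun _ => (1 : ℝ)) =o[atTop] fun k => √(Dbar H₀ H₁ m η₀ k) :=
    (isLittleO_const_left_of_ne one_ne_zero).2
      (tendsto_norm_atTop_atTop.comp (Real.tendsto_sqrt_atTop.comp hD))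
  have htruth : (fun k => H₀.Tmin m v k (x k) - H₀.Tmin m v k (H₀.mean m k (η₀ k))) =o[atTop]
      fun k => √(Dbar H₀ H₁ m η₀ k) :=
    ((ht.Tmin_isBigO_one hm0 hm hx v).sub
      (ht.Tmin_isBigO_one hm0 hm (isNear_mul m _) v)).trans_isLittleO hone
  rw [Dbar_eq_D₁ hb hm0] at hD htruth ⊢
  have hfit : (fun k => H₁.Tmin m v k (x k) - H₁.Tmin m v k (H₀.mean m k (η₀ k)) -
      H₁.linearPart m k (H₀.rate k (η₀ k)) (ζ₀ k) (x k)) =o[atTop]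
      fun k => √(D₁ H₀ H₁ m η₀ ζ₀ k) :=
    hb.Tmin_sub_Tmin_sub_linearPart_isLittleO_sqrt hm0 hm ht.isStableRate hδ hD hx v
  refine (hfit.sub htruth).congr_left fun k => ?_
  rw [D₂_eq_linearPart (hm0 k), DeltaT, DeltaT]
  ring

theorem pearsonD_isEquivalent :
    (fun k => pearsonD H₀ H₁ m k (x k)) ~[atTop] Dbar H₀ H₁ m η₀ := by
  have htruth := (ht.chiSqMin_isBigO_one hm0 hx).trans_isLittleO
    ((isLittleO_const_left_of_ne one_ne_zero).2 (tendsto_norm_atTop_atTop.comp hD))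
  rw [Dbar_eq_D₁ hb hm0] at hD htruth ⊢
  exact (hb.chiSqMin_isEquivalent hm0 hm ht.isStableRate hδ hD hx).sub_isLittleO htruth

theorem deltaT_sub_pearsonD_isLittleO (v : Form) :
    (fun k => DeltaT H₀ H₁ m v k (x k) - pearsonD H₀ H₁ m k (x k)) =o[atTop]
      Dbar H₀ H₁ m η₀ := by
  have htruth := ((ht.Tmin_isBigO_one hm0 hm hx v).sub (ht.chiSqMin_isBigO_one hm0 hx)
    ).trans_isLittleO ((isLittleO_const_left_of_ne one_ne_zero).2
      (tendsto_norm_atTop_atTop.comp hD))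
  rw [Dbar_eq_D₁ hb hm0] at hD htruth ⊢
  exact ((hb.Tmin_sub_chiSqMin_isLittleO hm0 hm ht.isStableRate hδ hD hx v).sub
    htruth).congr_left fun k => sub_sub_sub_comm _ _ _ _

theorem deltaT_isEquivalent (v : Form) :
    (fun k => DeltaT H₀ H₁ m v k (x k)) ~[atTop] Dbar H₀ H₁ m η₀ :=
  ((deltaT_sub_pearsonD_isLittleO ht hb hm0 hm hx hδ hD v).add_isEquivalent
    (pearsonD_isEquivalent ht hb hm0 hm hx hδ hD)).congr_left
      (.of_forall fun _ => sub_add_cancel _ _)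

theorem Dbar_isEquivalent_abs_deltaT (v : Form) :
    Dbar H₀ H₁ m η₀ ~[atTop] fun k => |DeltaT H₀ H₁ m v k (x k)| := by
  have hequiv := (deltaT_isEquivalent ht hb hm0 hm hx hδ hD v).symm
  refine hequiv.congr_right ?_
  filter_upwards [(hequiv.tendsto_atTop hD).eventually_ge_atTop 0] with k hk
    using (abs_of_nonneg hk).symm

end Near

end Leading

section Laws

variable {n : ℕ} {H₀ H₁ : BinModel n} {m : ℕ → ℝ} {η₀ : ℕ → H₀.Param} {ζ₀ : ℕ → H₁.Param}
  {Ω : ℕ → Type*} [∀ k, MeasurableSpace (Ω k)] {P : ∀ k, Measure (Ω k)}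
  [∀ k, IsProbabilityMeasure (P k)] {X : ∀ k, Ω k → Fin n → ℝ}
  (ht : H₀.IsTruth η₀) (hb : H₁.IsBestFit (fun k => H₀.rate k (η₀ k)) ζ₀)
  (hX : IsCountData P X fun k => H₀.mean m k (η₀ k)) (hm0 : ∀ k, 0 < m k)
  (hm : Tendsto m atTop atTop)

include ht hb hX hm0 hm

theorem isBigOInProb_norm_sub_of_isMinOn
    (hA0 : ∀ i, (fun k => rateDiff H₀ H₁ η₀ ζ₀ k i) =O[atTop] fun _ => (1 : ℝ))
    {ζhat : ∀ k, Ω k → H₁.Param} (hζ : ∀ k ω, ζhat k ω ∈ H₁.params ∧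
      IsMinOn (fun ζ => H₁.chiSq m k ζ (X k ω)) H₁.params (ζhat k ω)) :
    IsBigOInProb P (fun k ω => ‖ζhat k ω - ζ₀ k‖) fun k => (√(m k))⁻¹ :=
  hX.isBigOInProb_of_forall_isNear hm0 hm ht.isStableRate
    (fun _ => inv_nonneg.2 (Real.sqrt_nonneg _)) fun ω hω =>
      hb.norm_sub_isBigO hm0 hm ht.isStableRate (hb.deviation_isBigO_one hA0) hω
        (fun k => (hζ k (ω k)).1) fun k => (hζ k (ω k)).2 (hb.mem k)

theorem isBigOInProb_D₂
    (hA0 : ∀ i, (fun k => rateDiff H₀ H₁ η₀ ζ₀ k i) =O[atTop] fun _ => (1 : ℝ)) :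
    IsBigOInProb P (fun k ω => D₂ H₀ H₁ m η₀ ζ₀ k (X k ω)) fun k => √(m k) :=
  hX.isBigOInProb_of_forall_isNear hm0 hm ht.isStableRate (fun _ => Real.sqrt_nonneg _)
    fun _ hω => D₂_isBigO_sqrt ht hb hm0 hω hA0

theorem isBigOInProb_pearsonD_sub
    (hA0 : ∀ i, (fun k => rateDiff H₀ H₁ η₀ ζ₀ k i) =O[atTop] fun _ => (1 : ℝ)) :
    IsBigOInProb P (fun k ω => pearsonD H₀ H₁ m k (X k ω) -
      (D₁ H₀ H₁ m η₀ ζ₀ k + D₂ H₀ H₁ m η₀ ζ₀ k (X k ω))) fun _ => 1 :=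
  hX.isBigOInProb_of_forall_isNear hm0 hm ht.isStableRate (fun _ => zero_le_one)
    fun _ hω => pearsonD_sub_isBigO_one ht hb hm0 hm hω hA0

omit hb in
theorem isBigOInProb_Tmin_sub_Tmin_pearson (v : Form) :
    IsBigOInProb P (fun k ω => H₀.Tmin m v k (X k ω) - H₀.Tmin m .pearson k (X k ω))
      fun k => (√(m k))⁻¹ :=
  hX.isBigOInProb_of_forall_isNear hm0 hm ht.isStableRate
    (fun _ => inv_nonneg.2 (Real.sqrt_nonneg _))
    fun _ hω => ht.Tmin_sub_Tmin_pearson_isBigO hm0 hm hω v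

theorem approxNormal_mul_D₂ (c : ℕ → ℝ) :
    ApproxNormal P (fun k ω => c k * D₂ H₀ H₁ m η₀ ζ₀ k (X k ω)) (fun _ => 0)
      fun k => c k ^ 2 * (4 * Dbar H₀ H₁ m η₀ k + 4 * m k * sTerm H₀ H₁ η₀ ζ₀ k) := by
  have hsum := hX.approxNormal_sum_mul_sub (fun k i => mul_pos (hm0 k) (ht.isStableRate.pos k i))
    (ht.isStableRate.tendsto_mul hm0 hm)
    fun k i => c k * (2 * (rateDiff H₀ H₁ η₀ ζ₀ k i / H₁.rate k (ζ₀ k) i))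
  convert hsum using 3 with k ω k
  · rw [D₂_eq_linearPart (hm0 k), BinModel.linearPart, ← mul_assoc, Finset.mul_sum]
    exact Finset.sum_congr rfl fun i _ => by rw [mul_assoc, mul_assoc, mul_assoc]; rfl
  · rw [four_mul_Dbar_add_sTerm hb hm0, Finset.mul_sum, Finset.mul_sum]
    exact Finset.sum_congr rfl fun i _ => by rw [BinModel.mean]; ring

theorem approxNormal_D₂_div :
    ApproxNormal P (fun k ω => D₂ H₀ H₁ m η₀ ζ₀ k (X k ω) / (2 * √(m k))) (fun _ => 0)
      fun k => Dbar H₀ H₁ m η₀ k / m k + sTerm H₀ H₁ η₀ ζ₀ k := by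
  convert approxNormal_mul_D₂ ht hb hX hm0 hm fun k => (2 * √(m k))⁻¹ using 3 with k ω k
  · rw [div_eq_inv_mul]
  · have := (hm0 k).ne'
    rw [inv_pow, mul_pow, Real.sq_sqrt (hm0 k).le]
    field_simp
    ring

theorem approxNormal_D₁_add_D₂ :
    ApproxNormal P (fun k ω => D₁ H₀ H₁ m η₀ ζ₀ k + D₂ H₀ H₁ m η₀ ζ₀ k (X k ω))
      (Dbar H₀ H₁ m η₀)
      fun k => 4 * Dbar H₀ H₁ m η₀ k + 4 * m k * sTerm H₀ H₁ η₀ ζ₀ k := by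
  have := (approxNormal_mul_D₂ ht hb hX hm0 hm fun _ => 1).const_add (D₁ H₀ H₁ m η₀ ζ₀)
  simpa only [one_mul, one_pow, add_zero, Dbar_eq_D₁ hb hm0] using this

theorem approxNormal_pearsonD
    (hA0 : ∀ i, (fun k => rateDiff H₀ H₁ η₀ ζ₀ k i) =O[atTop] fun _ => (1 : ℝ))
    (hD : Tendsto (Dbar H₀ H₁ m η₀) atTop atTop) :
    ApproxNormal P (fun k ω => pearsonD H₀ H₁ m k (X k ω)) (Dbar H₀ H₁ m η₀)
      fun k => 4 * Dbar H₀ H₁ m η₀ k + 4 * m k * sTerm H₀ H₁ η₀ ζ₀ k := by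
  have hsqrt : (fun _ => (1 : ℝ)) =o[atTop]
      fun k => √(4 * Dbar H₀ H₁ m η₀ k + 4 * m k * sTerm H₀ H₁ η₀ ζ₀ k) := by
    refine ((isLittleO_const_left_of_ne one_ne_zero).2 (tendsto_norm_atTop_atTop.comp
      (Real.tendsto_sqrt_atTop.comp hD))).trans_isBigO ?_
    exact (Dbar_isBigO_four_mul_Dbar_add_sTerm ht hb hm0 hA0).sqrt
      (.of_forall (four_mul_Dbar_add_sTerm_nonneg ht hb hm0))
  exact (approxNormal_D₁_add_D₂ ht hb hX hm0 hm).of_sub_isLittleOInProb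
    (four_mul_Dbar_add_sTerm_nonneg ht hb hm0)
    (hX.isLittleOInProb_of_forall_isNear hm0 hm ht.isStableRate fun ω hω =>
      (pearsonD_sub_isBigO_one ht hb hm0 hm hω hA0).trans_isLittleO hsqrt)

variable (hδ : ∀ i, (fun k => rateDiff H₀ H₁ η₀ ζ₀ k i) =o[atTop] fun _ => (1 : ℝ))

include hδ

omit hX hm [∀ k, IsProbabilityMeasure (P k)] in
theorem ApproxNormal.four_mul_Dbar {Y : ∀ k, Ω k → ℝ} {a : ℕ → ℝ}
    (h : ApproxNormal P Y a
      fun k => 4 * Dbar H₀ H₁ m η₀ k + 4 * m k * sTerm H₀ H₁ η₀ ζ₀ k) :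
    ApproxNormal P Y a fun k => 4 * Dbar H₀ H₁ m η₀ k :=
  h.congr_variance (four_mul_Dbar_add_sTerm_nonneg ht hb hm0)
    (fun k => mul_nonneg zero_le_four (BinModel.chiSqMin_nonneg (hm0 k) _))
    (four_mul_Dbar_add_sTerm_isEquivalent hb hm0 hδ)

variable (hD : Tendsto (Dbar H₀ H₁ m η₀) atTop atTop)

include hD

theorem isLittleOInProb_Tmin_sub_Tmin_pearson (v : Form) :
    IsLittleOInProb P (fun k ω => H₁.Tmin m v k (X k ω) - H₁.Tmin m .pearson k (X k ω))
      fun k ω => H₁.Tmin m .pearson k (X k ω) := by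
  rw [Dbar_eq_D₁ hb hm0] at hD
  refine hX.isLittleOInProb_of_forall_isNear hm0 hm ht.isStableRate fun ω hω => ?_
  exact (hb.Tmin_sub_Tmin_pearson_isLittleO_mul hm0 hm ht.isStableRate hδ hD hω v).trans_isBigO
    (hb.Tmin_isEquivalent hm0 hm ht.isStableRate hδ hD hω .pearson).symm.isBigO

theorem isLittleOInProb_deltaT_sub_pearsonD (v : Form) :
    IsLittleOInProb P (fun k ω => DeltaT H₀ H₁ m v k (X k ω) - pearsonD H₀ H₁ m k (X k ω))
      fun k ω => pearsonD H₀ H₁ m k (X k ω) :=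
  hX.isLittleOInProb_of_forall_isNear hm0 hm ht.isStableRate fun _ hω =>
    (deltaT_sub_pearsonD_isLittleO ht hb hm0 hm hω hδ hD v).trans_isBigO
      (pearsonD_isEquivalent ht hb hm0 hm hω hδ hD).symm.isBigO

theorem isLittleOInProb_mul_deltaT_sub (v : Form) (c : ℝ) :
    IsLittleOInProb P (fun k ω => c * DeltaT H₀ H₁ m v k (X k ω) -
      (c * DeltaT H₀ H₁ m v k (H₀.mean m k (η₀ k)) + c * D₂ H₀ H₁ m η₀ ζ₀ k (X k ω)))
      fun k _ => √(c ^ 2 * (4 * Dbar H₀ H₁ m η₀ k + 4 * m k * sTerm H₀ H₁ η₀ ζ₀ k)) := by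
  refine hX.isLittleOInProb_of_forall_isNear hm0 hm ht.isStableRate fun ω hω => ?_
  have hsqrt : (fun k => √(Dbar H₀ H₁ m η₀ k)) =O[atTop]
      fun k => √(4 * Dbar H₀ H₁ m η₀ k + 4 * m k * sTerm H₀ H₁ η₀ ζ₀ k) :=
    (((isBigO_refl _ _).const_mul_right (four_ne_zero' ℝ)).trans
      (four_mul_Dbar_add_sTerm_isEquivalent hb hm0 hδ).symm.isBigO).sqrt
        (.of_forall (four_mul_Dbar_add_sTerm_nonneg ht hb hm0))
  refine IsLittleO.congr ((isBigO_refl (fun _ => c) atTop).abs_right.mul_isLittleO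
    ((deltaT_sub_deltaT_mean_sub_D₂_isLittleO ht hb hm0 hm hω hδ hD v).trans_isBigO hsqrt))
    (fun k => by ring) fun k => ?_
  rw [Real.sqrt_mul (sq_nonneg c), Real.sqrt_sq_eq_abs]

theorem approxNormal_mul_deltaT (v : Form) (c : ℝ) :
    ApproxNormal P (fun k ω => c * DeltaT H₀ H₁ m v k (X k ω))
      (fun k => c * DeltaT H₀ H₁ m v k (H₀.mean m k (η₀ k)))
      fun k => c ^ 2 * (4 * |DeltaT H₀ H₁ m v k (H₀.mean m k (η₀ k))|) := by
  have hvar : (fun k => c ^ 2 * (4 * Dbar H₀ H₁ m η₀ k + 4 * m k * sTerm H₀ H₁ η₀ ζ₀ k))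
      ~[atTop] fun k => c ^ 2 * (4 * |DeltaT H₀ H₁ m v k (H₀.mean m k (η₀ k))|) :=
    IsEquivalent.mul .refl ((four_mul_Dbar_add_sTerm_isEquivalent hb hm0 hδ).trans
      (IsEquivalent.mul .refl
        (Dbar_isEquivalent_abs_deltaT ht hb hm0 hm (isNear_mul m _) hδ hD v)))
  have hnonneg k := mul_nonneg (sq_nonneg c) (four_mul_Dbar_add_sTerm_nonneg ht hb hm0 k)
  have hD₂ := (approxNormal_mul_D₂ ht hb hX hm0 hm fun _ => c).const_add
    fun k => c * DeltaT H₀ H₁ m v k (H₀.mean m k (η₀ k))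
  have hlaw := (hD₂.of_sub_isLittleOInProb hnonneg
    (isLittleOInProb_mul_deltaT_sub ht hb hX hm0 hm hδ hD v c)).congr_variance hnonneg
      (fun k => by positivity) hvar
  simpa only [add_zero] using hlaw

end Laws

theorem mainTheorem1 {n : ℕ} (H₀ H₁ : BinModel n)
    (m : ℕ → ℝ) (hm_pos : ∀ k, 0 < m k) (hm : Tendsto m atTop atTop)
    {Ω : ℕ → Type*} [∀ k, MeasurableSpace (Ω k)]
    (P : ∀ k, Measure (Ω k)) [∀ k, IsProbabilityMeasure (P k)]
    (X : ∀ k, Ω k → Fin n → ℝ) :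
    -- `H₀` is the correct hypothesis
    (∀ (η₀ : ℕ → H₀.Param) (ζ₀ : ℕ → H₁.Param),
      H₀.IsTruth η₀ →
      H₁.IsBestFit (fun k => H₀.rate k (η₀ k)) ζ₀ →
      IsCountData P X (fun k => H₀.mean m k (η₀ k)) →
      -- [A0]
      (∀ i, (fun k => rateDiff H₀ H₁ η₀ ζ₀ k i) =O[atTop] (fun _ => (1 : ℝ))) →
      -- `D` in terms of the minimizers, and the rate of the fit under `H₁`
      (∀ (ηhat : ∀ k, Ω k → H₀.Param) (ζhat : ∀ k, Ω k → H₁.Param),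
        (∀ k ω, ηhat k ω ∈ H₀.params ∧
          IsMinOn (fun η => H₀.chiSq m k η (X k ω)) H₀.params (ηhat k ω)) →
        (∀ k ω, ζhat k ω ∈ H₁.params ∧
          IsMinOn (fun ζ => H₁.chiSq m k ζ (X k ω)) H₁.params (ζhat k ω)) →
        (∀ k ω, pearsonD H₀ H₁ m k (X k ω) =
          H₁.chiSq m k (ζhat k ω) (X k ω) - H₀.chiSq m k (ηhat k ω) (X k ω))) ∧
      (∀ ζhat : ∀ k, Ω k → H₁.Param,
        (∀ k ω, ζhat k ω ∈ H₁.params ∧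
          IsMinOn (fun ζ => H₁.chiSq m k ζ (X k ω)) H₁.params (ζhat k ω)) →
        IsBigOInProb P (fun k ω => ‖ζhat k ω - ζ₀ k‖) (fun k => (√(m k))⁻¹)) ∧
      -- the leading terms
      (∀ k, IsLeast ((fun ζ => H₁.chiSq m k ζ (H₀.mean m k (η₀ k))) '' H₁.params)
        (D₁ H₀ H₁ m η₀ ζ₀ k)) ∧
      (∀ k, D₁ H₀ H₁ m η₀ ζ₀ k = Dbar H₀ H₁ m η₀ k ∧
        pearsonD H₀ H₁ m k (H₀.mean m k (η₀ k)) = Dbar H₀ H₁ m η₀ k) ∧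
      (fun k => Dbar H₀ H₁ m η₀ k) =O[atTop] m ∧
      IsBigOInProb P (fun k ω => D₂ H₀ H₁ m η₀ ζ₀ k (X k ω)) (fun k => √(m k)) ∧
      -- `D = D₁ + D₂ + O_p(1)`
      IsBigOInProb P (fun k ω => pearsonD H₀ H₁ m k (X k ω) -
        (D₁ H₀ H₁ m η₀ ζ₀ k + D₂ H₀ H₁ m η₀ ζ₀ k (X k ω))) (fun _ => 1) ∧
      -- `D₂ / (2 √m) ≈ N(0, D̄ / m + s)` and `D₁ + D₂ ≈ N(D̄, 4 D̄ + 4 m s)`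
      ApproxNormal P (fun k ω => D₂ H₀ H₁ m η₀ ζ₀ k (X k ω) / (2 * √(m k)))
        (fun _ => 0) (fun k => Dbar H₀ H₁ m η₀ k / m k + sTerm H₀ H₁ η₀ ζ₀ k) ∧
      ApproxNormal P (fun k ω => D₁ H₀ H₁ m η₀ ζ₀ k + D₂ H₀ H₁ m η₀ ζ₀ k (X k ω))
        (Dbar H₀ H₁ m η₀)
        (fun k => 4 * Dbar H₀ H₁ m η₀ k + 4 * m k * sTerm H₀ H₁ η₀ ζ₀ k) ∧
      -- where the `O_p(1)` term is of relatively small order, so is the law of `D`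
      (Tendsto (Dbar H₀ H₁ m η₀) atTop atTop →
        ApproxNormal P (fun k ω => pearsonD H₀ H₁ m k (X k ω)) (Dbar H₀ H₁ m η₀)
          (fun k => 4 * Dbar H₀ H₁ m η₀ k + 4 * m k * sTerm H₀ H₁ η₀ ζ₀ k)) ∧
      -- the four forms of `T_{H₀}` agree up to `O_p(m^{-1/2})`
      (∀ v : Form, IsBigOInProb P
        (fun k ω => H₀.Tmin m v k (X k ω) - H₀.Tmin m .pearson k (X k ω))
        (fun k => (√(m k))⁻¹)) ∧
      -- consequences of [CD3]
      ((∀ i, (fun k => H₀.mean m k (η₀ k) i - H₁.mean m k (ζ₀ k) i) =o[atTop]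
          (fun k => H₀.mean m k (η₀ k) i)) →
        (fun k => m k * sTerm H₀ H₁ η₀ ζ₀ k) =o[atTop] Dbar H₀ H₁ m η₀ ∧
        ApproxNormal P (fun k ω => D₁ H₀ H₁ m η₀ ζ₀ k + D₂ H₀ H₁ m η₀ ζ₀ k (X k ω))
          (Dbar H₀ H₁ m η₀) (fun k => 4 * Dbar H₀ H₁ m η₀ k) ∧
        (Tendsto (Dbar H₀ H₁ m η₀) atTop atTop →
          ApproxNormal P (fun k ω => pearsonD H₀ H₁ m k (X k ω)) (Dbar H₀ H₁ m η₀)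
            (fun k => 4 * Dbar H₀ H₁ m η₀ k) ∧
          ∀ v : Form,
            IsLittleOInProb P
              (fun k ω => H₁.Tmin m v k (X k ω) - H₁.Tmin m .pearson k (X k ω))
              (fun k ω => H₁.Tmin m .pearson k (X k ω)) ∧
            IsLittleOInProb P
              (fun k ω => DeltaT H₀ H₁ m v k (X k ω) - pearsonD H₀ H₁ m k (X k ω))
              (fun k ω => pearsonD H₀ H₁ m k (X k ω)) ∧
            (fun k => DeltaT H₀ H₁ m v k (H₀.mean m k (η₀ k))) ~[atTop] Dbar H₀ H₁ m η₀ ∧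
            ApproxNormal P (fun k ω => DeltaT H₀ H₁ m v k (X k ω))
              (fun k => DeltaT H₀ H₁ m v k (H₀.mean m k (η₀ k)))
              (fun k => 4 * |DeltaT H₀ H₁ m v k (H₀.mean m k (η₀ k))|)))) ∧
    -- `H₁` is the correct hypothesis
    (∀ (ζ₀ : ℕ → H₁.Param) (η₀ : ℕ → H₀.Param),
      H₁.IsTruth ζ₀ →
      H₀.IsBestFit (fun k => H₁.rate k (ζ₀ k)) η₀ →
      IsCountData P X (fun k => H₁.mean m k (ζ₀ k)) →
      (∀ i, (fun k => H₁.mean m k (ζ₀ k) i - H₀.mean m k (η₀ k) i) =o[atTop]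
          (fun k => H₁.mean m k (ζ₀ k) i)) →
      Tendsto (Dbar H₁ H₀ m ζ₀) atTop atTop →
      ∀ v : Form, ApproxNormal P (fun k ω => DeltaT H₀ H₁ m v k (X k ω))
        (fun k => DeltaT H₀ H₁ m v k (H₁.mean m k (ζ₀ k)))
        (fun k => 4 * |DeltaT H₀ H₁ m v k (H₁.mean m k (ζ₀ k))|)) := by
  refine ⟨fun η₀ ζ₀ ht hb hX hA0 => ⟨fun ηhat ζhat hη hζ k ω =>
      pearsonD_eq_of_isMinOn (hm_pos k) (hη k ω) (hζ k ω),
    fun ζhat hζ => isBigOInProb_norm_sub_of_isMinOn ht hb hX hm_pos hm hA0 hζ,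
    fun k => isLeast_D₁ hb (hm_pos k),
    fun k => ⟨(congr_fun (Dbar_eq_D₁ hb hm_pos) k).symm, pearsonD_mean ht hm_pos k⟩,
    Dbar_isBigO hb hm_pos hA0, isBigOInProb_D₂ ht hb hX hm_pos hm hA0,
    isBigOInProb_pearsonD_sub ht hb hX hm_pos hm hA0,
    approxNormal_D₂_div ht hb hX hm_pos hm, approxNormal_D₁_add_D₂ ht hb hX hm_pos hm,
    approxNormal_pearsonD ht hb hX hm_pos hm hA0,
    isBigOInProb_Tmin_sub_Tmin_pearson ht hX hm_pos hm, fun hCD3 => ?_⟩,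
    fun ζ₀ η₀ ht hb hX hCD3 hD v => ?_⟩
  · have hδ i := rateDiff_isLittleO_one ht hm_pos (hCD3 i)
    refine ⟨mul_sTerm_isLittleO hb hm_pos hδ,
      (approxNormal_D₁_add_D₂ ht hb hX hm_pos hm).four_mul_Dbar ht hb hm_pos hδ, fun hD =>
      ⟨(approxNormal_pearsonD ht hb hX hm_pos hm hA0 hD).four_mul_Dbar ht hb hm_pos hδ,
        fun v => ⟨isLittleOInProb_Tmin_sub_Tmin_pearson ht hb hX hm_pos hm hδ hD v,
          isLittleOInProb_deltaT_sub_pearsonD ht hb hX hm_pos hm hδ hD v,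
          deltaT_isEquivalent ht hb hm_pos hm (isNear_mul m _) hδ hD v, ?_⟩⟩⟩
    simpa only [one_mul, one_pow] using approxNormal_mul_deltaT ht hb hX hm_pos hm hδ hD v 1
  · have hδ i := rateDiff_isLittleO_one ht hm_pos (hCD3 i)
    have hneg k x : -DeltaT H₁ H₀ m v k x = DeltaT H₀ H₁ m v k x := neg_sub _ _
    simpa only [neg_one_sq, neg_one_mul, one_mul, hneg, ← abs_neg (DeltaT H₁ H₀ _ _ _ _)]
      using approxNormal_mul_deltaT ht hb hX hm_pos hm hδ hD v (-1)
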